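/- Let $(\mathcal A,\varphi,\varphi_2)$ be a second order non-commutative probability space: $\mathcal A$ is a unital $*$-algebra over $\mathbb C$; $\varphi:\mathcal A\to\mathbb C$ is linear and tracial with $\varphi(1)=1$; $\varphi_2:\mathcal A\times\mathcal A\to\mathbb C$ is bilinear, symmetric, tracial in each variable, and $\varphi_2(1,x)=\varphi_2(x,1)=0$ for all $x$. *Combinatorics.* $NC(n)$ is the set of non-crossing partitions of $[n]=\{1,\dots,n\}$, each regarded as the permutation whose cycles are its blocks in increasing order. For $\pi\in S_n$ let $|\pi|=n-\#(\pi)$, where $\#(\pi)$ is the number of cycles, and let $\gamma_{p,q}=(1,\dots,p)(p+1,\dots,p+q)$. For $p,q\ge1$, $S_{NC}(p,q)$ is the set of $\pi\in S_{p+q}$ having a cycle that meets both $[p]$ and $[p+1,p+q]$ and satisfying $|\gamma_{p,q}|+2=|\pi|+|\pi^{-1}\gamma_{p,q}|$. A partitioned permutation is a pair $(\mathcal V,\pi)$ of a partition $\mathcal V$ and a permutation $\pi$ such that each cycle of $\pi$ lies in a block of $\mathcal V$. $\mathcal{PS}_{NC}(p,q)$ consists of the pairs $(0_\pi,\pi)$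 with $\pi\in S_{NC}(p,q)$, where $0_\pi$ is the partition into the cycles of $\pi$, together with the pairs $(\mathcal V,\pi)$ in which $\pi=\pi_1\times\pi_2\in NC(p)\times NC([p+1,p+q])$ and $\mathcal V$ is obtained from $0_\pi$ by joining one cycle of $\pi_1$ with one cycle of $\pi_2$. *Cumulants.* The free cumulants $\kappa_n$ and the second order cumulants $\kappa_{m,n}$ are determined recursively by $$\varphi(a_1\cdots a_n)=\sum_{\pi\in NC(n)}\kappa_\pi(a_1,\dots,a_n),\qquad \varphi_2(a_1\cdots a_m,a_{m+1}\cdots a_{m+n})=\sum_{(\mathcal V,\pi)\in\mathcal{PS}_{NC}(m,n)}\kappa_{(\mathcal V,\pi)}(a_1,\dots,a_{m+n}).$$ Here $\kappa_\pi$ and $\kappa_{(\mathcal V,\pi)}$ are multiplicative: a block that is one cycle $(i_1,\dots,i_k)$ of $\pi$ contributes the factor $\kappa_k(a_{i_1},\dots,a_{i_k})$, and a block that is the union of a cycle $(i_1,\dots,i_k)$ in $[m]$ and a cycle $(j_1,\dots,j_l)$ in $[m+1,m+n]$ contributes $\kappa_{k,l}(a_{i_1},\dots,a_{i_k},a_{j_1},\dots,a_{j_l})$.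 Let $a\in\mathcal A$ be second order $R$-diagonal, i.e. all cumulants $\kappa_n$ and $\kappa_{m,n}$ with entries in $\{a,a^*\}$ vanish except possibly $\kappa_{2n}(a,a^*,\dots,a,a^*)=\kappa_{2n}(a^*,a,\dots,a^*,a)$ and the $\kappa_{2m,2n}$ in which the entries alternate between $a$ and $a^*$ within the first $2m$ and within the last $2n$ places; by traciality the latter all equal $\kappa_{2m,2n}(a,a^*,\dots,a,a^*)$. Let $$\beta_n=\kappa_{2n}(a,a^*,\dots,a,a^*),\qquad \beta_{p,q}=\kappa_{2p,2q}(a,a^*,\dots,a,a^*)$$ be its determining sequences. For $(\mathcal V,\pi)\in\mathcal{PS}_{NC}(p,q)$ let $\beta_{(\mathcal V,\pi)}$ be the product over the blocks of $\mathcal V$ of $\beta_k$ for a block that is one cycle of $\pi$ of length $k$, and $\beta_{k,l}$ for a block that is the union of a cycle of length $k$ in $[p]$ and a cycle of length $l$ in $[p+1,p+q]$. **Theorem.** For all $p,q\ge1$, $$\kappa_{p,q}(aa^*,\dots,aa^*)=\sum_{(\mathcal V,\pi)\in\mathcal{PS}_{NC}(p,q)}\beta_{(\mathcal V,\pi)}.$$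 -/

import Mathlib

open Equiv

noncomputable section

namespace SecondOrderFree

/-! ### Cycles of permutations of `[n]`

The set `[n] = {1, …, n}` is `Fin n`, and `[m + n]` with its two circles `[m]` and
`[m + 1, m + n]` is `Fin (m + n)`. -/

/-- The cycle of `π` through `x`, read from `x`: the word `x, π x, π (π x), …`
(a fixed point gives the word `x`). -/
def cycleWord {n : ℕ} (π : Perm (Fin n)) (x : Fin n) : List (Fin n) :=
  List.iterate π x (Function.minimalPeriod π x)

/-- `x` is the smallest element of its cycle; every cycle has exactly one such element. -/
def IsCycleMin {n : ℕ} (π : Perm (Fin n)) (x : Fin n) : Prop :=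
  ∀ y, π.SameCycle x y → x ≤ y

open Classical in
/-- The product of `f c` over all cycles `c` of `π`, fixed points included, each cycle being
read from its smallest element. -/
def cycleProd {n : ℕ} (π : Perm (Fin n)) (f : List (Fin n) → ℂ) : ℂ :=
  ∏ x with IsCycleMin π x, f (cycleWord π x)

/-- The number `#(π)` of cycles of `π`, fixed points included. -/
def numCycles {n : ℕ} (π : Perm (Fin n)) : ℕ :=
  Nat.card (Quotient (Perm.SameCycle.setoid π))

/-- The length `|π| = n - #(π)`. -/
def permLength {n : ℕ} (π : Perm (Fin n)) : ℕ := n - numCycles π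

/-! ### Non-crossing partitions and non-crossing annular permutations -/

/-- `π` is the permutation of a non-crossing partition of `[n]`: each cycle runs through its
elements in increasing order (`π i` is the next larger element of the cycle of `i` or, if `i`
is the largest one, the smallest one), and the partition into cycles has no crossing. -/
structure IsNC {n : ℕ} (π : Perm (Fin n)) : Prop where
  increasing : ∀ i, (i < π i ∧ ∀ j, π.SameCycle i j → j ≤ i ∨ π i ≤ j) ∨
    (∀ j, π.SameCycle i j → π i ≤ j ∧ j ≤ i)
  noncrossing : ∀ i j k l, i < j → j < k → k < l →
    π.SameCycle i k → π.SameCycle j l → π.SameCycle i j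

open Classical in
/-- `NC(n)`, as a set of permutations. -/
def NC (n : ℕ) : Finset (Perm (Fin n)) := Finset.univ.filter IsNC

/-- `π₁ × π₂`, which acts as `π₁` on `[m]` and as `π₂` on `[m + 1, m + n]`. -/
def prodPerm {m n : ℕ} (π₁ : Perm (Fin m)) (π₂ : Perm (Fin n)) : Perm (Fin (m + n)) :=
  finSumFinEquiv.permCongr (Equiv.sumCongr π₁ π₂)

/-- The permutation `γ_{m,n} = (1, …, m)(m + 1, …, m + n)`. -/
def annularRotation (m n : ℕ) : Perm (Fin (m + n)) := prodPerm (finRotate m) (finRotate n)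

/-- The non-crossing annular permutations `S_NC(m,n)`: some cycle of `π` meets both circles,
and `|γ_{m,n}| + 2 = |π| + |π⁻¹ γ_{m,n}|`. -/
def IsNCAnnular (m n : ℕ) (π : Perm (Fin (m + n))) : Prop :=
  (∃ (i : Fin m) (j : Fin n), π.SameCycle (Fin.castAdd n i) (Fin.natAdd m j)) ∧
    permLength (annularRotation m n) + 2
      = permLength π + permLength (π⁻¹ * annularRotation m n)

/-! ### Partitioned permutations -/

/-- A partitioned permutation `(𝒰, π)` of `[n]`: a partition `𝒰` of `[n]`, given by its
equivalence relation, and a permutation `π` each of whose cycles lies in a block of `𝒰`. -/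
@[ext] structure PartitionedPerm (n : ℕ) where
  part : Setoid (Fin n)
  perm : Perm (Fin n)
  le : Perm.SameCycle.setoid perm ≤ part

instance (n : ℕ) : Finite (PartitionedPerm n) :=
  Finite.of_injective
    (fun P : PartitionedPerm n => ((fun i j => P.part i j : Fin n → Fin n → Prop), P.perm))
    (by
      intro P Q h
      rw [Prod.mk.injEq] at h
      refine PartitionedPerm.ext (Setoid.ext fun i j => ?_) h.2
      exact iff_of_eq (congrFun (congrFun h.1 i) j))

instance (n : ℕ) : Fintype (PartitionedPerm n) := Fintype.ofFinite _

/-- `𝒰` arises from the partition into the cycles of `π` by joining the cycle of `x` with the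
cycle of `y`. -/
def PartitionedPerm.JoinsCycles {n : ℕ} (P : PartitionedPerm n) (x y : Fin n) : Prop :=
  ∀ i j, P.part i j ↔ P.perm.SameCycle i j ∨
    ((P.perm.SameCycle x i ∨ P.perm.SameCycle y i) ∧
      (P.perm.SameCycle x j ∨ P.perm.SameCycle y j))

/-- The pairs `(0_π, π)` with `π ∈ S_NC(m,n)`, where `0_π` is the partition into the cycles
of `π`. -/
def IsAnnularPair (m n : ℕ) (P : PartitionedPerm (m + n)) : Prop :=
  IsNCAnnular m n P.perm ∧ P.part = Perm.SameCycle.setoid P.perm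

/-- `𝒫𝒮_NC(m,n)'`: the pairs `(𝒰, π)` with `π = π₁ × π₂ ∈ NC(m) × NC(n)` whose partition `𝒰`
arises by joining one cycle of `π₁` with one cycle of `π₂`. -/
def IsMarkedPair (m n : ℕ) (P : PartitionedPerm (m + n)) : Prop :=
  (∃ π₁ ∈ NC m, ∃ π₂ ∈ NC n, P.perm = prodPerm π₁ π₂) ∧
    ∃ (x : Fin m) (y : Fin n), P.JoinsCycles (Fin.castAdd n x) (Fin.natAdd m y)

open Classical in
/-- `𝒫𝒮_NC(m,n) = S_NC(m,n) ∪ 𝒫𝒮_NC(m,n)'`. -/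
def PSNC (m n : ℕ) : Finset (PartitionedPerm (m + n)) :=
  Finset.univ.filter fun P => IsAnnularPair m n P ∨ IsMarkedPair m n P

/-- The pair `(1_{m+n}, γ_{m,n})`. -/
def topPair (m n : ℕ) : PartitionedPerm (m + n) := ⟨⊤, annularRotation m n, le_top⟩

open Classical in
/-- The factor of a block `B` of `𝒰` in a multiplicative function: `f c` if `B` is one cycle
`c` of `π`, and `g c d` if `B` is the union of two cycles `c` and `d`, where `c` has the
smaller least element (for pairs in `𝒫𝒮_NC(m,n)'`: `c` lies in `[m]` and `d` in
`[m + 1, m + n]`). Blocks with more cycles do not occur in `𝒫𝒮_NC(m,n)`. -/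
def blockFactor {n : ℕ} (π : Perm (Fin n)) (f : List (Fin n) → ℂ)
    (g : List (Fin n) → List (Fin n) → ℂ) (B : Finset (Fin n)) : ℂ :=
  match (B.filter (IsCycleMin π)).sort with
  | [x] => f (cycleWord π x)
  | [x, y] => g (cycleWord π x) (cycleWord π y)
  | _ => 0

open Classical in
/-- The multiplicative function of `(𝒰, π)`: the product of the factors of all blocks
of `𝒰`. The blocks are listed by their least elements. -/
def PartitionedPerm.blockProd {n : ℕ} (P : PartitionedPerm n) (f : List (Fin n) → ℂ)
    (g : List (Fin n) → List (Fin n) → ℂ) : ℂ :=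
  ∏ x with (∀ y, P.part x y → x ≤ y), blockFactor P.perm f g {y | P.part x y}

/-! ### Second order probability spaces and their cumulants -/

/-- A second order probability space `(A, φ, φ₂)` over a unital algebra `A`. -/
structure SecondOrderSpace (A : Type*) [Ring A] [Algebra ℂ A] where
  φ : A →ₗ[ℂ] ℂ
  φ₂ : A →ₗ[ℂ] A →ₗ[ℂ] ℂ
  map_one : φ 1 = 1
  tracial : ∀ a b, φ (a * b) = φ (b * a)
  symm₂ : ∀ a b, φ₂ a b = φ₂ b a
  tracial₂ : ∀ a b c, φ₂ (a * b) c = φ₂ (b * a) c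
  map_one₂ : ∀ a, φ₂ 1 a = 0

namespace SecondOrderSpace

section

variable {A : Type*} [Ring A] [Algebra ℂ A] (S : SecondOrderSpace A)

open Classical in
/-- The free cumulant `κ_n(a₁, …, a_n)` of the word `w = [a₁, …, a_n]`, by recursion on `n`:
the moment-cumulant formula `φ(a₁ ⋯ a_n) = ∑_{π ∈ NC(n)} κ_π(a₁, …, a_n)` is solved for the
term of the partition with one block. The test on the length only serves the recursion: it
succeeds for each cycle of each of the other partitions. -/
def cumulant (w : List A) : ℂ :=
  S.φ w.prod - ∑ π ∈ (NC w.length).erase (finRotate w.length),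
    cycleProd π fun c => if _ : c.length < w.length then cumulant (c.map w.get) else 0
termination_by w.length
decreasing_by simpa

/-- The entries `a₁, …, a_{m+n}` on the two circles, given by the words `[a₁, …, a_m]` and
`[a_{m+1}, …, a_{m+n}]`. -/
def entries (v w : List A) : Fin (v.length + w.length) → A := Fin.append v.get w.get

open Classical in
/-- The second order cumulant `κ_{m,n}(a₁, …, a_m, a_{m+1}, …, a_{m+n})` of the two words
`v = [a₁, …, a_m]` and `w = [a_{m+1}, …, a_{m+n}]`, by recursion on `m + n`: the
moment-cumulant formula
`φ₂(a₁ ⋯ a_m, a_{m+1} ⋯ a_{m+n}) = ∑_{(𝒰, π) ∈ 𝒫𝒮_NC(m,n)} κ_{(𝒰,π)}(a₁, …, a_{m+n})`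
is solved for the term of `(1_{m+n}, γ_{m,n})`. The test on the lengths only serves the
recursion: it succeeds in each of the other terms. -/
def cumulant₂ (v w : List A) : ℂ :=
  S.φ₂ v.prod w.prod - ∑ P ∈ (PSNC v.length w.length).erase (topPair v.length w.length),
    P.blockProd (fun c => S.cumulant (c.map (entries v w)))
      fun c d => if _ : c.length + d.length < v.length + w.length then
        cumulant₂ (c.map (entries v w)) (d.map (entries v w)) else 0
termination_by v.length + w.length
decreasing_by simpa

end

end SecondOrderSpace

/-! ### The cumulants satisfy the moment-cumulant formulas

The theorems `moment_cumulant` and `moment_cumulant₂` show that the two recursions above solve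
the moment-cumulant formulas; the rest of this part prepares their proofs. -/

section
variable {n : ℕ}

theorem length_cycleWord (π : Perm (Fin n)) (x : Fin n) :
    (cycleWord π x).length = Function.minimalPeriod π x := by simp [cycleWord]

theorem mem_cycleWord (π : Perm (Fin n)) (x y : Fin n) :
    y ∈ cycleWord π x ↔ π.SameCycle x y := by
  have hp : x ∈ Function.periodicPts π :=
    Function.Injective.mem_periodicPts π.injective x
  rw [cycleWord, List.mem_iterate]
  constructor
  · rintro ⟨k, -, rfl⟩
    exact ⟨k, by simp [← Perm.iterate_eq_pow]⟩
  · rintro h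
    obtain ⟨k, -, rfl⟩ := h.exists_pow_eq'
    refine ⟨k % Function.minimalPeriod π x, Nat.mod_lt _ (Function.minimalPeriod_pos_of_mem_periodicPts hp), ?_⟩
    rw [Function.iterate_mod_minimalPeriod_eq, Perm.iterate_eq_pow]

theorem nodup_cycleWord (π : Perm (Fin n)) (x : Fin n) : (cycleWord π x).Nodup := by
  rw [List.nodup_iff_injective_get]
  intro i j h
  have hi := i.2.trans_eq (length_cycleWord π x)
  have hj := j.2.trans_eq (length_cycleWord π x)
  have hg : ∀ k : Fin (cycleWord π x).length, (cycleWord π x).get k = π^[k.1] x := fun k => by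
    rw [List.get_eq_getElem]; exact List.getElem_iterate ..
  rw [hg, hg] at h
  exact Fin.ext (Function.iterate_injOn_Iio_minimalPeriod hi hj h)

theorem sameCycle_finRotate (i j : Fin n) : (finRotate n).SameCycle i j := by
  rcases n with _ | n
  · exact i.elim0
  have h0 : ∀ (k : ℕ) (hk : k < n + 1), (finRotate (n+1)).SameCycle 0 ⟨k, hk⟩ := by
    intro k
    induction k with
    | zero => intro _; exact Perm.SameCycle.refl _ _
    | succ k ih =>
      intro hk
      have h2 := ih (by omega)
      rw [← Perm.sameCycle_apply_right] at h2
      convert h2 using 1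
      rw [finRotate_of_lt (by omega)]
  exact (h0 i i.2).symm.trans (h0 j j.2)

theorem isNC_finRotate : IsNC (finRotate n) := by
  rcases n with _ | n
  · exact ⟨fun i => i.elim0, fun i => i.elim0⟩
  refine ⟨fun i => ?_, fun i j k l _ _ _ _ _ => sameCycle_finRotate i j⟩
  rcases Nat.lt_or_ge i.1 n with h | h
  · left
    have : finRotate (n+1) i = ⟨i + 1, by omega⟩ := finRotate_of_lt h
    rw [this]
    simp only [Fin.lt_def, Fin.le_def]
    exact ⟨by omega, fun j _ => by omega⟩
  · right
    obtain rfl : i = Fin.last n := Fin.ext (by simp; omega)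
    intro j _
    simp [Fin.le_last]

theorem eq_finRotate {π : Perm (Fin n)} (h : IsNC π)
    (hc : ∀ i j, π.SameCycle i j) : π = finRotate n := by
  rcases n with _ | n
  · exact Subsingleton.elim _ _
  ext i
  rcases h.increasing i with ⟨h1, h2⟩ | h1
  · have hi : i.1 < n := by have := (π i).2; rw [Fin.lt_def] at h1; omega
    have := h2 ⟨i + 1, by omega⟩ (hc _ _)
    have h3 : finRotate (n+1) i = ⟨i + 1, by omega⟩ := finRotate_of_lt hi
    rw [h3]
    simp only [Fin.lt_def, Fin.le_def] at *
    omega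
  · have h3 := (h1 (Fin.last n) (hc _ _)).2
    have h4 := (h1 0 (hc _ _)).1
    obtain rfl : i = Fin.last n := le_antisymm (Fin.le_last _) h3
    simpa using h4

theorem length_cycleWord_le (π : Perm (Fin n)) (x : Fin n) : (cycleWord π x).length ≤ n := by
  simpa using (nodup_cycleWord π x).length_le_card

theorem length_cycleWord_lt {π : Perm (Fin n)} (h : IsNC π) (hne : π ≠ finRotate n)
    (x : Fin n) : (cycleWord π x).length < n := by
  classical
  refine lt_of_le_of_ne (length_cycleWord_le π x) fun he => hne (eq_finRotate h ?_)
  have hu : (cycleWord π x).toFinset = Finset.univ := by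
    rw [← Finset.card_eq_iff_eq_univ, List.toFinset_card_of_nodup (nodup_cycleWord π x), he]
    simp
  have hx : ∀ i, π.SameCycle x i := fun i => by
    rw [← mem_cycleWord, ← List.mem_toFinset, hu]; exact Finset.mem_univ i
  exact fun i j => (hx i).symm.trans (hx j)

theorem cycleWord_eq_of_forall (π : Perm (Fin n)) (x : Fin n) (h : ∀ y, π.SameCycle x y) :
    (cycleWord π x).length = n := by
  classical
  rw [← List.toFinset_card_of_nodup (nodup_cycleWord π x),
    Finset.eq_univ_of_forall (s := (cycleWord π x).toFinset), Finset.card_fin]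
  intro y
  rw [List.mem_toFinset, mem_cycleWord]; exact h y

theorem cycleWord_finRotate : cycleWord (finRotate (n+1)) 0 = List.finRange (n+1) := by
  have hl := cycleWord_eq_of_forall (finRotate (n+1)) 0 (sameCycle_finRotate 0)
  have hk : ∀ (k : ℕ) (hk : k < n + 1), (finRotate (n+1))^[k] 0 = ⟨k, hk⟩ := by
    intro k
    induction k with
    | zero => intro _; rfl
    | succ k ih =>
      intro hk
      rw [Function.iterate_succ_apply', ih (by omega), finRotate_of_lt (by omega)]
  refine List.ext_getElem (by simpa using hl) fun k h1 h2 => ?_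
  simp only [cycleWord, List.getElem_iterate, List.getElem_finRange]
  rw [hk k (by omega)]; rfl

theorem cycleProd_finRotate (hn : 0 < n) (f : List (Fin n) → ℂ) :
    cycleProd (finRotate n) f = f (List.finRange n) := by
  classical
  obtain ⟨n, rfl⟩ := Nat.exists_eq_succ_of_ne_zero hn.ne'
  rw [cycleProd, ← cycleWord_finRotate, Finset.prod_eq_single_of_mem (0 : Fin (n + 1))]
  · exact Finset.mem_filter.2 ⟨Finset.mem_univ _, fun y _ => Fin.zero_le y⟩
  · intro b hb hb0
    rw [Finset.mem_filter] at hb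
    exact absurd (Fin.le_zero_iff.1 (hb.2 0 (sameCycle_finRotate b 0))) hb0

end

section

variable {A : Type*} [Ring A] [Algebra ℂ A] (S : SecondOrderSpace A)

/-- The moment-cumulant formula. -/
theorem SecondOrderSpace.moment_cumulant (w : List A) :
    S.φ w.prod = ∑ π ∈ NC w.length, cycleProd π fun c => S.cumulant (c.map w.get) := by
  classical
  rw [← Finset.add_sum_erase _ _ (show finRotate w.length ∈ NC w.length by
    simp [NC, isNC_finRotate])]
  have h1 : cycleProd (finRotate w.length) (fun c => S.cumulant (c.map w.get)) =
      S.cumulant w := by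
    rcases eq_or_ne w [] with rfl | hw
    · rw [SecondOrderSpace.cumulant, Finset.sum_eq_zero]
      · simp [cycleProd, S.map_one]
      · intro π hπ
        exact absurd (Equiv.ext fun i => i.elim0) (Finset.ne_of_mem_erase hπ)
    · rw [cycleProd_finRotate (List.length_pos_iff.2 hw), List.map_get_finRange]
  rw [h1, SecondOrderSpace.cumulant]
  rw [sub_add_eq_add_sub, eq_comm, sub_eq_iff_eq_add, add_right_inj]
  refine Finset.sum_congr rfl fun π hπ => Finset.prod_congr rfl fun x _ => ?_
  rw [Finset.mem_erase, NC, Finset.mem_filter] at hπ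
  beta_reduce
  rw [dif_pos (length_cycleWord_lt hπ.2.2 hπ.1 x)]

section annulus

variable {m n : ℕ}

theorem prodPerm_castAdd (π₁ : Perm (Fin m)) (π₂ : Perm (Fin n)) (x : Fin m) :
    prodPerm π₁ π₂ (Fin.castAdd n x) = Fin.castAdd n (π₁ x) := by
  simp [prodPerm, Equiv.permCongr_apply]

theorem prodPerm_natAdd (π₁ : Perm (Fin m)) (π₂ : Perm (Fin n)) (x : Fin n) :
    prodPerm π₁ π₂ (Fin.natAdd m x) = Fin.natAdd m (π₂ x) := by
  simp [prodPerm, Equiv.permCongr_apply]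

theorem cycleWord_semiconj {k l : ℕ} {π : Perm (Fin k)} {σ : Perm (Fin l)} {h : Fin k → Fin l}
    (hh : Function.Injective h) (hs : Function.Semiconj h π σ) (x : Fin k) :
    cycleWord σ (h x) = (cycleWord π x).map h := by
  have hp : Function.minimalPeriod σ (h x) = Function.minimalPeriod π x := by
    rw [Function.minimalPeriod_eq_minimalPeriod_iff]
    intro j
    rw [Function.IsPeriodicPt, Function.IsPeriodicPt, Function.IsFixedPt, Function.IsFixedPt,
      ← (hs.iterate_right j).eq, hh.eq_iff]
  refine List.ext_getElem (by simp [cycleWord, hp]) fun j h1 h2 => ?_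
  simp only [cycleWord, List.getElem_iterate, List.getElem_map]
  exact ((hs.iterate_right j).eq x).symm

theorem cycleWord_prodPerm_castAdd (π₁ : Perm (Fin m)) (π₂ : Perm (Fin n)) (x : Fin m) :
    cycleWord (prodPerm π₁ π₂) (Fin.castAdd n x) = (cycleWord π₁ x).map (Fin.castAdd n) :=
  cycleWord_semiconj (Fin.castAdd_injective m n)
    (fun y => (prodPerm_castAdd π₁ π₂ y).symm) x

theorem cycleWord_prodPerm_natAdd (π₁ : Perm (Fin m)) (π₂ : Perm (Fin n)) (x : Fin n) :
    cycleWord (prodPerm π₁ π₂) (Fin.natAdd m x) = (cycleWord π₂ x).map (Fin.natAdd m) :=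
  cycleWord_semiconj (Fin.natAdd_injective n m)
    (fun y => (prodPerm_natAdd π₁ π₂ y).symm) x

theorem annular_left (i : Fin m) (j : Fin (m + n)) :
    (annularRotation m n).SameCycle (Fin.castAdd n i) j ↔ ∃ k : Fin m, j = Fin.castAdd n k := by
  rw [← mem_cycleWord, annularRotation, cycleWord_prodPerm_castAdd, List.mem_map]
  simp only [mem_cycleWord, sameCycle_finRotate, true_and, eq_comm]

theorem annular_right (i : Fin n) (j : Fin (m + n)) :
    (annularRotation m n).SameCycle (Fin.natAdd m i) j ↔ ∃ k : Fin n, j = Fin.natAdd m k := by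
  rw [← mem_cycleWord, annularRotation, cycleWord_prodPerm_natAdd, List.mem_map]
  simp only [mem_cycleWord, sameCycle_finRotate, true_and, eq_comm]

theorem topPair_joins (x : Fin m) (y : Fin n) :
    (topPair m n).JoinsCycles (Fin.castAdd n x) (Fin.natAdd m y) := by
  intro i j
  have h : ∀ i : Fin (m + n), (annularRotation m n).SameCycle (Fin.castAdd n x) i ∨
      (annularRotation m n).SameCycle (Fin.natAdd m y) i := by
    intro i
    rw [annular_left, annular_right]
    induction i using Fin.addCases with
    | left i => exact Or.inl ⟨i, rfl⟩
    | right i => exact Or.inr ⟨i, rfl⟩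
  exact iff_of_true trivial (Or.inr ⟨h i, h j⟩)

theorem topPair_mem (hm : 0 < m) (hn : 0 < n) : topPair m n ∈ PSNC m n := by
  classical
  rw [PSNC, Finset.mem_filter]
  exact ⟨Finset.mem_univ _, Or.inr ⟨⟨finRotate m, by simp [NC, isNC_finRotate], finRotate n,
    by simp [NC, isNC_finRotate], rfl⟩, ⟨0, hm⟩, ⟨0, hn⟩, topPair_joins _ _⟩⟩

theorem blockProd_topPair (hm : 0 < m) (hn : 0 < n) (f : List (Fin (m + n)) → ℂ)
    (g : List (Fin (m + n)) → List (Fin (m + n)) → ℂ) :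
    (topPair m n).blockProd f g =
      g ((List.finRange m).map (Fin.castAdd n)) ((List.finRange n).map (Fin.natAdd m)) := by
  classical
  obtain ⟨m, rfl⟩ := Nat.exists_eq_succ_of_ne_zero hm.ne'
  obtain ⟨n, rfl⟩ := Nat.exists_eq_succ_of_ne_zero hn.ne'
  rw [PartitionedPerm.blockProd, Finset.prod_eq_single_of_mem (Fin.castAdd (n + 1) 0)]
  · have h1 : ((Finset.univ.filter fun y =>
        (topPair (m + 1) (n + 1)).part (Fin.castAdd (n + 1) 0) y).filter
          (IsCycleMin (annularRotation (m + 1) (n + 1)))) =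
        {Fin.castAdd (n + 1) 0, Fin.natAdd (m + 1) 0} := by
      ext y
      have : (topPair (m + 1) (n + 1)).part (Fin.castAdd (n + 1) 0) y := trivial
      simp only [Finset.mem_filter, Finset.mem_univ, true_and, this, IsCycleMin,
        Finset.mem_insert, Finset.mem_singleton]
      induction y using Fin.addCases with
      | left i =>
        simp only [annular_left]
        constructor
        · intro h
          left
          have := h _ ⟨0, rfl⟩
          simp only [Fin.le_def, Fin.ext_iff, Fin.val_castAdd, Fin.val_zero] at *
          omega
        · rintro (h | h)
          · rintro _ ⟨k, rfl⟩
            simp only [Fin.le_def, Fin.ext_iff, Fin.val_castAdd, Fin.val_zero] at *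
            omega
          · have := i.2
            simp only [Fin.ext_iff, Fin.val_castAdd, Fin.val_natAdd] at h
            omega
      | right i =>
        simp only [annular_right]
        constructor
        · intro h
          right
          have := h _ ⟨0, rfl⟩
          simp only [Fin.le_def, Fin.ext_iff, Fin.val_natAdd, Fin.val_zero] at *
          omega
        · rintro (h | h)
          · simp only [Fin.ext_iff, Fin.val_castAdd, Fin.val_natAdd, Fin.val_zero] at h
            omega
          · rintro _ ⟨k, rfl⟩
            simp only [Fin.le_def, Fin.ext_iff, Fin.val_natAdd, Fin.val_zero] at *
            omega
    have h2 : (({Fin.castAdd (n + 1) 0, Fin.natAdd (m + 1) 0} :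
        Finset (Fin (m + 1 + (n + 1))))).sort =
        [Fin.castAdd (n + 1) 0, Fin.natAdd (m + 1) 0] := by
      rw [Finset.sort_insert]
      · simp
      · simp [Fin.le_def]
      · simp [Fin.ext_iff]
    have h3 : (topPair (m + 1) (n + 1)).perm = annularRotation (m + 1) (n + 1) := rfl
    rw [blockFactor, h3, h1, h2]
    simp only [annularRotation, cycleWord_prodPerm_castAdd, cycleWord_prodPerm_natAdd,
      cycleWord_finRotate]
  · rw [Finset.mem_filter]
    exact ⟨Finset.mem_univ _, fun y _ => by simp [Fin.le_def]⟩
  · intro b hb hb0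
    rw [Finset.mem_filter] at hb
    have := hb.2 (Fin.castAdd (n + 1) 0) trivial
    exact absurd (Fin.ext (by simpa [Fin.le_def] using this)) hb0

theorem length_add_lt {P : PartitionedPerm (m + n)} (hP : P ∈ PSNC m n)
    (hne : P ≠ topPair m n) {x y : Fin (m + n)} (hxy : P.part x y)
    (hc : ¬ P.perm.SameCycle x y) :
    (cycleWord P.perm x).length + (cycleWord P.perm y).length < m + n := by
  classical
  rw [PSNC, Finset.mem_filter] at hP
  rcases hP.2 with ⟨-, h⟩ | ⟨⟨π₁, h₁, π₂, h₂, hπ⟩, i, j, hJ⟩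
  · rw [h] at hxy; exact absurd hxy hc
  rw [NC, Finset.mem_filter] at h₁ h₂
  have hlen : ∀ {u v : Fin (m + n)}, P.perm.SameCycle u v →
      (cycleWord P.perm u).length = (cycleWord P.perm v).length := by
    intro u v huv
    rw [← List.toFinset_card_of_nodup (nodup_cycleWord _ u),
      ← List.toFinset_card_of_nodup (nodup_cycleWord _ v)]
    congr 1
    ext z
    rw [List.mem_toFinset, List.mem_toFinset, mem_cycleWord, mem_cycleWord]
    exact ⟨huv.symm.trans, huv.trans⟩
  have hsum : (cycleWord P.perm x).length + (cycleWord P.perm y).length =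
      (cycleWord π₁ i).length + (cycleWord π₂ j).length := by
    have e1 : (cycleWord P.perm (Fin.castAdd n i)).length = (cycleWord π₁ i).length := by
      rw [hπ, cycleWord_prodPerm_castAdd, List.length_map]
    have e2 : (cycleWord P.perm (Fin.natAdd m j)).length = (cycleWord π₂ j).length := by
      rw [hπ, cycleWord_prodPerm_natAdd, List.length_map]
    rw [← e1, ← e2]
    rcases (hJ x y).1 hxy with h | ⟨h | h, h' | h'⟩
    · exact absurd h hc
    · exact absurd (h.symm.trans h') hc
    · rw [hlen h, hlen h']
    · rw [hlen h, hlen h', add_comm]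
    · exact absurd (h.symm.trans h') hc
  rw [hsum]
  by_cases e1 : π₁ = finRotate m
  · by_cases e2 : π₂ = finRotate n
    · refine absurd (PartitionedPerm.ext (Setoid.ext fun u v => ?_) ?_) hne
      · rw [hJ, (topPair_joins i j) u v, hπ, e1, e2]; rfl
      · rw [hπ, e1, e2]; rfl
    · exact add_lt_add_of_le_of_lt (length_cycleWord_le _ _) (length_cycleWord_lt h₂.2 e2 _)
  · exact add_lt_add_of_lt_of_le (length_cycleWord_lt h₁.2 e1 _) (length_cycleWord_le _ _)

theorem blockProd_congr {P : PartitionedPerm (m + n)} (hP : P ∈ PSNC m n)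
    (hne : P ≠ topPair m n) (f : List (Fin (m + n)) → ℂ)
    {g g' : List (Fin (m + n)) → List (Fin (m + n)) → ℂ}
    (h : ∀ c d, c.length + d.length < m + n → g c d = g' c d) :
    P.blockProd f g = P.blockProd f g' := by
  classical
  refine Finset.prod_congr rfl fun x _ => ?_
  rw [blockFactor, blockFactor]
  split
  · rfl
  · rename_i u v huv
    have hmem : ∀ z ∈ [u, v], P.part x z ∧ IsCycleMin P.perm z := by
      intro z hz
      rw [← huv, Finset.mem_sort, Finset.mem_filter, Finset.mem_filter] at hz
      exact ⟨hz.1.2, hz.2⟩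
    have hu := hmem u (by simp)
    have hv := hmem v (by simp)
    have hnd := Finset.sort_nodup (r := (· ≤ ·)) ((Finset.univ.filter fun y => P.part x y).filter
      (IsCycleMin P.perm))
    rw [huv] at hnd
    refine h _ _ (length_add_lt hP hne (P.part.trans (P.part.symm hu.1) hv.1) fun hs => ?_)
    have : u = v := le_antisymm (hu.2 v hs) (hv.2 u hs.symm)
    simp [this] at hnd
  · rfl

end annulus

/-- The second order moment-cumulant formula. -/
theorem SecondOrderSpace.moment_cumulant₂ (v w : List A) (hv : v ≠ []) (hw : w ≠ []) :
    S.φ₂ v.prod w.prod = ∑ P ∈ PSNC v.length w.length,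
      P.blockProd (fun c => S.cumulant (c.map (SecondOrderSpace.entries v w)))
        fun c d => S.cumulant₂ (c.map (SecondOrderSpace.entries v w))
          (d.map (SecondOrderSpace.entries v w)) := by
  classical
  have hv' := List.length_pos_iff.2 hv
  have hw' := List.length_pos_iff.2 hw
  rw [← Finset.add_sum_erase _ _ (topPair_mem hv' hw'), blockProd_topPair hv' hw',
    List.map_map, List.map_map]
  have e1 : SecondOrderSpace.entries v w ∘ Fin.castAdd w.length = v.get := by
    funext i; simp [SecondOrderSpace.entries]
  have e2 : SecondOrderSpace.entries v w ∘ Fin.natAdd v.length = w.get := by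
    funext i; simp [SecondOrderSpace.entries]
  rw [e1, e2, List.map_get_finRange, List.map_get_finRange, SecondOrderSpace.cumulant₂,
    sub_add_eq_add_sub, eq_comm, sub_eq_iff_eq_add, add_right_inj]
  refine Finset.sum_congr rfl fun P hP => ?_
  rw [Finset.mem_erase] at hP
  refine blockProd_congr hP.2 hP.1 _ fun c d h => ?_
  rw [dif_pos h]

end

namespace SecondOrderSpace

/-! ### Second order `R`-diagonal elements -/

variable {A : Type*} [Ring A] [StarRing A] [Algebra ℂ A] (S : SecondOrderSpace A)

/-- `a^{(1)} = a` and `a^{(-1)} = a*`. -/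
def signed (a : A) (ε : ℤˣ) : A := if ε = 1 then a else star a

/-- A word of signs that alternates and has even length. -/
def EvenAlternating (ε : List ℤˣ) : Prop := Even ε.length ∧ ε.IsChain (· ≠ ·)

/-- `a` is second order `R`-diagonal: all first and second order `*`-cumulants of `a` vanish,
except possibly those in which each word has even length and alternates between `a` and `a*`.
(As `φ` and `φ₂` are tracial, cumulants do not change under cyclic rotation of a word, so it
does not matter whether a word starts with `a` or with `a*`.) -/
structure IsRDiagonal (a : A) : Prop where
  first : ∀ ε : List ℤˣ, ¬ EvenAlternating ε → S.cumulant (ε.map (signed a)) = 0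
  second : ∀ ε δ : List ℤˣ, ¬ (EvenAlternating ε ∧ EvenAlternating δ) →
    S.cumulant₂ (ε.map (signed a)) (δ.map (signed a)) = 0

/-- The word `a, a*, …, a, a*` of length `2n`. -/
def altWord (a : A) (n : ℕ) : List A := (List.replicate n [a, star a]).flatten

/-- `β_n = κ_{2n}(a, a*, …, a, a*)`. -/
def β (a : A) (n : ℕ) : ℂ := S.cumulant (altWord a n)

/-- `β_{p,q} = κ_{2p,2q}(a, a*, …, a, a*)`. -/
def β₂ (a : A) (p q : ℕ) : ℂ := S.cumulant₂ (altWord a p) (altWord a q)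

/-- `β_{(𝒱,π)}`: a block of `𝒱` that is one cycle of length `k` has the factor `β_k`, one that
is the union of cycles of lengths `k` and `l` has the factor `β_{k,l}`. -/
def βPair (a : A) {n : ℕ} (P : PartitionedPerm n) : ℂ :=
  P.blockProd (fun c => S.β a c.length) fun c d => S.β₂ a c.length d.length

end SecondOrderSpace

end SecondOrderFree

end

noncomputable section

namespace SecondOrderFree

/-! Write `discWeight f n` for the sum over NC(n) of the products of f over block sizes, and
`annulusWeight f g p q` for the analogous sum over PS_NC(p,q). A moment-cumulant formula is
triangular: the top term is one unknown, and the other terms contain only shorter cumulants. Moments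
therefore determine cumulants (`eq_of_sum_NC_eq`, `eq_of_sum_PSNC_eq`). It suffices to show that the
moments of aa* are the ones produced by the claimed cumulants, that is, φ((aa*)^n) = `discWeight
(discWeight β) n`, and that φ₂((aa*)^p, (aa*)^q) = `annulusWeight (discWeight β) (annulusWeight β
β₂) p q`.

Both moments are also moments of alternating words in a and a*. R-diagonality leaves only those
terms in which every cycle alternates. Up to relabelling, the 2n letters form two copies of a set of
n points carrying a rotation γ. An alternating permutation π of the two copies amounts to a pair (σ,
τ): σ is the map from the second copy to the first, τ is the square of π on the first copy (`alt`).
It has as many cycles as τ, and π⁻¹Γ, for the doubled rotation Γ = `alt γ γ`, is the disjoint union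
of τ⁻¹σ and σ⁻¹γ (`alt_inv_mul`). Hence the defect |π| + |π⁻¹Γ| - |Γ| is the sum of the
corresponding defects of (τ, σ) and (σ, γ).

Non-crossing in a disc means defect 0 (`isNC_iff_geo`), and annular non-crossing means defect 2
together with a connection between the circles. Defects are non-negative, and a connection between
different cycles costs at least 2; both follow from the genus inequality `nc_add_nc_le`. So in the
disc the alternating terms are chains τ ≤ σ ≤ γ (`geo_alt_iff`). In the annulus the defect 2 sits in
exactly one of the two steps (`ann_alt_iff`), and there are in addition chains of defect 0 with a
marked pair of cycles of τ.

It remains to sum over τ with σ fixed. For τ ≤ σ, a non-crossing permutation is chosen independently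
on each cycle of σ, which produces the factor `discWeight β` for every cycle (`cprod_discWeight`).
If τ is annular relative to σ, or carries a marked pair, exactly one cycle of σ on each circle is
involved. These two cycles become the circles of a smaller annulus and produce `annulusWeight β β₂`,
while the other cycles produce `discWeight β` as before (`markedSum_annulusWeight`). The sum over σ
is then the required sum over PS_NC(p,q).

Permutations act on arbitrary finite types throughout, so that a cycle, or a pair of cycles, can
itself serve as the underlying disc or annulus. -/

/-! ### Counting classes of equivalence relations -/

section SetoidCount

variable {α : Type*}

/-- The equivalence relation obtained from `r` by joining the classes of `x` and `y`. -/
def joinClasses (r : Setoid α) (x y : α) : Setoid α where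
  r a b := r a b ∨ ((r x a ∨ r y a) ∧ (r x b ∨ r y b))
  iseqv :=
    { refl := fun a => Or.inl (r.refl a)
      symm := by
        rintro a b (h | ⟨h, h'⟩)
        · exact Or.inl (r.symm h)
        · exact Or.inr ⟨h', h⟩
      trans := by
        rintro a b c (h | ⟨h, h'⟩) (k | ⟨k, k'⟩)
        · exact Or.inl (r.trans h k)
        · exact Or.inr ⟨k.imp (fun z => r.trans z (r.symm h)) (fun z => r.trans z (r.symm h)), k'⟩
        · exact Or.inr ⟨h, h'.imp (fun z => r.trans z k) (fun z => r.trans z k)⟩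
        · exact Or.inr ⟨h, k'⟩ }

theorem joinClasses_iff {r : Setoid α} {x y a b : α} :
    joinClasses r x y a b ↔ r a b ∨ ((r x a ∨ r y a) ∧ (r x b ∨ r y b)) := Iff.rfl

theorem le_joinClasses (r : Setoid α) (x y : α) : r ≤ joinClasses r x y := fun _ _ h => Or.inl h

theorem joinClasses_self (r : Setoid α) (x y : α) : joinClasses r x y x y :=
  Or.inr ⟨Or.inl (r.refl x), Or.inr (r.refl y)⟩

theorem joinClasses_le {r s : Setoid α} {x y : α} (h : r ≤ s) (hxy : s x y) :
    joinClasses r x y ≤ s := by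
  rintro a b (hab | ⟨ha | ha, hb | hb⟩)
  · exact h hab
  · exact s.trans (s.symm (h ha)) (h hb)
  · exact s.trans (s.symm (h ha)) (s.trans hxy (h hb))
  · exact s.trans (s.symm (h ha)) (s.trans (s.symm hxy) (h hb))
  · exact s.trans (s.symm (h ha)) (h hb)

/-- Every class of the join contains exactly one class of `r` other than that of `y`: the class of
`x` represents the merged class. -/
theorem card_joinClasses [Finite α] (r : Setoid α) {x y : α} (h : ¬ r x y) :
    Nat.card (Quotient (joinClasses r x y)) + 1 = Nat.card (Quotient r) := by
  classical
  have hle := le_joinClasses r x y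
  let f : {q : Quotient r // q ≠ Quotient.mk r y} → Quotient (joinClasses r x y) :=
    fun q => Quotient.map' id hle q.1
  have hf : Function.Bijective f := by
    constructor
    · rintro ⟨p, hp⟩ ⟨q, hq⟩ hpq
      induction p using Quotient.inductionOn with | _ a
      induction q using Quotient.inductionOn with | _ b
      have hab : joinClasses r x y a b := Quotient.exact hpq
      have ha : ¬ r y a := fun h => hp (Quotient.sound (r.symm h))
      have hb : ¬ r y b := fun h => hq (Quotient.sound (r.symm h))
      refine Subtype.ext (Quotient.sound ?_)
      rcases hab with h | ⟨h1 | h1, h2 | h2⟩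
      · exact h
      · exact r.trans (r.symm h1) h2
      · exact absurd h2 hb
      · exact absurd h1 ha
      · exact absurd h1 ha
    · intro q
      induction q using Quotient.inductionOn with | _ a
      by_cases ha : r y a
      · refine ⟨⟨Quotient.mk r x, fun h' => h (Quotient.exact h')⟩, Quotient.sound ?_⟩
        exact Or.inr ⟨Or.inl (r.refl x), Or.inr ha⟩
      · exact ⟨⟨Quotient.mk r a, fun h' => ha (r.symm (Quotient.exact h'))⟩, rfl⟩
  have := Fintype.ofFinite (Quotient r)
  rw [← Nat.card_congr (Equiv.ofBijective f hf), Nat.card_eq_fintype_card,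
    Nat.card_eq_fintype_card, Fintype.card_subtype_compl (p := fun q => q = Quotient.mk r y),
    Fintype.card_subtype_eq]
  have : 0 < Fintype.card (Quotient r) := Fintype.card_pos_iff.2 ⟨Quotient.mk r x⟩
  omega

theorem card_quotient_le [Finite α] {r s : Setoid α} (h : r ≤ s) :
    Nat.card (Quotient s) ≤ Nat.card (Quotient r) := by
  refine Nat.card_le_card_of_surjective (Quotient.map' id h) fun q => ?_
  induction q using Quotient.inductionOn with | _ a
  exact ⟨Quotient.mk r a, rfl⟩

theorem card_quotient_le_joinClasses [Finite α] (r : Setoid α) (x y : α) :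
    Nat.card (Quotient r) ≤ Nat.card (Quotient (joinClasses r x y)) + 1 := by
  by_cases h : r x y
  · have := card_quotient_le (joinClasses_le le_rfl h)
    omega
  · exact (card_joinClasses r h).ge

theorem card_quotient_lt [Finite α] {r s : Setoid α} (h : r ≤ s) {x y : α} (hr : ¬ r x y)
    (hs : s x y) : Nat.card (Quotient s) + 1 ≤ Nat.card (Quotient r) := by
  rw [← card_joinClasses r hr]
  exact Nat.add_le_add_right (card_quotient_le (joinClasses_le h hs)) 1

end SetoidCount

/-! ### The number of cycles of a permutation -/

section CycleCount

variable {α : Type*}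

/-- The set of cycles of `σ`. -/
def Cyc (σ : Perm α) : Type _ := Quotient (Perm.SameCycle.setoid σ)

/-- The cycle of `x`. -/
def Cyc.mk (σ : Perm α) (x : α) : Cyc σ := Quotient.mk (Perm.SameCycle.setoid σ) x

/-- A point of a cycle. -/
def Cyc.out {σ : Perm α} (q : Cyc σ) : α := Quotient.out q

theorem Cyc.mk_out {σ : Perm α} (q : Cyc σ) : Cyc.mk σ q.out = q := Quotient.out_eq q

theorem Cyc.mk_eq {σ : Perm α} {x y : α} : Cyc.mk σ x = Cyc.mk σ y ↔ σ.SameCycle x y :=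
  Quotient.eq

theorem Cyc.out_mk (σ : Perm α) (x : α) : σ.SameCycle (Cyc.mk σ x).out x :=
  Cyc.mk_eq.1 (Cyc.mk_out _)

instance [Finite α] (σ : Perm α) : Finite (Cyc σ) :=
  inferInstanceAs (Finite (Quotient (Perm.SameCycle.setoid σ)))

instance [Finite α] (σ : Perm α) : Fintype (Cyc σ) := Fintype.ofFinite _

/-- The number of cycles of `σ`, fixed points included. -/
def nc (σ : Perm α) : ℕ := Nat.card (Cyc σ)

/-- On a finite type a cycle is reached by natural powers, so an invariant checked for one step of
`σ` holds along whole cycles. -/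
theorem setoid_sameCycle_le [Finite α] {σ : Perm α} {r : Setoid α} (h : ∀ x, r x (σ x)) :
    Perm.SameCycle.setoid σ ≤ r := by
  intro x y hxy
  obtain ⟨i, -, rfl⟩ := Perm.SameCycle.exists_pow_eq' (f := σ) hxy
  induction i with
  | zero => exact r.refl x
  | succ i ih =>
    rw [pow_succ', Perm.mul_apply]
    exact r.trans (ih ⟨i, rfl⟩) (h _)

theorem sameCycle_apply_self (σ : Perm α) (x : α) : σ.SameCycle x (σ x) :=
  Perm.sameCycle_apply_right.2 (Perm.SameCycle.refl _ _)

theorem nc_conj (σ τ : Perm α) : nc (τ * σ * τ⁻¹) = nc σ :=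
  Nat.card_congr (Quotient.congr (τ⁻¹ : Perm α) fun _ _ => Perm.sameCycle_conj)

theorem nc_one : nc (1 : Perm α) = Nat.card α := by
  refine (Nat.card_congr (Equiv.ofBijective (Cyc.mk (1 : Perm α)) ⟨fun x y h => ?_, fun q => ?_⟩)).symm
  · exact Perm.sameCycle_one.1 (Cyc.mk_eq.1 h)
  · exact ⟨q.out, q.mk_out⟩

theorem nc_le [Finite α] (σ : Perm α) : nc σ ≤ Nat.card α :=
  Nat.card_le_card_of_surjective (Cyc.mk σ) fun q => ⟨q.out, q.mk_out⟩

variable [DecidableEq α]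

/-- The new permutation sends `y` to `σ x` and then follows the old cycle of `x` until it returns to
`x` (at the first return time `k`). Since `y` is not on that cycle, the transposition does not
interfere on the way. -/
theorem sameCycle_mul_swap_of_not [Finite α] {σ : Perm α} {x y : α} (h : ¬ σ.SameCycle x y) :
    (σ * swap x y).SameCycle x y := by
  have hex : ∃ k : ℕ, 0 < k ∧ (σ ^ k) x = x :=
    ⟨orderOf σ, orderOf_pos σ, by simp [pow_orderOf_eq_one]⟩
  classical
  obtain ⟨hk, hkx⟩ := Nat.find_spec hex
  set k := Nat.find hex
  have key : ∀ j, j + 1 ≤ k → (σ * swap x y).SameCycle y ((σ ^ (j + 1)) x) := by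
    intro j
    induction j with
    | zero =>
      intro _
      have : (σ ^ (0 + 1)) x = (σ * swap x y) y := by simp
      rw [this]; exact sameCycle_apply_self _ _
    | succ j ih =>
      intro hj
      have h1 : (σ ^ (j + 1)) x ≠ x := fun he =>
        Nat.find_min hex (show j + 1 < k by omega) ⟨by omega, he⟩
      have h2 : (σ ^ (j + 1)) x ≠ y := fun he => h ⟨(j + 1 : ℕ), by rw [zpow_natCast]; exact he⟩
      have : (σ ^ (j + 1 + 1)) x = (σ * swap x y) ((σ ^ (j + 1)) x) := by
        rw [pow_succ' σ (j + 1), Perm.mul_apply, Perm.mul_apply, swap_apply_of_ne_of_ne h1 h2]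
      rw [this]
      exact Perm.sameCycle_apply_right.2 (ih (by omega))
  have := key (k - 1) (by omega)
  rw [Nat.sub_add_cancel hk, hkx] at this
  exact this.symm

theorem sameCycle_mul_swap_iff [Finite α] {σ : Perm α} {x y : α} (h : ¬ σ.SameCycle x y)
    (a b : α) : (σ * swap x y).SameCycle a b ↔
      joinClasses (Perm.SameCycle.setoid σ) x y a b := by
  constructor
  · refine fun hab => setoid_sameCycle_le (fun z => ?_) hab
    rcases eq_or_ne z x with rfl | hzx
    · refine Or.inr ⟨Or.inl (Perm.SameCycle.refl _ _), Or.inr ?_⟩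
      rw [Perm.mul_apply, swap_apply_left]
      exact sameCycle_apply_self σ y
    rcases eq_or_ne z y with rfl | hzy
    · refine Or.inr ⟨Or.inr (Perm.SameCycle.refl _ _), Or.inl ?_⟩
      rw [Perm.mul_apply, swap_apply_right]
      exact sameCycle_apply_self σ x
    · rw [Perm.mul_apply, swap_apply_of_ne_of_ne hzx hzy]
      exact Or.inl (sameCycle_apply_self σ z)
  · have hxy := sameCycle_mul_swap_of_not h
    refine fun hab => joinClasses_le (s := Perm.SameCycle.setoid (σ * swap x y))
      (setoid_sameCycle_le fun z => ?_) hxy hab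
    change (σ * swap x y).SameCycle z (σ z)
    rcases eq_or_ne z x with rfl | hzx
    · refine hxy.trans ?_
      simpa using sameCycle_apply_self (σ * swap z y) y
    rcases eq_or_ne z y with rfl | hzy
    · refine hxy.symm.trans ?_
      simpa using sameCycle_apply_self (σ * swap x z) x
    · simpa [swap_apply_of_ne_of_ne hzx hzy] using sameCycle_apply_self (σ * swap x y) z

theorem nc_mul_swap_of_not [Finite α] {σ : Perm α} {x y : α} (h : ¬ σ.SameCycle x y) :
    nc (σ * swap x y) + 1 = nc σ := by
  refine Eq.trans ?_ (card_joinClasses (Perm.SameCycle.setoid σ) (x := x) (y := y) h)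
  exact congrArg (· + 1) (Nat.card_congr (Quotient.congr (Equiv.refl α)
    fun a b => sameCycle_mul_swap_iff h a b))

/-- The new permutation sends `x` to `σ y`. With `k` the first positive time at which `σ` takes `y`
to `x`, the points `σ y, …, σ^k y = x` form a closed orbit of the new permutation, and `y` is not
among them. -/
theorem not_sameCycle_mul_swap [Finite α] {σ : Perm α} {x y : α} (h : σ.SameCycle x y)
    (hne : x ≠ y) : ¬ (σ * swap x y).SameCycle x y := by
  have hex : ∃ k : ℕ, 0 < k ∧ (σ ^ k) y = x := by
    obtain ⟨i, -, hi⟩ := h.symm.exists_pow_eq'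
    refine ⟨i, Nat.pos_of_ne_zero ?_, hi⟩
    rintro rfl
    exact hne (by simpa using hi.symm)
  classical
  obtain ⟨hk, hkx⟩ := Nat.find_spec hex
  set k := Nat.find hex
  have hny : ∀ j, 0 < j → j ≤ k → (σ ^ j) y ≠ y := by
    intro j hj hjk he
    have h1 : (σ ^ (k - j)) y = x := by
      rw [← hkx]; nth_rw 2 [show k = (k - j) + j by omega]
      rw [pow_add, Perm.mul_apply, he]
    rcases Nat.eq_zero_or_pos (k - j) with h0 | h0
    · rw [h0] at h1; exact hne (by simpa using h1.symm)
    · exact Nat.find_min hex (show k - j < k by omega) ⟨h0, h1⟩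
  have key : ∀ i : ℕ, ∃ j, 0 < j ∧ j ≤ k ∧ ((σ * swap x y) ^ i) x = (σ ^ j) y := by
    intro i
    induction i with
    | zero => exact ⟨k, hk, le_rfl, by simpa using hkx.symm⟩
    | succ i ih =>
      obtain ⟨j, hj, hjk, he⟩ := ih
      rw [pow_succ', Perm.mul_apply, he]
      by_cases hx : (σ ^ j) y = x
      · exact ⟨1, one_pos, hk, by simp [hx]⟩
      · have hjlt : j < k := lt_of_le_of_ne hjk fun e => hx (e ▸ hkx)
        refine ⟨j + 1, by omega, by omega, ?_⟩
        rw [Perm.mul_apply, swap_apply_of_ne_of_ne hx (hny j hj hjk), pow_succ', Perm.mul_apply]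
  intro hc
  obtain ⟨i, -, hi⟩ := hc.exists_pow_eq'
  obtain ⟨j, hj, hjk, he⟩ := key i
  exact hny j hj hjk (by rw [← he, hi])

theorem nc_mul_swap_of_sameCycle [Finite α] {σ : Perm α} {x y : α} (h : σ.SameCycle x y)
    (hne : x ≠ y) : nc (σ * swap x y) = nc σ + 1 := by
  rw [← nc_mul_swap_of_not (not_sameCycle_mul_swap h hne), mul_assoc, swap_mul_self, mul_one]

theorem swap_mul_eq_conj (σ : Perm α) (x y : α) :
    swap x y * σ = (swap x y) * (σ * swap x y) * (swap x y)⁻¹ := by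
  simp [mul_assoc]

theorem nc_swap_mul_of_not [Finite α] {σ : Perm α} {x y : α} (h : ¬ σ.SameCycle x y) :
    nc (swap x y * σ) + 1 = nc σ := by
  rw [swap_mul_eq_conj, nc_conj, nc_mul_swap_of_not h]

theorem nc_swap_mul_of_sameCycle [Finite α] {σ : Perm α} {x y : α} (h : σ.SameCycle x y)
    (hne : x ≠ y) : nc (swap x y * σ) = nc σ + 1 := by
  rw [swap_mul_eq_conj, nc_conj, nc_mul_swap_of_sameCycle h hne]

theorem swap_mul_eq_inv (σ : Perm α) (x y : α) : swap x y * σ = (σ⁻¹ * swap x y)⁻¹ := by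
  simp [mul_inv_rev]

theorem sameCycle_swap_mul_iff [Finite α] {σ : Perm α} {x y : α} (h : ¬ σ.SameCycle x y)
    (a b : α) : (swap x y * σ).SameCycle a b ↔
      joinClasses (Perm.SameCycle.setoid σ) x y a b := by
  rw [swap_mul_eq_inv, Perm.sameCycle_inv, sameCycle_mul_swap_iff (by rwa [Perm.sameCycle_inv])]
  have : Perm.SameCycle.setoid σ⁻¹ = Perm.SameCycle.setoid σ :=
    Setoid.ext fun _ _ => Perm.sameCycle_inv
  rw [this]

/-- The genus of a pair of permutations is non-negative. -/
theorem nc_add_nc_le [Finite α] (σ τ : Perm α) :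
    nc σ + nc τ + nc (σ * τ⁻¹) ≤
      Nat.card α + 2 * Nat.card (Quotient (Perm.SameCycle.setoid σ ⊔ Perm.SameCycle.setoid τ)) := by
  have := Fintype.ofFinite α
  induction hk : τ.support.card using Nat.strong_induction_on generalizing τ with
  | _ k ih =>
  subst hk
  by_cases hτ : ∃ x, τ x ≠ x
  · obtain ⟨x, hx⟩ := hτ
    -- Splitting `x` off its cycle makes it a fixed point and shrinks the support, so induction
    -- applies to `τ'`.
    have hlt := Perm.card_support_swap_mul hx
    set y := τ x with hy
    set τ' := swap x y * τ with hτ'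
    have ih' := ih _ hlt τ' rfl
    have hfix : τ' x = x := by simp [hτ', ← hy]
    have hττ : τ = swap x y * τ' := by simp [hτ', ← mul_assoc]
    have hn : ¬ τ'.SameCycle x y := by
      rintro h
      obtain ⟨i, -, hi⟩ := h.exists_pow_eq'
      rw [Perm.pow_apply_eq_self_of_apply_eq_self hfix] at hi
      exact hx hi.symm
    have h1 : nc τ + 1 = nc τ' := by rw [hττ, nc_swap_mul_of_not hn]
    have h2 : σ * τ⁻¹ = σ * τ'⁻¹ * swap x y := by rw [hττ, mul_inv_rev, swap_inv, mul_assoc]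
    have hτle : ∀ r : Setoid α, Perm.SameCycle.setoid τ' ≤ r → r x y →
        Perm.SameCycle.setoid τ ≤ r := fun r hr hxy a b hab => by
      refine joinClasses_le hr hxy ?_
      rw [← sameCycle_swap_mul_iff hn, ← hττ]
      exact hab
    -- Passing from `τ'` to `τ` removes one cycle of `τ'`. If `x` and `y` share a cycle of `σ τ'⁻¹`,
    -- the quotient gains a cycle and they were already in one class of the join. Otherwise the
    -- quotient also loses a cycle, and the join, which counts twice, loses at most one class.
    by_cases hs : (σ * τ'⁻¹).SameCycle x y
    · have h3 : nc (σ * τ⁻¹) = nc (σ * τ'⁻¹) + 1 := by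
        rw [h2, nc_mul_swap_of_sameCycle hs (Ne.symm hx)]
      have hxy : (Perm.SameCycle.setoid σ ⊔ Perm.SameCycle.setoid τ') x y := by
        refine setoid_sameCycle_le (fun z => ?_) hs
        refine Setoid.trans' _ (y := τ'⁻¹ z) ?_ ?_
        · refine (le_sup_right : Perm.SameCycle.setoid τ' ≤ _) ?_
          exact Perm.sameCycle_inv.1 (sameCycle_apply_self τ'⁻¹ z)
        · refine (le_sup_left : Perm.SameCycle.setoid σ ≤ _) ?_
          exact sameCycle_apply_self σ _
      have h4 := card_quotient_le (sup_le (le_sup_left : Perm.SameCycle.setoid σ ≤ _)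
        (hτle _ (le_sup_right : Perm.SameCycle.setoid τ' ≤ _) hxy))
      omega
    · have h3 : nc (σ * τ⁻¹) + 1 = nc (σ * τ'⁻¹) := by
        rw [h2, nc_mul_swap_of_not hs]
      have h4 := card_quotient_le_joinClasses
        (Perm.SameCycle.setoid σ ⊔ Perm.SameCycle.setoid τ') x y
      have h5 := card_quotient_le (sup_le
        (le_sup_left.trans (le_joinClasses (Perm.SameCycle.setoid σ ⊔ Perm.SameCycle.setoid τ') x y))
        (hτle _ (le_sup_right.trans (le_joinClasses _ _ _)) (joinClasses_self _ x y)))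
      omega
  · push Not at hτ
    obtain rfl : τ = 1 := Perm.ext hτ
    have h1 : Perm.SameCycle.setoid σ ⊔ Perm.SameCycle.setoid 1 = Perm.SameCycle.setoid σ :=
      sup_eq_left.2 (setoid_sameCycle_le fun x => Setoid.refl' _ x)
    rw [h1, inv_one, mul_one, nc_one]
    have : nc σ = Nat.card (Quotient (Perm.SameCycle.setoid σ)) := rfl
    omega

end CycleCount

/-! ### Geodesics and annular permutations -/

section Geodesic

variable {α : Type*}

/-- `τ` lies on a geodesic from `1` to `σ`: `|τ| + |τ⁻¹ σ| = |σ|`. -/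
def Geo (τ σ : Perm α) : Prop := nc τ + nc (τ⁻¹ * σ) = Nat.card α + nc σ

/-- The annular analogue of `Geo`: `|τ| + |τ⁻¹ σ| = |σ| + 2` and `τ` does not preserve the
colouring `col` of the circles. -/
def Ann (σ : Perm α) (col : α → Bool) (τ : Perm α) : Prop :=
  nc τ + nc (τ⁻¹ * σ) + 2 = Nat.card α + nc σ ∧ ∃ x, col (τ x) ≠ col x

variable [Finite α]

theorem nc_add_nc_inv_mul_le (σ τ : Perm α) : nc σ + nc τ + nc (τ⁻¹ * σ) ≤
    Nat.card α + 2 * Nat.card (Quotient (Perm.SameCycle.setoid σ ⊔ Perm.SameCycle.setoid τ)) := by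
  classical
  have h : nc (τ⁻¹ * σ) = nc (σ * τ⁻¹) := by
    rw [← nc_conj (τ⁻¹ * σ) τ]; simp
  rw [h]
  exact nc_add_nc_le σ τ

/-- This is |σ| ≤ |τ| + |τ⁻¹σ|, the genus inequality with the number of classes of the join bounded
by the number of cycles of `σ`. -/
theorem nc_triangle (τ σ : Perm α) : nc τ + nc (τ⁻¹ * σ) ≤ Nat.card α + nc σ := by
  have h1 := nc_add_nc_inv_mul_le σ τ
  have h2 := card_quotient_le (le_sup_left : Perm.SameCycle.setoid σ ≤
    Perm.SameCycle.setoid σ ⊔ Perm.SameCycle.setoid τ)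
  have : nc σ = Nat.card (Quotient (Perm.SameCycle.setoid σ)) := rfl
  omega

/-- If `τ` connects two cycles of `σ`, the join has at least one class fewer than `σ` has cycles.
Classes enter the genus inequality with coefficient 2, whence the gap. -/
theorem nc_triangle_of_not {τ σ : Perm α} {x y : α} (h : τ.SameCycle x y)
    (h' : ¬ σ.SameCycle x y) : nc τ + nc (τ⁻¹ * σ) + 2 ≤ Nat.card α + nc σ := by
  have h1 := nc_add_nc_inv_mul_le σ τ
  have h2 := card_quotient_lt (le_sup_left : Perm.SameCycle.setoid σ ≤
    Perm.SameCycle.setoid σ ⊔ Perm.SameCycle.setoid τ) (x := x) (y := y) h'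
    ((le_sup_right : Perm.SameCycle.setoid τ ≤ _) h)
  have : nc σ = Nat.card (Quotient (Perm.SameCycle.setoid σ)) := rfl
  omega

theorem Geo.sameCycle {τ σ : Perm α} (h : Geo τ σ) {x y : α} (hxy : τ.SameCycle x y) :
    σ.SameCycle x y := by
  by_contra h'
  have := nc_triangle_of_not hxy h'
  rw [Geo] at h
  omega

/-- A defect of exactly 2 pays for one connection between cycles of `σ`. Any connection beyond that
of `x` with `y` would cost a further class of the join. -/
theorem joinClasses_of_nc_eq {τ σ : Perm α} (h : nc τ + nc (τ⁻¹ * σ) + 2 = Nat.card α + nc σ)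
    {x y : α} (hxy : τ.SameCycle x y) (h' : ¬ σ.SameCycle x y) {a b : α}
    (hab : τ.SameCycle a b) : joinClasses (Perm.SameCycle.setoid σ) x y a b := by
  by_contra hc
  have h1 := nc_add_nc_inv_mul_le σ τ
  have h2 := card_quotient_lt (r := joinClasses (Perm.SameCycle.setoid σ) x y)
    (s := Perm.SameCycle.setoid σ ⊔ Perm.SameCycle.setoid τ)
    (joinClasses_le le_sup_left ((le_sup_right : Perm.SameCycle.setoid τ ≤ _) hxy)) hc
    ((le_sup_right : Perm.SameCycle.setoid τ ≤ _) hab)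
  have h3 := card_joinClasses (Perm.SameCycle.setoid σ) (x := x) (y := y) h'
  have : nc σ = Nat.card (Quotient (Perm.SameCycle.setoid σ)) := rfl
  omega

theorem sameCycle_col {σ : Perm α} {col : α → Bool} (hσ : ∀ x, col (σ x) = col x) {x y : α}
    (h : σ.SameCycle x y) : col x = col y :=
  setoid_sameCycle_le (r := Setoid.ker col) (fun z => (hσ z).symm) h

theorem Geo.col {τ σ : Perm α} {col : α → Bool} (h : Geo τ σ) (hσ : ∀ x, col (σ x) = col x)
    (x : α) : col (τ x) = col x :=
  (sameCycle_col hσ (h.sameCycle (sameCycle_apply_self τ x))).symm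

theorem nc_triangle_of_col {τ σ : Perm α} {col : α → Bool} (hσ : ∀ x, col (σ x) = col x)
    (h : ∃ x, col (τ x) ≠ col x) : nc τ + nc (τ⁻¹ * σ) + 2 ≤ Nat.card α + nc σ := by
  obtain ⟨x, hx⟩ := h
  exact nc_triangle_of_not (sameCycle_apply_self τ x) fun hs => hx (sameCycle_col hσ hs).symm

end Geodesic

open Classical

/-! ### Products and sums over the cycles of a permutation -/

section CycleSums

variable {α β : Type*}

/-- The number of elements of the cycle of `x`. -/
def sz (τ : Perm α) (x : α) : ℕ := {y | τ.SameCycle x y}.ncard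

/-- `φ` is constant on the cycles of `τ`. -/
def IsClass {M : Type*} (τ : Perm α) (φ : α → M) : Prop := ∀ x y, τ.SameCycle x y → φ x = φ y

theorem isClass_sz (τ : Perm α) : IsClass τ (sz τ) := by
  intro x y h
  rw [sz, sz]
  congr 1
  ext z
  exact ⟨h.symm.trans, h.trans⟩

theorem IsClass.comp {M N : Type*} {τ : Perm α} {φ : α → M} (h : IsClass τ φ) (f : M → N) :
    IsClass τ (fun x => f (φ x)) := fun x y hxy => congrArg f (h x y hxy)

theorem isClass_of_apply [Finite α] {M : Type*} {τ : Perm α} {φ : α → M}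
    (h : ∀ x, φ (τ x) = φ x) : IsClass τ φ :=
  fun _ _ hxy => setoid_sameCycle_le (r := Setoid.ker φ) (fun z => (h z).symm) hxy

theorem IsClass.out_mk {M : Type*} {τ : Perm α} {φ : α → M} (h : IsClass τ φ) (x : α) :
    φ (Cyc.mk τ x).out = φ x := h _ _ (Cyc.out_mk τ x)

variable [Finite α] [Finite β]

/-- The product over all cycles. -/
def cprod (τ : Perm α) (φ : α → ℂ) : ℂ := ∏ q : Cyc τ, φ q.out

/-- The product over all cycles but two. -/
def restProd (τ : Perm α) (φ : α → ℂ) (q₁ q₂ : Cyc τ) : ℂ :=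
  ∏ q : Cyc τ, if q = q₁ ∨ q = q₂ then 1 else φ q.out

/-- The sum over the ways to mark a cycle satisfying `P` and a cycle satisfying `Q`. -/
def markedSum (τ : Perm α) (P Q : α → Prop) (φ : α → ℂ) (ψ : α → α → ℂ) : ℂ :=
  ∑ q : Cyc τ × Cyc τ,
    if P q.1.out ∧ Q q.2.out then ψ q.1.out q.2.out * restProd τ φ q.1 q.2 else 0

/-- The bijection between cycles given by a map of the underlying sets. -/
def cycEquiv {τ : Perm α} {τ' : Perm β} (h : α → β)
    (h₁ : ∀ x y, τ'.SameCycle (h x) (h y) ↔ τ.SameCycle x y)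
    (h₂ : ∀ z, ∃ x, τ'.SameCycle (h x) z) : Cyc τ ≃ Cyc τ' :=
  Equiv.ofBijective (fun q => Cyc.mk τ' (h q.out)) <| by
    constructor
    · intro p q hpq
      rw [← p.mk_out, ← q.mk_out, Cyc.mk_eq, ← h₁]
      exact Cyc.mk_eq.1 hpq
    · intro q
      obtain ⟨x, hx⟩ := h₂ q.out
      refine ⟨Cyc.mk τ x, ?_⟩
      rw [← q.mk_out, Cyc.mk_eq]
      exact ((h₁ _ _).2 (Cyc.out_mk τ x)).trans hx

/-! ### Change of variables along a map inducing a bijection of cycles (not necessarily of points)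
-/

section Match

variable {τ : Perm α} {τ' : Perm β} {h : α → β}
  (h₁ : ∀ x y, τ'.SameCycle (h x) (h y) ↔ τ.SameCycle x y)
  (h₂ : ∀ z, ∃ x, τ'.SameCycle (h x) z)

include h₁ h₂

omit [Finite α] [Finite β] in
theorem cycEquiv_out {M : Type*} {φ : β → M} (hφ : IsClass τ' φ) (q : Cyc τ) :
    φ (cycEquiv h h₁ h₂ q).out = φ (h q.out) := hφ _ _ (Cyc.out_mk _ _)

theorem cprod_match {φ : β → ℂ} (hφ : IsClass τ' φ) :
    cprod τ (fun x => φ (h x)) = cprod τ' φ :=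
  Fintype.prod_equiv (cycEquiv h h₁ h₂) _ _ fun q => (cycEquiv_out h₁ h₂ hφ q).symm

theorem restProd_match {φ : β → ℂ} (hφ : IsClass τ' φ) (q₁ q₂ : Cyc τ) :
    restProd τ (fun x => φ (h x)) q₁ q₂ =
      restProd τ' φ (cycEquiv h h₁ h₂ q₁) (cycEquiv h h₁ h₂ q₂) :=
  Fintype.prod_equiv (cycEquiv h h₁ h₂) _ _ fun q => by
    rw [cycEquiv_out h₁ h₂ hφ]
    simp only [EmbeddingLike.apply_eq_iff_eq]

omit [Finite α] [Finite β] in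
theorem nc_match : nc τ = nc τ' := Nat.card_congr (cycEquiv h h₁ h₂)

theorem markedSum_match {φ : β → ℂ} (hφ : IsClass τ' φ) {P Q : β → Prop} (hP : IsClass τ' P)
    (hQ : IsClass τ' Q) {ψ : β → β → ℂ} (hψ : ∀ y, IsClass τ' fun x => ψ x y)
    (hψ' : ∀ x, IsClass τ' (ψ x)) :
    markedSum τ (fun x => P (h x)) (fun x => Q (h x)) (fun x => φ (h x))
      (fun x y => ψ (h x) (h y)) = markedSum τ' P Q φ ψ :=
  Fintype.sum_equiv ((cycEquiv h h₁ h₂).prodCongr (cycEquiv h h₁ h₂)) _ _ fun q => by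
    change _ = if P (cycEquiv h h₁ h₂ q.1).out ∧ Q (cycEquiv h h₁ h₂ q.2).out then
      ψ (cycEquiv h h₁ h₂ q.1).out (cycEquiv h h₁ h₂ q.2).out *
        restProd τ' φ (cycEquiv h h₁ h₂ q.1) (cycEquiv h h₁ h₂ q.2) else 0
    rw [cycEquiv_out h₁ h₂ hP, cycEquiv_out h₁ h₂ hQ, cycEquiv_out h₁ h₂ (hψ _),
      cycEquiv_out h₁ h₂ (hψ' _), ← restProd_match h₁ h₂ hφ]

end Match

end CycleSums

/-! ### Transport along a bijection -/

section Transport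

variable {α β : Type*}

theorem permCongr_pow (e : α ≃ β) (τ : Perm α) (k : ℤ) (x : α) :
    ((e.permCongr τ) ^ k) (e x) = e ((τ ^ k) x) := by
  have : (e.permCongr τ) ^ k = e.permCongr (τ ^ k) := (map_zpow e.permCongrHom τ k).symm
  rw [this]; simp [Equiv.permCongr_apply]

theorem sameCycle_permCongr (e : α ≃ β) (τ : Perm α) (x y : α) :
    (e.permCongr τ).SameCycle (e x) (e y) ↔ τ.SameCycle x y := by
  simp only [Perm.SameCycle, permCongr_pow, EmbeddingLike.apply_eq_iff_eq]

theorem exists_sameCycle_permCongr (e : α ≃ β) (τ : Perm α) (z : β) :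
    ∃ x, (e.permCongr τ).SameCycle (e x) z :=
  ⟨e.symm z, by rw [e.apply_symm_apply]⟩

theorem sz_permCongr (e : α ≃ β) (τ : Perm α) (x : α) :
    sz (e.permCongr τ) (e x) = sz τ x := by
  rw [sz, sz, ← Set.ncard_image_of_injective _ e.injective]
  congr 1
  ext z
  obtain ⟨z, rfl⟩ := e.surjective z
  simp [sameCycle_permCongr]

theorem nc_permCongr [Finite α] [Finite β] (e : α ≃ β) (τ : Perm α) :
    nc (e.permCongr τ) = nc τ :=
  (nc_match (sameCycle_permCongr e τ) (exists_sameCycle_permCongr e τ)).symm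

theorem permCongr_inv_mul (e : α ≃ β) (τ σ : Perm α) :
    (e.permCongr τ)⁻¹ * e.permCongr σ = e.permCongr (τ⁻¹ * σ) := by
  rw [show e.permCongr (τ⁻¹ * σ) = e.permCongrHom (τ⁻¹ * σ) from rfl, map_mul, map_inv]; rfl

variable [Finite α] [Finite β]

theorem geo_permCongr (e : α ≃ β) (τ σ : Perm α) :
    Geo (e.permCongr τ) (e.permCongr σ) ↔ Geo τ σ := by
  rw [Geo, Geo, permCongr_inv_mul, nc_permCongr, nc_permCongr, nc_permCongr, Nat.card_congr e]

theorem ann_permCongr (e : α ≃ β) (τ σ : Perm α) (col : β → Bool) :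
    Ann (e.permCongr σ) col (e.permCongr τ) ↔ Ann σ (fun x => col (e x)) τ := by
  rw [Ann, Ann, permCongr_inv_mul, nc_permCongr, nc_permCongr, nc_permCongr, Nat.card_congr e]
  refine and_congr_right fun _ => ?_
  constructor
  · rintro ⟨x, hx⟩
    obtain ⟨x, rfl⟩ := e.surjective x
    exact ⟨x, by simpa [Equiv.permCongr_apply] using hx⟩
  · rintro ⟨x, hx⟩
    exact ⟨e x, by simpa [Equiv.permCongr_apply] using hx⟩

end Transport

/-! ### Sums over geodesics and annular permutations -/

section Sums

/-- Permutations of a finite type form a finite type. -/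
instance (priority := 10) permFintype {α : Type*} [Finite α] : Fintype (Perm α) :=
  Fintype.ofFinite _

variable {α β : Type*} [Finite α] [Finite β]

/-- The sum over the geodesic permutations of the product over the cycles. -/
def geoSum (σ : Perm α) (Φ : Perm α → α → ℂ) : ℂ :=
  ∑ τ : Perm α, if Geo τ σ then cprod τ (Φ τ) else 0

/-- The sum over the annular permutations of the product over the cycles. -/
def annSum (σ : Perm α) (col : α → Bool) (Φ : Perm α → α → ℂ) : ℂ :=
  ∑ τ : Perm α, if Ann σ col τ then cprod τ (Φ τ) else 0

/-- The sum over the geodesic permutations with a marked cycle of either colour. -/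
def geoMarkedSum (σ : Perm α) (col : α → Bool) (Φ : Perm α → α → ℂ)
    (Ψ : Perm α → α → α → ℂ) : ℂ :=
  ∑ τ : Perm α, if Geo τ σ then
    markedSum τ (fun x => col x = false) (fun x => col x = true) (Φ τ) (Ψ τ) else 0

theorem geoSum_permCongr (e : α ≃ β) (σ : Perm α) {Φ : Perm α → α → ℂ} {Φ' : Perm β → β → ℂ}
    (hc : ∀ τ, IsClass τ (Φ' τ)) (h : ∀ τ x, Φ' (e.permCongr τ) (e x) = Φ τ x) :
    geoSum (e.permCongr σ) Φ' = geoSum σ Φ := by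
  refine (Fintype.sum_equiv e.permCongr _ _ fun τ => ?_).symm
  rw [geo_permCongr, show Φ τ = fun x => Φ' (e.permCongr τ) (e x) from funext fun x => (h τ x).symm]
  rw [cprod_match (sameCycle_permCongr e τ) (exists_sameCycle_permCongr e τ) (hc _)]

theorem annSum_permCongr (e : α ≃ β) (σ : Perm α) (col : β → Bool) {Φ : Perm α → α → ℂ}
    {Φ' : Perm β → β → ℂ}
    (hc : ∀ τ, IsClass τ (Φ' τ)) (h : ∀ τ x, Φ' (e.permCongr τ) (e x) = Φ τ x) :
    annSum (e.permCongr σ) col Φ' = annSum σ (fun x => col (e x)) Φ := by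
  refine (Fintype.sum_equiv e.permCongr _ _ fun τ => ?_).symm
  rw [ann_permCongr, show Φ τ = fun x => Φ' (e.permCongr τ) (e x) from funext fun x => (h τ x).symm]
  rw [cprod_match (sameCycle_permCongr e τ) (exists_sameCycle_permCongr e τ) (hc _)]

theorem geoMarkedSum_permCongr (e : α ≃ β) (σ : Perm α) {col : β → Bool}
    (hcol : ∀ x, col (e.permCongr σ x) = col x) {Φ : Perm α → α → ℂ}
    {Φ' : Perm β → β → ℂ} {Ψ : Perm α → α → α → ℂ} {Ψ' : Perm β → β → β → ℂ}
    (hc : ∀ τ, IsClass τ (Φ' τ)) (h : ∀ τ x, Φ' (e.permCongr τ) (e x) = Φ τ x)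
    (hΨ : ∀ τ y, IsClass τ fun x => Ψ' τ x y) (hΨ' : ∀ τ x, IsClass τ (Ψ' τ x))
    (h' : ∀ τ x y, Ψ' (e.permCongr τ) (e x) (e y) = Ψ τ x y) :
    geoMarkedSum (e.permCongr σ) col Φ' Ψ' = geoMarkedSum σ (fun x => col (e x)) Φ Ψ := by
  refine (Fintype.sum_equiv e.permCongr _ _ fun τ => ?_).symm
  rw [geo_permCongr, show Φ τ = fun x => Φ' (e.permCongr τ) (e x) from funext fun x => (h τ x).symm,
    show Ψ τ = fun x y => Ψ' (e.permCongr τ) (e x) (e y) from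
      funext fun x => funext fun y => (h' τ x y).symm]
  refine ite_congr rfl (fun hg => ?_) fun _ => rfl
  -- The marking conditions are tested at chosen points of cycles, so the colour must be constant on
  -- cycles; this holds because a geodesic permutation refines the cycles of the ambient one.
  have hcl : IsClass (e.permCongr τ) col :=
    isClass_of_apply (Geo.col ((geo_permCongr e τ σ).2 hg) hcol)
  exact markedSum_match (sameCycle_permCongr e τ) (exists_sameCycle_permCongr e τ) (hc _)
    (hcl.comp (· = false)) (hcl.comp (· = true)) (hΨ _) (hΨ' _)

/-- The sum over the geodesic permutations of a product of weights of the cycle lengths. -/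
def geoWeight (σ : Perm α) (f : ℕ → ℂ) : ℂ := geoSum σ fun τ x => f (sz τ x)

/-- The analogue of `geoWeight` for the annulus. -/
def annWeight (σ : Perm α) (col : α → Bool) (f : ℕ → ℂ) (g : ℕ → ℕ → ℂ) : ℂ :=
  annSum σ col (fun τ x => f (sz τ x)) +
    geoMarkedSum σ col (fun τ x => f (sz τ x)) (fun τ x y => g (sz τ x) (sz τ y))

theorem geoWeight_permCongr (e : α ≃ β) (σ : Perm α) (f : ℕ → ℂ) :
    geoWeight (e.permCongr σ) f = geoWeight σ f :=
  geoSum_permCongr e σ (fun τ => (isClass_sz τ).comp f) fun τ x => by rw [sz_permCongr]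

theorem annWeight_permCongr (e : α ≃ β) (σ : Perm α) {col : β → Bool}
    (hcol : ∀ x, col (e.permCongr σ x) = col x) (f : ℕ → ℂ) (g : ℕ → ℕ → ℂ) :
    annWeight (e.permCongr σ) col f g = annWeight σ (fun x => col (e x)) f g := by
  rw [annWeight, annWeight, annSum_permCongr e σ col (Φ := fun τ x => f (sz τ x))
    (fun τ => (isClass_sz τ).comp f) fun τ x => by rw [sz_permCongr]]
  rw [geoMarkedSum_permCongr e σ hcol (Φ := fun τ x => f (sz τ x))
    (Ψ := fun τ x y => g (sz τ x) (sz τ y)) (fun τ => (isClass_sz τ).comp f)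
    (fun τ x => by rw [sz_permCongr]) (fun τ y => (isClass_sz τ).comp fun k => g k _)
    (fun τ x => (isClass_sz τ).comp (g _)) fun τ x y => by rw [sz_permCongr, sz_permCongr]]

end Sums

/-! ### Permutations of a disjoint union -/

section Glue

variable {A B α : Type*}

/-- The permutation acting as `τ₁` on one part and as `τ₂` on the other. -/
def glue (e : A ⊕ B ≃ α) (τ₁ : Perm A) (τ₂ : Perm B) : Perm α :=
  e.permCongr (Equiv.sumCongr τ₁ τ₂)

variable (e : A ⊕ B ≃ α)

theorem glue_inl (τ₁ : Perm A) (τ₂ : Perm B) (a : A) :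
    glue e τ₁ τ₂ (e (Sum.inl a)) = e (Sum.inl (τ₁ a)) := by
  simp [glue, Equiv.permCongr_apply]

theorem glue_inr (τ₁ : Perm A) (τ₂ : Perm B) (b : B) :
    glue e τ₁ τ₂ (e (Sum.inr b)) = e (Sum.inr (τ₂ b)) := by
  simp [glue, Equiv.permCongr_apply]

theorem glue_injective : Function.Injective fun τ : Perm A × Perm B => glue e τ.1 τ.2 := by
  rintro ⟨τ₁, τ₂⟩ ⟨τ₁', τ₂'⟩ h
  ext x
  · have := congrArg (fun π : Perm α => π (e (Sum.inl x))) h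
    simpa [glue_inl] using this
  · have := congrArg (fun π : Perm α => π (e (Sum.inr x))) h
    simpa [glue_inr] using this

theorem glue_inv_mul (τ₁ σ₁ : Perm A) (τ₂ σ₂ : Perm B) :
    (glue e τ₁ τ₂)⁻¹ * glue e σ₁ σ₂ = glue e (τ₁⁻¹ * σ₁) (τ₂⁻¹ * σ₂) := by
  rw [inv_mul_eq_iff_eq_mul]
  ext x
  obtain ⟨x | x, rfl⟩ := e.surjective x <;>
  simp [glue_inl, glue_inr]

/-- By finiteness, a permutation that maps the first part into itself permutes it, and hence
preserves the second part as well. -/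
theorem exists_glue [Finite A] [Finite B] {σ : Perm α}
    (h : ∀ a, ∃ a', σ (e (Sum.inl a)) = e (Sum.inl a')) : ∃ σ₁ σ₂, σ = glue e σ₁ σ₂ := by
  have h1 : Set.MapsTo (e.symm.permCongr σ) (Set.range Sum.inl) (Set.range Sum.inl) := by
    rintro _ ⟨a, rfl⟩
    obtain ⟨a', ha'⟩ := h a
    exact ⟨a', by simp [Equiv.permCongr_apply, ha']⟩
  obtain ⟨⟨σ₁, σ₂⟩, hσ⟩ := Perm.mem_sumCongrHom_range_of_perm_mapsTo_inl h1
  refine ⟨σ₁, σ₂, ?_⟩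
  have : e.symm.permCongr σ = Equiv.sumCongr σ₁ σ₂ := hσ.symm
  rw [glue, ← this]
  ext x; simp [Equiv.permCongr_apply]

theorem sumCongr_zpow (τ₁ : Perm A) (τ₂ : Perm B) (k : ℤ) :
    (Equiv.sumCongr τ₁ τ₂ : Perm (A ⊕ B)) ^ k = Equiv.sumCongr (τ₁ ^ k) (τ₂ ^ k) :=
  (map_zpow (Perm.sumCongrHom A B) (τ₁, τ₂) k).symm

theorem sameCycle_glue_inl (τ₁ : Perm A) (τ₂ : Perm B) (x y : A) :
    (glue e τ₁ τ₂).SameCycle (e (Sum.inl x)) (e (Sum.inl y)) ↔ τ₁.SameCycle x y := by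
  rw [glue, sameCycle_permCongr, Perm.SameCycle, Perm.SameCycle]
  simp [sumCongr_zpow]

theorem sameCycle_glue_inr (τ₁ : Perm A) (τ₂ : Perm B) (x y : B) :
    (glue e τ₁ τ₂).SameCycle (e (Sum.inr x)) (e (Sum.inr y)) ↔ τ₂.SameCycle x y := by
  rw [glue, sameCycle_permCongr, Perm.SameCycle, Perm.SameCycle]
  simp [sumCongr_zpow]

theorem not_sameCycle_glue (τ₁ : Perm A) (τ₂ : Perm B) (x : A) (y : B) :
    ¬ (glue e τ₁ τ₂).SameCycle (e (Sum.inl x)) (e (Sum.inr y)) := by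
  rw [glue, sameCycle_permCongr, Perm.SameCycle]
  simp [sumCongr_zpow]

/-- The cycles of a glued permutation. -/
def cycGlue (τ₁ : Perm A) (τ₂ : Perm B) : Cyc τ₁ ⊕ Cyc τ₂ ≃ Cyc (glue e τ₁ τ₂) :=
  Equiv.ofBijective (Sum.elim (fun q => Cyc.mk _ (e (Sum.inl q.out)))
    (fun q => Cyc.mk _ (e (Sum.inr q.out)))) <| by
    constructor
    · rintro (p | p) (q | q) hpq
      · rw [← p.mk_out, ← q.mk_out, Sum.inl.injEq, Cyc.mk_eq, ← sameCycle_glue_inl e τ₁ τ₂]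
        exact Cyc.mk_eq.1 hpq
      · exact absurd (Cyc.mk_eq.1 hpq) (not_sameCycle_glue e τ₁ τ₂ _ _)
      · exact absurd (Cyc.mk_eq.1 hpq).symm (not_sameCycle_glue e τ₁ τ₂ _ _)
      · rw [← p.mk_out, ← q.mk_out, Sum.inr.injEq, Cyc.mk_eq, ← sameCycle_glue_inr e τ₁ τ₂]
        exact Cyc.mk_eq.1 hpq
    · intro q
      obtain ⟨x | x, hx⟩ := e.surjective q.out
      · refine ⟨Sum.inl (Cyc.mk _ x), ?_⟩
        rw [← q.mk_out, ← hx]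
        exact Cyc.mk_eq.2 ((sameCycle_glue_inl e τ₁ τ₂ _ _).2 (Cyc.out_mk _ _))
      · refine ⟨Sum.inr (Cyc.mk _ x), ?_⟩
        rw [← q.mk_out, ← hx]
        exact Cyc.mk_eq.2 ((sameCycle_glue_inr e τ₁ τ₂ _ _).2 (Cyc.out_mk _ _))

theorem cycGlue_inl (τ₁ : Perm A) (τ₂ : Perm B) (q : Cyc τ₁) {M : Type*} {φ : α → M}
    (hφ : IsClass (glue e τ₁ τ₂) φ) :
    φ (cycGlue e τ₁ τ₂ (Sum.inl q)).out = φ (e (Sum.inl q.out)) := hφ _ _ (Cyc.out_mk _ _)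

theorem cycGlue_inr (τ₁ : Perm A) (τ₂ : Perm B) (q : Cyc τ₂) {M : Type*} {φ : α → M}
    (hφ : IsClass (glue e τ₁ τ₂) φ) :
    φ (cycGlue e τ₁ τ₂ (Sum.inr q)).out = φ (e (Sum.inr q.out)) := hφ _ _ (Cyc.out_mk _ _)

theorem sz_glue_inl (τ₁ : Perm A) (τ₂ : Perm B) (x : A) :
    sz (glue e τ₁ τ₂) (e (Sum.inl x)) = sz τ₁ x := by
  rw [sz, sz, ← Set.ncard_image_of_injective _ (e.injective.comp Sum.inl_injective)]
  congr 1
  ext z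
  obtain ⟨z | z, rfl⟩ := e.surjective z
  · simp [sameCycle_glue_inl]
  · simp [not_sameCycle_glue]

theorem sz_glue_inr (τ₁ : Perm A) (τ₂ : Perm B) (x : B) :
    sz (glue e τ₁ τ₂) (e (Sum.inr x)) = sz τ₂ x := by
  rw [sz, sz, ← Set.ncard_image_of_injective _ (e.injective.comp Sum.inr_injective)]
  congr 1
  ext z
  obtain ⟨z | z, rfl⟩ := e.surjective z
  · simp only [Set.mem_ofPred_eq, Set.mem_image, Function.comp, EmbeddingLike.apply_eq_iff_eq,
      reduceCtorEq, and_false, exists_false, iff_false]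
    exact fun h => not_sameCycle_glue e τ₁ τ₂ _ _ h.symm
  · simp [sameCycle_glue_inr]

variable [Finite A] [Finite B]

theorem nc_glue (τ₁ : Perm A) (τ₂ : Perm B) : nc (glue e τ₁ τ₂) = nc τ₁ + nc τ₂ := by
  rw [nc, ← Nat.card_congr (cycGlue e τ₁ τ₂), Nat.card_sum]; rfl

/-- The defects of the two parts add up and are non-negative, so their sum vanishes only if both do.
-/
theorem geo_glue_iff {σ₁ : Perm A} {σ₂ : Perm B} {τ₁ : Perm A} {τ₂ : Perm B} :
    Geo (glue e τ₁ τ₂) (glue e σ₁ σ₂) ↔ Geo τ₁ σ₁ ∧ Geo τ₂ σ₂ := by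
  simp only [Geo, glue_inv_mul, nc_glue]
  rw [← Nat.card_congr e, Nat.card_sum]
  have h1 := nc_triangle τ₁ σ₁
  have h2 := nc_triangle τ₂ σ₂
  omega

variable [Finite α]

theorem cprod_glue (τ₁ : Perm A) (τ₂ : Perm B) {φ : α → ℂ} (hφ : IsClass (glue e τ₁ τ₂) φ) :
    cprod (glue e τ₁ τ₂) φ =
      cprod τ₁ (fun a => φ (e (Sum.inl a))) * cprod τ₂ (fun b => φ (e (Sum.inr b))) := by
  rw [cprod, ← Equiv.prod_comp (cycGlue e τ₁ τ₂), Fintype.prod_sum_type]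
  simp only [cycGlue_inl e τ₁ τ₂ _ hφ, cycGlue_inr e τ₁ τ₂ _ hφ]
  rfl

theorem restProd_glue (τ₁ : Perm A) (τ₂ : Perm B) {φ : α → ℂ} (hφ : IsClass (glue e τ₁ τ₂) φ)
    (q₁ q₂ : Cyc τ₁) :
    restProd (glue e τ₁ τ₂) φ (cycGlue e τ₁ τ₂ (Sum.inl q₁)) (cycGlue e τ₁ τ₂ (Sum.inl q₂)) =
      restProd τ₁ (fun a => φ (e (Sum.inl a))) q₁ q₂ * cprod τ₂ (fun b => φ (e (Sum.inr b))) := by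
  rw [restProd, ← Equiv.prod_comp (cycGlue e τ₁ τ₂), Fintype.prod_sum_type]
  simp only [cycGlue_inl e τ₁ τ₂ _ hφ, cycGlue_inr e τ₁ τ₂ _ hφ, EmbeddingLike.apply_eq_iff_eq,
    Sum.inl.injEq, reduceCtorEq, or_self, if_false]
  rfl

/-- Neither mark can fall on a cycle of the second part, so that part contributes its full product
as a common factor. -/
theorem markedSum_glue (τ₁ : Perm A) (τ₂ : Perm B) {φ : α → ℂ} {P Q : α → Prop}
    {ψ : α → α → ℂ} (hφ : IsClass (glue e τ₁ τ₂) φ) (hP : IsClass (glue e τ₁ τ₂) P)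
    (hQ : IsClass (glue e τ₁ τ₂) Q) (hψ : ∀ y, IsClass (glue e τ₁ τ₂) fun x => ψ x y)
    (hψ' : ∀ x, IsClass (glue e τ₁ τ₂) (ψ x)) (hPr : ∀ b, ¬ P (e (Sum.inr b)))
    (hQr : ∀ b, ¬ Q (e (Sum.inr b))) :
    markedSum (glue e τ₁ τ₂) P Q φ ψ =
      markedSum τ₁ (fun a => P (e (Sum.inl a))) (fun a => Q (e (Sum.inl a)))
        (fun a => φ (e (Sum.inl a))) (fun a b => ψ (e (Sum.inl a)) (e (Sum.inl b))) *
      cprod τ₂ (fun b => φ (e (Sum.inr b))) := by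
  rw [markedSum, markedSum, Finset.sum_mul]
  refine (Fintype.sum_of_injective (fun q : Cyc τ₁ × Cyc τ₁ =>
    (cycGlue e τ₁ τ₂ (Sum.inl q.1), cycGlue e τ₁ τ₂ (Sum.inl q.2))) ?_ _ _ ?_ ?_).symm
  · rintro ⟨p, q⟩ ⟨p', q'⟩ h
    simpa using h
  · rintro ⟨p, q⟩ h
    refine if_neg ?_
    rintro ⟨h1, h2⟩
    obtain ⟨p | p, rfl⟩ := (cycGlue e τ₁ τ₂).surjective p
    · obtain ⟨q | q, rfl⟩ := (cycGlue e τ₁ τ₂).surjective q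
      · exact h ⟨(p, q), rfl⟩
      · exact hQr _ ((cycGlue_inr e τ₁ τ₂ q hQ) ▸ h2)
    · exact hPr _ ((cycGlue_inr e τ₁ τ₂ p hP) ▸ h1)
  · rintro ⟨p, q⟩
    dsimp only
    rw [cycGlue_inl e τ₁ τ₂ _ hP, cycGlue_inl e τ₁ τ₂ _ hQ, cycGlue_inl e τ₁ τ₂ _ (hψ _),
      cycGlue_inl e τ₁ τ₂ _ (hψ' _), restProd_glue e τ₁ τ₂ hφ, ite_mul, zero_mul, mul_assoc]

theorem Geo.exists_glue {σ₁ : Perm A} {σ₂ : Perm B} {τ : Perm α} (h : Geo τ (glue e σ₁ σ₂)) :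
    ∃ τ₁ τ₂, τ = glue e τ₁ τ₂ := by
  refine SecondOrderFree.exists_glue e fun a => ?_
  have := h.sameCycle (sameCycle_apply_self τ (e (Sum.inl a)))
  obtain ⟨z | z, hz⟩ := e.surjective (τ (e (Sum.inl a)))
  · exact ⟨z, hz.symm⟩
  · rw [← hz] at this
    exact absurd this (not_sameCycle_glue e σ₁ σ₂ _ _)

end Glue

/-! ### Expanding the weights of the cycles -/

section Expansion

/-- The sum of the weights of the non-crossing permutations of a disc with `k` points. -/
def discWeight (f : ℕ → ℂ) (k : ℕ) : ℂ := geoWeight (finRotate k) f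

/-- The colouring of the two circles of the annulus. -/
def circle (k l : ℕ) : Fin (k + l) → Bool := fun i => decide (k ≤ i.1)

/-- The sum of the weights over the annulus with `k` and `l` points on its circles. -/
def annulusWeight (f : ℕ → ℂ) (g : ℕ → ℕ → ℂ) (k l : ℕ) : ℂ :=
  annWeight (annularRotation k l) (circle k l) f g

theorem isConj_of_transitive {n : ℕ} {σ τ : Perm (Fin n)} (hσ : ∀ x y, σ.SameCycle x y)
    (hτ : ∀ x y, τ.SameCycle x y) : IsConj σ τ := by
  -- A single fixed point is not an `IsCycle`, so fewer than two points are treated apart. From two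
  -- points on, a transitive permutation is a cycle of full support, and equal supports give
  -- conjugacy.
  rcases Nat.lt_or_ge n 2 with hn | hn
  · have : Subsingleton (Fin n) := by
      rw [← Fintype.card_le_one_iff_subsingleton, Fintype.card_fin]; omega
    rw [Subsingleton.elim σ τ]
  have : Nontrivial (Fin n) := Fin.nontrivial_iff_two_le.2 hn
  have hne : ∀ {ρ : Perm (Fin n)}, (∀ x y, ρ.SameCycle x y) → ∀ x, ρ x ≠ x := by
    intro ρ hρ x hx
    obtain ⟨y, hy⟩ := exists_ne x
    obtain ⟨i, -, hi⟩ := (hρ x y).exists_pow_eq'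
    rw [Perm.pow_apply_eq_self_of_apply_eq_self hx] at hi
    exact hy hi.symm
  have hcyc : ∀ {ρ : Perm (Fin n)}, (∀ x y, ρ.SameCycle x y) → ρ.IsCycle := fun {ρ} hρ =>
    ⟨⟨0, by omega⟩, hne hρ _, fun y _ => hρ _ y⟩
  rw [Perm.IsCycle.isConj_iff (hcyc hσ) (hcyc hτ)]
  congr 1
  ext x
  simp [hne hσ, hne hτ]

theorem exists_permCongr_finRotate {α : Type*} [Finite α] {σ : Perm α}
    (h : ∀ x y, σ.SameCycle x y) :
    ∃ e : α ≃ Fin (Nat.card α), e.permCongr σ = finRotate (Nat.card α) := by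
  let e := Finite.equivFin α
  have h' : ∀ x y, (e.permCongr σ).SameCycle x y := fun x y => by
    obtain ⟨x, rfl⟩ := e.surjective x
    obtain ⟨y, rfl⟩ := e.surjective y
    exact (sameCycle_permCongr e σ x y).2 (h x y)
  obtain ⟨c, hc⟩ := isConj_iff.1 (isConj_of_transitive h' sameCycle_finRotate)
  refine ⟨e.trans c, ?_⟩
  rw [← hc]
  ext x
  simp [Equiv.permCongr_apply, Perm.inv_def]

theorem geoWeight_of_transitive {α : Type*} [Finite α] {σ : Perm α}
    (h : ∀ x y, σ.SameCycle x y) (f : ℕ → ℂ) : geoWeight σ f = discWeight f (Nat.card α) := by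
  obtain ⟨e, he⟩ := exists_permCongr_finRotate h
  rw [discWeight, ← he, geoWeight_permCongr]

theorem sz_of_transitive {α : Type*} {σ : Perm α} (h : ∀ x y, σ.SameCycle x y) (x : α) :
    sz σ x = Nat.card α := by
  rw [sz, show {y | σ.SameCycle x y} = Set.univ from Set.eq_univ_of_forall (h x), Set.ncard_univ]

theorem cprod_of_transitive {α : Type*} [Finite α] {σ : Perm α}
    (h : ∀ x y, σ.SameCycle x y) (x : α) {φ : α → ℂ} (hφ : IsClass σ φ) : cprod σ φ = φ x := by
  rw [cprod, Fintype.prod_eq_single (Cyc.mk σ x)]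
  · exact hφ.out_mk x
  · intro q hq
    refine absurd ?_ hq
    rw [← q.mk_out, Cyc.mk_eq]
    exact h _ _

/-! ### Multiplicativity of the disc weight over disjoint unions -/

section GlueSums

variable {A B α : Type*} [Finite A] [Finite B] [Finite α] (e : A ⊕ B ≃ α)

theorem cprod_sz_glue (τ₁ : Perm A) (τ₂ : Perm B) (f : ℕ → ℂ) :
    cprod (glue e τ₁ τ₂) (fun x => f (sz (glue e τ₁ τ₂) x)) =
      cprod τ₁ (fun x => f (sz τ₁ x)) * cprod τ₂ (fun x => f (sz τ₂ x)) := by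
  rw [cprod_glue e τ₁ τ₂ ((isClass_sz _).comp f)]
  simp only [sz_glue_inl, sz_glue_inr]

theorem geoWeight_glue (σ₁ : Perm A) (σ₂ : Perm B) (f : ℕ → ℂ) :
    geoWeight (glue e σ₁ σ₂) f = geoWeight σ₁ f * geoWeight σ₂ f := by
  rw [geoWeight, geoSum, geoWeight, geoSum, geoWeight, geoSum, Finset.sum_mul_sum,
    ← Finset.sum_product', Finset.univ_product_univ]
  refine (Fintype.sum_of_injective _ (glue_injective e) _ _ ?_ ?_).symm
  · intro τ hτ
    refine if_neg fun h => hτ ?_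
    obtain ⟨τ₁, τ₂, rfl⟩ := h.exists_glue
    exact ⟨(τ₁, τ₂), rfl⟩
  · rintro ⟨τ₁, τ₂⟩
    dsimp only
    rw [cprod_sz_glue, geo_glue_iff]
    by_cases h1 : Geo τ₁ σ₁ <;> by_cases h2 : Geo τ₂ σ₂ <;> simp [h1, h2]

end GlueSums

/-- A permutation geodesic below `σ` preserves the cycles of `σ`, and on each of them it is an
independent choice of a non-crossing permutation of a disc. Multiplying out the disc weights
therefore enumerates all of them. -/
theorem cprod_discWeight {α : Type*} [Finite α] (σ : Perm α) (f : ℕ → ℂ) :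
    cprod σ (fun x => discWeight f (sz σ x)) = geoWeight σ f := by
  induction hn : Nat.card α using Nat.strong_induction_on generalizing α with
  | _ n ih =>
  subst hn
  rcases isEmpty_or_nonempty α with hα | ⟨⟨x⟩⟩
  · have hc : ∀ (τ : Perm α) φ, cprod τ φ = 1 := fun τ φ => by
      have : IsEmpty (Cyc τ) := ⟨fun q => hα.elim q.out⟩
      exact Fintype.prod_empty _
    rw [geoWeight, geoSum, hc]
    refine (Eq.trans (Finset.sum_eq_single σ
      (fun τ _ hτ => absurd (Subsingleton.elim _ _) hτ)
      fun h => absurd (@Finset.mem_univ _ permFintype _) h) ?_).symm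
    rw [hc, if_pos]
    rw [Geo, Subsingleton.elim (σ⁻¹ * σ) 1, nc_one, add_comm]
  · let p : α → Prop := fun z => σ.SameCycle x z
    let e : {z // p z} ⊕ {z // ¬ p z} ≃ α := Equiv.sumCompl p
    obtain ⟨σ₁, σ₂, hσ⟩ := exists_glue e (σ := σ) fun a =>
      ⟨⟨σ a.1, Perm.sameCycle_apply_right.2 a.2⟩, rfl⟩
    have htr : ∀ a b, σ₁.SameCycle a b := fun a b => by
      rw [← sameCycle_glue_inl e σ₁ σ₂, ← hσ]
      exact a.2.symm.trans b.2
    have hlt : Nat.card {z // ¬ p z} < Nat.card α := by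
      have : Nat.card {z // p z} + Nat.card {z // ¬ p z} = Nat.card α := by
        rw [← Nat.card_sum, Nat.card_congr e]
      have h2 : 0 < Nat.card {z // p z} :=
        Nat.card_pos_iff.2 ⟨⟨⟨x, Perm.SameCycle.refl _ _⟩⟩, inferInstance⟩
      omega
    have := ih _ hlt σ₂ rfl
    rw [hσ, cprod_sz_glue e σ₁ σ₂ (discWeight f), geoWeight_glue, this,
      cprod_of_transitive htr ⟨x, Perm.SameCycle.refl _ _⟩ ((isClass_sz _).comp _),
      sz_of_transitive htr, geoWeight_of_transitive htr]

/-- Each colour class is a single cycle of `σ` and can be identified with a rotated disc; the two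
identifications combine to one of the annulus. -/
theorem exists_permCongr_annularRotation {α : Type*} [Finite α] {σ : Perm α} {col : α → Bool}
    (hcol : ∀ x, col (σ x) = col x) (h : ∀ x y, col x = col y → σ.SameCycle x y) {k l : ℕ}
    (hk : Nat.card {x // col x = false} = k) (hl : Nat.card {x // col x = true} = l) :
    ∃ e : α ≃ Fin (k + l), e.permCongr σ = annularRotation k l ∧ ∀ x, circle k l (e x) = col x := by
  subst hk hl
  let e : {x // col x = false} ⊕ {x // ¬ col x = false} ≃ α := Equiv.sumCompl _
  let u : {x // ¬ col x = false} ≃ {x // col x = true} :=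
    Equiv.subtypeEquivRight fun x => by simp
  obtain ⟨σ₁, σ₂, hσ⟩ := exists_glue e (σ := σ) fun a => ⟨⟨σ a.1, (hcol _).trans a.2⟩, rfl⟩
  have h₁ : ∀ a b, σ₁.SameCycle a b := fun a b => by
    rw [← sameCycle_glue_inl e σ₁ σ₂, ← hσ]
    exact h _ _ (a.2.trans b.2.symm)
  have h₂ : ∀ a b, σ₂.SameCycle a b := fun a b => by
    rw [← sameCycle_glue_inr e σ₁ σ₂, ← hσ]
    exact h _ _ ((Bool.eq_true_of_not_eq_false a.2).trans (Bool.eq_true_of_not_eq_false b.2).symm)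
  obtain ⟨e₁, he₁⟩ := exists_permCongr_finRotate h₁
  rw [← Nat.card_congr u]
  obtain ⟨e₂, he₂⟩ := exists_permCongr_finRotate h₂
  refine ⟨e.symm.trans ((Equiv.sumCongr e₁ e₂).trans finSumFinEquiv), ?_, ?_⟩
  · rw [annularRotation, prodPerm, ← he₁, ← he₂, hσ]
    ext x
    obtain ⟨x | x, rfl⟩ := finSumFinEquiv.surjective x <;>
      simp [Equiv.permCongr_apply, glue]
  · intro x
    obtain ⟨x | x, rfl⟩ := e.surjective x
    · have : col (e (Sum.inl x)) = false := x.2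
      simp [circle, this]
    · have : col (e (Sum.inr x)) = true := Bool.eq_true_of_not_eq_false x.2
      simp [circle, this]

theorem circle_annularRotation (k l : ℕ) (x : Fin (k + l)) :
    circle k l (annularRotation k l x) = circle k l x := by
  induction x using Fin.addCases with
  | left x =>
    rw [annularRotation, prodPerm_castAdd]
    simp only [circle, Fin.val_castAdd, decide_eq_decide]
    omega
  | right x => rw [annularRotation, prodPerm_natAdd]; simp [circle]

theorem annWeight_of_transitive {α : Type*} [Finite α] {σ : Perm α} {col : α → Bool}
    (hcol : ∀ x, col (σ x) = col x) (h : ∀ x y, col x = col y → σ.SameCycle x y) (f : ℕ → ℂ)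
    (g : ℕ → ℕ → ℂ) : annWeight σ col f g =
      annulusWeight f g (Nat.card {x // col x = false}) (Nat.card {x // col x = true}) := by
  obtain ⟨e, he, hc⟩ := exists_permCongr_annularRotation hcol h rfl rfl
  rw [annulusWeight, ← he, annWeight_permCongr e σ]
  · simp only [hc]
  · intro x
    rw [he, circle_annularRotation]

end Expansion

/-! ### Expanding the weights of marked pairs of cycles -/

section MarkedExpansion

variable {α : Type*} [Finite α]

/-- The part of `annSum` in which the cycles of `x` and `y` are connected. -/
def annPart (σ : Perm α) (x y : α) (f : ℕ → ℂ) : ℂ :=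
  ∑ τ : Perm α, if nc τ + nc (τ⁻¹ * σ) + 2 = Nat.card α + nc σ ∧
      ∃ u v, σ.SameCycle x u ∧ σ.SameCycle y v ∧ τ.SameCycle u v then
    cprod τ (fun z => f (sz τ z)) else 0

/-- The part of `geoMarkedSum` in which the marked cycles lie in the cycles of `x` and `y`. -/
def geoPart (σ : Perm α) (x y : α) (f : ℕ → ℂ) (g : ℕ → ℕ → ℂ) : ℂ :=
  ∑ τ : Perm α, if Geo τ σ then
    markedSum τ (σ.SameCycle x) (σ.SameCycle y) (fun z => f (sz τ z))
      (fun z w => g (sz τ z) (sz τ w)) else 0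

omit [Finite α] in
theorem exists_sameCycle_of_col {τ : Perm α} {col : α → Bool} (h : ∃ x, col (τ x) ≠ col x) :
    ∃ u v, col u = false ∧ col v = true ∧ τ.SameCycle u v := by
  obtain ⟨x, hx⟩ := h
  have hs := sameCycle_apply_self τ x
  cases h1 : col x <;> cases h2 : col (τ x)
  · exact absurd (h2.trans h1.symm) hx
  · exact ⟨_, _, h1, h2, hs⟩
  · exact ⟨_, _, h2, h1, hs.symm⟩
  · exact absurd (h2.trans h1.symm) hx

theorem exists_col_ne {τ : Perm α} {col : α → Bool} {u v : α} (hu : col u = false)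
    (hv : col v = true) (h : τ.SameCycle u v) : ∃ x, col (τ x) ≠ col x := by
  by_contra hc
  push Not at hc
  have := sameCycle_col hc h
  simp [hu, hv] at this

/-- By `joinClasses_of_nc_eq` an annular permutation connects exactly one cycle of colour `false`
with one of colour `true`; sorting by this pair counts each permutation once. -/
theorem annSum_eq_sum_annPart {σ : Perm α} {col : α → Bool} (hcol : ∀ x, col (σ x) = col x)
    (f : ℕ → ℂ) : annSum σ col (fun τ x => f (sz τ x)) =
      ∑ q : Cyc σ × Cyc σ, if col q.1.out = false ∧ col q.2.out = true then
        annPart σ q.1.out q.2.out f else 0 := by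
  have hne : ∀ {u v}, col u = false → col v = true → ¬ σ.SameCycle u v := fun hu hv h => by
    have := sameCycle_col hcol h
    simp [hu, hv] at this
  simp only [annSum, annPart, Finset.ite_sum_zero]
  rw [Finset.sum_comm]
  refine Finset.sum_congr rfl fun τ _ => ?_
  simp only [← ite_and]
  by_cases hA : Ann σ col τ
  · rw [if_pos hA]
    obtain ⟨hn, hx⟩ := hA
    obtain ⟨u, v, hu, hv, huv⟩ := exists_sameCycle_of_col hx
    rw [Fintype.sum_eq_single (Cyc.mk σ u, Cyc.mk σ v), if_pos]
    · have hcl : IsClass σ col := isClass_of_apply hcol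
      exact ⟨⟨(hcl.out_mk u).trans hu, (hcl.out_mk v).trans hv⟩, hn, u, v, Cyc.out_mk σ u,
        Cyc.out_mk σ v, huv⟩
    · rintro ⟨q₁, q₂⟩ hq
      refine if_neg ?_
      rintro ⟨⟨h1, h2⟩, -, u', v', hu', hv', huv'⟩
      dsimp only at h1 h2 hu' hv'
      have cu : col u' = false := (sameCycle_col hcol hu').symm.trans h1
      have cv : col v' = true := (sameCycle_col hcol hv').symm.trans h2
      refine hq (Prod.ext ?_ ?_)
      all_goals
        rcases joinClasses_of_nc_eq hn huv (hne hu hv) huv' with h | ⟨h | h, h' | h'⟩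
        · exact absurd h (hne cu cv)
        · exact absurd h' (hne hu cv)
        · first
          | exact q₁.mk_out.symm.trans (Cyc.mk_eq.2 (hu'.trans h.symm))
          | exact q₂.mk_out.symm.trans (Cyc.mk_eq.2 (hv'.trans h'.symm))
        · exact absurd h.symm (hne cu hv)
        · exact absurd h.symm (hne cu hv)
  · rw [if_neg hA]
    refine (Fintype.sum_eq_zero _ fun q => if_neg ?_).symm
    rintro ⟨⟨h1, h2⟩, hn, u, v, hu, hv, huv⟩
    exact hA ⟨hn, exists_col_ne ((sameCycle_col hcol hu).symm.trans h1)
      ((sameCycle_col hcol hv).symm.trans h2) huv⟩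

/-- The marks are sorted by the cycles of `σ` that contain their chosen points. -/
theorem markedSum_eq_sum {σ : Perm α} {col : α → Bool} (hcol : ∀ x, col (σ x) = col x)
    (τ : Perm α) (φ : α → ℂ) (ψ : α → α → ℂ) :
    markedSum τ (fun x => col x = false) (fun x => col x = true) φ ψ =
      ∑ q : Cyc σ × Cyc σ, if col q.1.out = false ∧ col q.2.out = true then
        markedSum τ (σ.SameCycle q.1.out) (σ.SameCycle q.2.out) φ ψ else 0 := by
  have hcl : IsClass σ col := isClass_of_apply hcol
  simp only [markedSum, Finset.ite_sum_zero]
  rw [Finset.sum_comm]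
  refine Finset.sum_congr rfl fun p _ => ?_
  simp only [← ite_and]
  rw [Fintype.sum_eq_single (Cyc.mk σ p.1.out, Cyc.mk σ p.2.out)]
  · dsimp only
    rw [hcl.out_mk, hcl.out_mk]
    by_cases h : col p.1.out = false ∧ col p.2.out = true
    · rw [if_pos h, if_pos ⟨h, Cyc.out_mk _ _, Cyc.out_mk _ _⟩]
    · rw [if_neg h, if_neg fun h' => h h'.1]
  · rintro ⟨q₁, q₂⟩ hq
    refine if_neg ?_
    rintro ⟨-, h1, h2⟩
    exact hq (Prod.ext (q₁.mk_out.symm.trans (Cyc.mk_eq.2 h1))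
      (q₂.mk_out.symm.trans (Cyc.mk_eq.2 h2)))

theorem geoMarkedSum_eq_sum_geoPart {σ : Perm α} {col : α → Bool}
    (hcol : ∀ x, col (σ x) = col x) (f : ℕ → ℂ) (g : ℕ → ℕ → ℂ) :
    geoMarkedSum σ col (fun τ x => f (sz τ x)) (fun τ x y => g (sz τ x) (sz τ y)) =
      ∑ q : Cyc σ × Cyc σ, if col q.1.out = false ∧ col q.2.out = true then
        geoPart σ q.1.out q.2.out f g else 0 := by
  simp only [geoMarkedSum, geoPart, Finset.ite_sum_zero]
  rw [Finset.sum_comm]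
  refine Finset.sum_congr rfl fun τ _ => ?_
  rw [markedSum_eq_sum hcol, Finset.ite_sum_zero]
  refine Finset.sum_congr rfl fun q _ => ?_
  rw [← ite_and, ← ite_and]
  exact if_congr and_comm rfl rfl

/-! ### Separating a pair of cycles (the part `A`) from all other cycles (the part `B`) -/

section Glued

variable {A B : Type*} [Finite A] [Finite B] (e : A ⊕ B ≃ α) (σ₁ : Perm A) (σ₂ : Perm B)
  {x y : α} (hxy : ¬ (glue e σ₁ σ₂).SameCycle x y)
  (hA : ∀ a, (glue e σ₁ σ₂).SameCycle x (e (Sum.inl a)) ∨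
    (glue e σ₁ σ₂).SameCycle y (e (Sum.inl a)))
  (hB : ∀ b, ¬ (glue e σ₁ σ₂).SameCycle x (e (Sum.inr b)) ∧
    ¬ (glue e σ₁ σ₂).SameCycle y (e (Sum.inr b)))

/-- The colouring of the union of two cycles that gives the cycle of `y` the colour `true`. -/
def twoCol (y : α) (a : A) : Bool := decide ((glue e σ₁ σ₂).SameCycle y (e (Sum.inl a)))

omit [Finite α] [Finite A] [Finite B] in
theorem twoCol_apply (a : A) : twoCol e σ₁ σ₂ y (σ₁ a) = twoCol e σ₁ σ₂ y a := by
  rw [twoCol, twoCol, ← glue_inl e σ₁ σ₂, decide_eq_decide, Perm.sameCycle_apply_right]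

omit [Finite α] [Finite A] [Finite B] in
include hxy hA in
theorem twoCol_eq_false (a : A) :
    twoCol e σ₁ σ₂ y a = false ↔ (glue e σ₁ σ₂).SameCycle x (e (Sum.inl a)) := by
  rw [twoCol, decide_eq_false_iff_not]
  refine ⟨fun h => (hA a).resolve_right h, fun h h' => hxy (h.trans h'.symm)⟩

omit [Finite α] [Finite A] [Finite B] in
theorem twoCol_eq_true (a : A) :
    twoCol e σ₁ σ₂ y a = true ↔ (glue e σ₁ σ₂).SameCycle y (e (Sum.inl a)) := by
  rw [twoCol, decide_eq_true_iff]

include hxy hA hB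

/-- All connections between cycles of the ambient permutation take place inside `A`, so `τ` splits
into an annular permutation of `A` and a geodesic one of `B`. -/
theorem annPart_glue (f : ℕ → ℂ) : annPart (glue e σ₁ σ₂) x y f =
    annSum σ₁ (twoCol e σ₁ σ₂ y) (fun τ z => f (sz τ z)) * geoWeight σ₂ f := by
  rw [annPart, annSum, geoWeight, geoSum, Finset.sum_mul_sum, ← Finset.sum_product',
    Finset.univ_product_univ]
  refine (Fintype.sum_of_injective _ (glue_injective e) _ _ ?_ ?_).symm
  · intro τ hτ
    refine if_neg ?_
    rintro ⟨hn, u, v, hu, hv, huv⟩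
    refine hτ ?_
    obtain ⟨τ₁, τ₂, rfl⟩ := exists_glue e (σ := τ) fun a => by
      have hj := joinClasses_of_nc_eq hn huv (fun h => hxy (hu.trans (h.trans hv.symm)))
        (sameCycle_apply_self τ (e (Sum.inl a)))
      obtain ⟨z | z, hz⟩ := e.surjective (τ (e (Sum.inl a)))
      · exact ⟨z, hz.symm⟩
      · exfalso
        rw [← hz] at hj
        rcases hj with h | ⟨-, h | h⟩
        · exact not_sameCycle_glue _ _ _ _ _ h
        · exact (hB z).1 (hu.trans h)
        · exact (hB z).2 (hv.trans h)
    exact ⟨(τ₁, τ₂), rfl⟩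
  · rintro ⟨τ₁, τ₂⟩
    dsimp only
    have hiff : (nc (glue e τ₁ τ₂) + nc ((glue e τ₁ τ₂)⁻¹ * glue e σ₁ σ₂) + 2 =
          Nat.card α + nc (glue e σ₁ σ₂) ∧ ∃ u v, (glue e σ₁ σ₂).SameCycle x u ∧
          (glue e σ₁ σ₂).SameCycle y v ∧ (glue e τ₁ τ₂).SameCycle u v) ↔
        Ann σ₁ (twoCol e σ₁ σ₂ y) τ₁ ∧ Geo τ₂ σ₂ := by
      rw [glue_inv_mul, nc_glue, nc_glue, nc_glue, ← Nat.card_congr e, Nat.card_sum, Ann, Geo]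
      have t2 := nc_triangle τ₂ σ₂
      constructor
      · rintro ⟨hn, u, v, hu, hv, huv⟩
        have hc : ∃ z, twoCol e σ₁ σ₂ y (τ₁ z) ≠ twoCol e σ₁ σ₂ y z := by
          obtain ⟨u | u, rfl⟩ := e.surjective u
          · obtain ⟨v | v, rfl⟩ := e.surjective v
            · exact exists_col_ne ((twoCol_eq_false e σ₁ σ₂ hxy hA u).2 hu)
                ((twoCol_eq_true e σ₁ σ₂ v).2 hv) ((sameCycle_glue_inl e τ₁ τ₂ u v).1 huv)
            · exact absurd hv (hB v).2
          · exact absurd hu (hB u).1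
        -- The two defects add up to 2, and a change of colour forces at least 2 on `A`; nothing is
        -- left for `B`.
        have t1 := nc_triangle_of_col (twoCol_apply e σ₁ σ₂) hc
        exact ⟨⟨by omega, hc⟩, by omega⟩
      · rintro ⟨⟨h1, hc⟩, h2⟩
        obtain ⟨u, v, hu, hv, huv⟩ := exists_sameCycle_of_col hc
        exact ⟨by omega, _, _, (twoCol_eq_false e σ₁ σ₂ hxy hA u).1 hu,
          (twoCol_eq_true e σ₁ σ₂ v).1 hv, (sameCycle_glue_inl e τ₁ τ₂ u v).2 huv⟩
    rw [if_congr hiff rfl rfl, cprod_sz_glue]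
    by_cases h1 : Ann σ₁ (twoCol e σ₁ σ₂ y) τ₁ <;> by_cases h2 : Geo τ₂ σ₂ <;> simp [h1, h2]

theorem geoPart_glue (f : ℕ → ℂ) (g : ℕ → ℕ → ℂ) : geoPart (glue e σ₁ σ₂) x y f g =
    geoMarkedSum σ₁ (twoCol e σ₁ σ₂ y) (fun τ z => f (sz τ z))
      (fun τ z w => g (sz τ z) (sz τ w)) * geoWeight σ₂ f := by
  rw [geoPart, geoMarkedSum, geoWeight, geoSum, Finset.sum_mul_sum, ← Finset.sum_product',
    Finset.univ_product_univ]
  refine (Fintype.sum_of_injective _ (glue_injective e) _ _ ?_ ?_).symm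
  · intro τ hτ
    refine if_neg fun h => hτ ?_
    obtain ⟨τ₁, τ₂, rfl⟩ := h.exists_glue
    exact ⟨(τ₁, τ₂), rfl⟩
  · rintro ⟨τ₁, τ₂⟩
    dsimp only
    by_cases h : Geo (glue e τ₁ τ₂) (glue e σ₁ σ₂)
    · have hcl : ∀ z, IsClass (glue e τ₁ τ₂) ((glue e σ₁ σ₂).SameCycle z) :=
        fun z w w' hw => propext ⟨fun k => k.trans (h.sameCycle hw),
          fun k => k.trans (h.sameCycle hw).symm⟩
      rw [if_pos h, markedSum_glue e τ₁ τ₂ ((isClass_sz _).comp f) (hcl x) (hcl y)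
        (fun w => (isClass_sz _).comp fun k => g k _) (fun w => (isClass_sz _).comp (g _))
        (fun b => (hB b).1) fun b => (hB b).2]
      rw [geo_glue_iff] at h
      simp only [sz_glue_inl, sz_glue_inr, if_pos h.1, if_pos h.2,
        twoCol_eq_false e σ₁ σ₂ hxy hA, twoCol_eq_true e σ₁ σ₂]
    · rw [if_neg h]
      rw [geo_glue_iff, not_and_or] at h
      rcases h with h | h <;> simp [h]

theorem annPart_add_geoPart_glue (f : ℕ → ℂ) (g : ℕ → ℕ → ℂ) :
    annPart (glue e σ₁ σ₂) x y f + geoPart (glue e σ₁ σ₂) x y f g =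
      annulusWeight f g (sz (glue e σ₁ σ₂) x) (sz (glue e σ₁ σ₂) y) * geoWeight σ₂ f := by
  have hcard : ∀ z, (∀ b, ¬ (glue e σ₁ σ₂).SameCycle z (e (Sum.inr b))) →
      Nat.card {a // (glue e σ₁ σ₂).SameCycle z (e (Sum.inl a))} = sz (glue e σ₁ σ₂) z := by
    intro z hz
    rw [sz, ← Nat.card_coe_set_eq]
    refine Nat.card_congr (Equiv.ofBijective (fun a => ⟨e (Sum.inl a.1), a.2⟩) ⟨?_, ?_⟩)
    · rintro ⟨a, ha⟩ ⟨b, hb⟩ hab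
      simpa using hab
    · rintro ⟨w, hw⟩
      obtain ⟨w | w, rfl⟩ := e.surjective w
      · exact ⟨⟨w, hw⟩, rfl⟩
      · exact absurd hw (hz w)
  rw [annPart_glue e σ₁ σ₂ hxy hA hB, geoPart_glue e σ₁ σ₂ hxy hA hB, ← add_mul]
  congr 1
  rw [← annWeight, annWeight_of_transitive (twoCol_apply e σ₁ σ₂)]
  · simp only [twoCol_eq_false e σ₁ σ₂ hxy hA, twoCol_eq_true e σ₁ σ₂]
    rw [hcard x fun b => (hB b).1, hcard y fun b => (hB b).2]
  · intro a b hab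
    rw [← sameCycle_glue_inl e σ₁ σ₂]
    cases hb : twoCol e σ₁ σ₂ y b
    · exact ((twoCol_eq_false e σ₁ σ₂ hxy hA a).1 (hab.trans hb)).symm.trans
        ((twoCol_eq_false e σ₁ σ₂ hxy hA b).1 hb)
    · exact ((twoCol_eq_true e σ₁ σ₂ a).1 (hab.trans hb)).symm.trans
        ((twoCol_eq_true e σ₁ σ₂ b).1 hb)

omit hxy in
theorem restProd_two_cycles {φ : α → ℂ} (hφ : IsClass (glue e σ₁ σ₂) φ) :
    restProd (glue e σ₁ σ₂) φ (Cyc.mk _ x) (Cyc.mk _ y) =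
      cprod σ₂ fun b => φ (e (Sum.inr b)) := by
  rw [restProd, ← Equiv.prod_comp (cycGlue e σ₁ σ₂), Fintype.prod_sum_type]
  have h1 : ∀ q : Cyc σ₁, cycGlue e σ₁ σ₂ (Sum.inl q) = Cyc.mk _ x ∨
      cycGlue e σ₁ σ₂ (Sum.inl q) = Cyc.mk _ y := fun q =>
    (hA q.out).imp (fun h => Cyc.mk_eq.2 h.symm) (fun h => Cyc.mk_eq.2 h.symm)
  have h2 : ∀ q : Cyc σ₂, ¬ (cycGlue e σ₁ σ₂ (Sum.inr q) = Cyc.mk _ x ∨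
      cycGlue e σ₁ σ₂ (Sum.inr q) = Cyc.mk _ y) := fun q h =>
    h.elim (fun h => (hB q.out).1 (Cyc.mk_eq.1 h).symm)
      (fun h => (hB q.out).2 (Cyc.mk_eq.1 h).symm)
  simp only [if_pos (h1 _), if_neg (h2 _), Finset.prod_const_one, one_mul,
    cycGlue_inr e σ₁ σ₂ _ hφ]
  rfl

end Glued

/-- The cycles of `x` and `y` are the circles of an annulus on which both the annular and the marked
terms live. On the other cycles a geodesic permutation is chosen freely, which gives their disc
weights. -/
theorem annPart_add_geoPart (σ : Perm α) {x y : α} (hxy : ¬ σ.SameCycle x y) (f : ℕ → ℂ)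
    (g : ℕ → ℕ → ℂ) : annPart σ x y f + geoPart σ x y f g =
      annulusWeight f g (sz σ x) (sz σ y) *
        restProd σ (fun z => discWeight f (sz σ z)) (Cyc.mk σ x) (Cyc.mk σ y) := by
  let p : α → Prop := fun z => σ.SameCycle x z ∨ σ.SameCycle y z
  let e : {z // p z} ⊕ {z // ¬ p z} ≃ α := Equiv.sumCompl p
  obtain ⟨σ₁, σ₂, hσ⟩ := exists_glue e (σ := σ) fun a =>
    ⟨⟨σ a.1, a.2.imp Perm.sameCycle_apply_right.2 Perm.sameCycle_apply_right.2⟩, rfl⟩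
  have hA : ∀ a, (glue e σ₁ σ₂).SameCycle x (e (Sum.inl a)) ∨
      (glue e σ₁ σ₂).SameCycle y (e (Sum.inl a)) := fun a => by
    rw [← hσ]; exact a.2
  have hB : ∀ b, ¬ (glue e σ₁ σ₂).SameCycle x (e (Sum.inr b)) ∧
      ¬ (glue e σ₁ σ₂).SameCycle y (e (Sum.inr b)) := fun b => by
    rw [← hσ]; exact not_or.1 b.2
  have h1 := annPart_add_geoPart_glue e σ₁ σ₂ (by rwa [← hσ]) hA hB f g
  have h2 := restProd_two_cycles e σ₁ σ₂ hA hB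
    ((isClass_sz (glue e σ₁ σ₂)).comp (discWeight f))
  simp only [sz_glue_inr, cprod_discWeight] at h2
  rw [← h2, ← hσ] at h1
  exact h1

/-- Expanding the weights of the cycles of `σ` and of a marked pair of cycles. -/
theorem markedSum_annulusWeight {σ : Perm α} {col : α → Bool} (hcol : ∀ x, col (σ x) = col x)
    (f : ℕ → ℂ) (g : ℕ → ℕ → ℂ) :
    markedSum σ (fun x => col x = false) (fun x => col x = true)
      (fun z => discWeight f (sz σ z)) (fun z w => annulusWeight f g (sz σ z) (sz σ w)) =
      annWeight σ col f g := by
  rw [annWeight, annSum_eq_sum_annPart hcol, geoMarkedSum_eq_sum_geoPart hcol,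
    ← Finset.sum_add_distrib, markedSum]
  refine Finset.sum_congr rfl fun q _ => ?_
  by_cases h : col q.1.out = false ∧ col q.2.out = true
  · rw [if_pos h, if_pos h, if_pos h, annPart_add_geoPart, Cyc.mk_out, Cyc.mk_out]
    intro hs
    have := sameCycle_col hcol hs
    simp [h.1, h.2] at this
  · rw [if_neg h, if_neg h, if_neg h, add_zero]

end MarkedExpansion

/-! ### Alternating permutations -/

section Alternating

/-- All elements of the cycle of `x` alternate in `s`. -/
def AltAt {β : Type*} (s : β → Bool) (π : Perm β) (x : β) : Prop :=
  ∀ y, π.SameCycle x y → s (π y) ≠ s y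

/-- The weight of the alternating cycles of length `2k` is `f k`, that of all others is `0`. -/
def altΦ {β : Type*} (s : β → Bool) (f : ℕ → ℂ) (π : Perm β) (x : β) : ℂ :=
  if AltAt s π x then f (sz π x / 2) else 0

/-- The weight of a pair of cycles analogous to `altΦ`. -/
def altΨ {β : Type*} (s : β → Bool) (g : ℕ → ℕ → ℂ) (π : Perm β) (x y : β) : ℂ :=
  if AltAt s π x ∧ AltAt s π y then g (sz π x / 2) (sz π y / 2) else 0

/-! ### Invariance on cycles and vanishing of the alternating weights -/

section Class

variable {β : Type*} (s : β → Bool) (f : ℕ → ℂ) (g : ℕ → ℕ → ℂ) (π : Perm β)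

theorem isClass_altAt : IsClass π (AltAt s π) := fun _ _ h => propext
  ⟨fun k z hz => k z (h.trans hz), fun k z hz => k z (h.symm.trans hz)⟩

theorem isClass_altΦ : IsClass π (altΦ s f π) := fun x y h => by
  rw [altΦ, altΦ, isClass_altAt s π x y h, isClass_sz π x y h]

theorem isClass_altΨ_left (z : β) : IsClass π fun x => altΨ s g π x z := fun x y h => by
  simp only [altΨ]
  rw [isClass_altAt s π x y h, isClass_sz π x y h]

theorem isClass_altΨ_right (z : β) : IsClass π (altΨ s g π z) := fun x y h => by
  rw [altΨ, altΨ, isClass_altAt s π x y h, isClass_sz π x y h]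

variable {s π} {f g}

theorem cprod_altΦ_eq_zero [Finite β] {x : β} (h : ¬ AltAt s π x) : cprod π (altΦ s f π) = 0 :=
  Finset.prod_eq_zero (Finset.mem_univ (Cyc.mk π x)) <| by
    rw [(isClass_altΦ s f π).out_mk, altΦ, if_neg h]

/-- The non-alternating cycle is either marked, and then kills the factor of the marked pair, or
unmarked, and then kills the product over the remaining cycles. -/
theorem markedSum_alt_eq_zero [Finite β] {P Q : β → Prop} {x : β} (h : ¬ AltAt s π x) :
    markedSum π P Q (altΦ s f π) (altΨ s g π) = 0 := by
  refine Fintype.sum_eq_zero _ fun q => ?_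
  split_ifs
  · have hm : ∀ q : Cyc π, q = Cyc.mk π x → ¬ AltAt s π q.out := by
      rintro _ rfl
      rwa [(isClass_altAt s π).out_mk]
    by_cases h1 : q.1 = Cyc.mk π x
    · rw [altΨ, if_neg fun h' => hm _ h1 h'.1, zero_mul]
    by_cases h2 : q.2 = Cyc.mk π x
    · rw [altΨ, if_neg fun h' => hm _ h2 h'.2, zero_mul]
    rw [restProd, Finset.prod_eq_zero (Finset.mem_univ (Cyc.mk π x)), mul_zero]
    rw [if_neg (by tauto), altΦ, if_neg (hm _ rfl)]
  · rfl

theorem altAt_permCongr {α : Type*} (e : α ≃ β) (τ : Perm α) (x : α) :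
    AltAt s (e.permCongr τ) (e x) ↔ AltAt (fun x => s (e x)) τ x := by
  constructor
  · intro h y hy
    have := h (e y) ((sameCycle_permCongr e τ x y).2 hy)
    simpa [Equiv.permCongr_apply] using this
  · intro h y hy
    obtain ⟨y, rfl⟩ := e.surjective y
    have := h y ((sameCycle_permCongr e τ x y).1 hy)
    simpa [Equiv.permCongr_apply] using this

end Class

/-! ### Alternating permutations of two copies as pairs of permutations -/

section Alt

variable {α : Type*}

/-- The alternating permutation of the two copies of `α` whose square on the first copy is `τ`
and that maps the second copy to the first one by `σ`. -/
def alt (σ τ : Perm α) : Perm (α ⊕ α) where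
  toFun := Sum.elim (fun i => Sum.inr (σ.symm (τ i))) (fun j => Sum.inl (σ j))
  invFun := Sum.elim (fun i => Sum.inr (σ.symm i)) (fun j => Sum.inl (τ.symm (σ j)))
  left_inv := by rintro (x | x) <;> simp
  right_inv := by rintro (x | x) <;> simp

@[simp] theorem alt_inl (σ τ : Perm α) (x : α) : alt σ τ (Sum.inl x) = Sum.inr (σ.symm (τ x)) := rfl

@[simp] theorem alt_inr (σ τ : Perm α) (x : α) : alt σ τ (Sum.inr x) = Sum.inl (σ x) := rfl

theorem alt_injective : Function.Injective fun p : Perm α × Perm α => alt p.1 p.2 := by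
  rintro ⟨σ, τ⟩ ⟨σ', τ'⟩ h
  have h1 : σ = σ' := by
    ext x
    have := congrArg (fun π : Perm (α ⊕ α) => π (Sum.inr x)) h
    simpa using this
  subst h1
  have h2 : τ = τ' := by
    ext x
    have := congrArg (fun π : Perm (α ⊕ α) => π (Sum.inl x)) h
    simpa using this
  rw [h2]

theorem altAt_alt (σ τ : Perm α) (x : α ⊕ α) : AltAt Sum.isLeft (alt σ τ) x := by
  rintro (y | y) - <;> simp

variable [Finite α]

/-- Alternation means that `π` exchanges the copies: it maps the first to the second by some `F` and
the second to the first by some `G`, so that `σ = G` and `τ = G * F`. -/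
theorem exists_alt {π : Perm (α ⊕ α)} (h : ∀ x, AltAt Sum.isLeft π x) : ∃ σ τ, π = alt σ τ := by
  have h1 : ∀ x, ∃ y, π (Sum.inl x) = Sum.inr y := fun x => by
    have := h _ _ (Perm.SameCycle.refl π (Sum.inl x))
    cases hx : π (Sum.inl x) with
    | inl y => simp [hx] at this
    | inr y => exact ⟨y, rfl⟩
  have h2 : ∀ x, ∃ y, π (Sum.inr x) = Sum.inl y := fun x => by
    have := h _ _ (Perm.SameCycle.refl π (Sum.inr x))
    cases hx : π (Sum.inr x) with
    | inl y => exact ⟨y, rfl⟩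
    | inr y => simp [hx] at this
  choose f hf using h1
  choose g hg using h2
  have hfi : Function.Injective f := fun x y hxy => by
    have : π (Sum.inl x) = π (Sum.inl y) := by rw [hf, hf, hxy]
    simpa using this
  have hgi : Function.Injective g := fun x y hxy => by
    have : π (Sum.inr x) = π (Sum.inr y) := by rw [hg, hg, hxy]
    simpa using this
  let F : Perm α := Equiv.ofBijective f (Finite.injective_iff_bijective.1 hfi)
  let G : Perm α := Equiv.ofBijective g (Finite.injective_iff_bijective.1 hgi)
  refine ⟨G, G * F, Equiv.ext ?_⟩
  rintro (x | x)
  · rw [hf, alt_inl, Perm.mul_apply, Equiv.symm_apply_apply]; rfl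
  · rw [hg, alt_inr]; rfl

/-- Every second point of an alternating cycle lies in the first copy, and two steps from such a
point are one step of `τ`. In one direction the second copy is pulled back to the first by `σ`. -/
theorem sameCycle_alt (σ τ : Perm α) (x y : α) :
    (alt σ τ).SameCycle (Sum.inl x) (Sum.inl y) ↔ τ.SameCycle x y := by
  constructor
  · intro h
    refine setoid_sameCycle_le (σ := alt σ τ)
      (r := (Perm.SameCycle.setoid τ).comap (Sum.elim id σ)) ?_ h
    rintro (z | z)
    · change τ.SameCycle z (σ (σ.symm (τ z)))
      rw [Equiv.apply_symm_apply]
      exact sameCycle_apply_self τ z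
    · exact Perm.SameCycle.refl τ _
  · intro h
    refine setoid_sameCycle_le (r := (Perm.SameCycle.setoid (alt σ τ)).comap Sum.inl) ?_ h
    intro z
    have h1 := sameCycle_apply_self (alt σ τ) (Sum.inl z)
    have h2 := sameCycle_apply_self (alt σ τ) (Sum.inr (σ.symm (τ z)))
    rw [alt_inr, Equiv.apply_symm_apply] at h2
    exact h1.trans h2

omit [Finite α] in
theorem exists_sameCycle_alt (σ τ : Perm α) (z : α ⊕ α) :
    ∃ x, (alt σ τ).SameCycle (Sum.inl x) z := by
  rcases z with z | z
  · exact ⟨z, Perm.SameCycle.refl _ _⟩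
  · exact ⟨σ z, (sameCycle_apply_self (alt σ τ) (Sum.inr z)).symm⟩

theorem nc_alt (σ τ : Perm α) : nc (alt σ τ) = nc τ :=
  (nc_match (sameCycle_alt σ τ) (exists_sameCycle_alt σ τ)).symm

theorem sz_alt (σ τ : Perm α) (x : α) : sz (alt σ τ) (Sum.inl x) = 2 * sz τ x := by
  have h : {y | (alt σ τ).SameCycle (Sum.inl x) y} =
      Sum.inl '' {y | τ.SameCycle x y} ∪ (fun y => Sum.inr (σ.symm y)) '' {y | τ.SameCycle x y} := by
    ext (y | y)
    · simp [sameCycle_alt]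
    · have : (alt σ τ).SameCycle (Sum.inl x) (Sum.inr y) ↔ τ.SameCycle x (σ y) := by
        rw [← Perm.sameCycle_apply_right, alt_inr, sameCycle_alt]
      simp [this, Equiv.symm_apply_eq]
  rw [sz, h, Set.ncard_union_eq _ (Set.toFinite _) (Set.toFinite _),
    Set.ncard_image_of_injective _ Sum.inl_injective,
    Set.ncard_image_of_injective _ (f := fun y => Sum.inr (σ.symm y)) (Sum.inr_injective.comp σ.symm.injective), ← two_mul, sz]
  rw [Set.disjoint_left]
  rintro _ ⟨y, -, rfl⟩ ⟨z, -, hz⟩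
  simp at hz

omit [Finite α] in
-- Both factors exchange the copies, so the quotient preserves each of them. This splitting of the
-- complement turns one non-crossing condition into a condition on a chain.
theorem alt_inv_mul (σ τ γ : Perm α) :
    (alt σ τ)⁻¹ * alt γ γ = glue (Equiv.refl (α ⊕ α)) (τ⁻¹ * σ) (σ⁻¹ * γ) := by
  rw [inv_mul_eq_iff_eq_mul]
  refine Equiv.ext ?_
  rintro (x | x)
  · have := glue_inl (Equiv.refl (α ⊕ α)) (τ⁻¹ * σ) (σ⁻¹ * γ) x
    simp only [Equiv.refl_apply] at this
    simp [this]
  · have := glue_inr (Equiv.refl (α ⊕ α)) (τ⁻¹ * σ) (σ⁻¹ * γ) x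
    simp only [Equiv.refl_apply] at this
    simp [this]

/-- The defect of the alternating permutation is the sum of the non-negative defects of the pairs
(τ, σ) and (σ, γ), so it vanishes exactly for chains of geodesics. -/
theorem geo_alt_iff {σ τ γ : Perm α} : Geo (alt σ τ) (alt γ γ) ↔ Geo τ σ ∧ Geo σ γ := by
  rw [Geo, Geo, Geo, alt_inv_mul, nc_glue, nc_alt, nc_alt, Nat.card_sum]
  have h1 := nc_triangle τ σ
  have h2 := nc_triangle σ γ
  omega

/-- A defect of 2 is used up by a single change of colour. If `σ` changes colours, the step from `σ`
to `γ` takes all of it; if `σ` preserves them, then `τ` must change colours and the step from `τ` to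
`σ` takes it. -/
theorem ann_alt_iff {σ τ γ : Perm α} {col : α → Bool} (hcol : ∀ x, col (γ x) = col x) :
    Ann (alt γ γ) (Sum.elim col col) (alt σ τ) ↔
      (Ann γ col σ ∧ Geo τ σ) ∨ (Geo σ γ ∧ Ann σ col τ) := by
  have hc : (∃ x, Sum.elim col col (alt σ τ x) ≠ Sum.elim col col x) ↔
      (∃ x, col (σ x) ≠ col x) ∨ ((∀ x, col (σ x) = col x) ∧ ∃ x, col (τ x) ≠ col x) := by
    by_cases hσ : ∀ x, col (σ x) = col x
    · have hσ' : ∀ x, col (σ.symm x) = col x := fun x => by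
        have := hσ (σ.symm x)
        rw [Equiv.apply_symm_apply] at this
        exact this.symm
      simp [hσ, hσ']
    · push Not at hσ
      obtain ⟨x, hx⟩ := hσ
      exact iff_of_true ⟨Sum.inr x, hx⟩ (Or.inl ⟨x, hx⟩)
  rw [Ann, Ann, Ann, Geo, Geo, hc, alt_inv_mul, nc_glue, nc_alt, nc_alt, Nat.card_sum]
  have h1 := nc_triangle τ σ
  have h2 := nc_triangle σ γ
  have hσγ := nc_triangle_of_col (τ := σ) hcol
  by_cases hσ : ∀ x, col (σ x) = col x
  · have hτσ := nc_triangle_of_col (τ := τ) hσ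
    have hn : ¬ ∃ x, col (σ x) ≠ col x := by push Not; exact hσ
    by_cases hτ : ∃ x, col (τ x) ≠ col x
    · have := hτσ hτ
      refine ⟨fun h => Or.inr ⟨by omega, by omega, hτ⟩, ?_⟩
      rintro (⟨⟨-, h⟩, -⟩ | ⟨h, h', -⟩)
      · exact absurd h hn
      · exact ⟨by omega, Or.inr ⟨hσ, hτ⟩⟩
    · simp [hn, hτ]
  · have hn : ∃ x, col (σ x) ≠ col x := by push Not at hσ; exact hσ
    have := hσγ hn
    refine ⟨fun h => Or.inl ⟨⟨by omega, hn⟩, by omega⟩, ?_⟩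
    rintro (⟨⟨h, -⟩, h'⟩ | ⟨h, h', -⟩)
    · exact ⟨by omega, Or.inl hn⟩
    · omega

omit [Finite α] in
theorem Ann.not_geo {σ τ : Perm α} {col : α → Bool} (h : Ann σ col τ) : ¬ Geo τ σ := by
  have := h.1
  rw [Geo]
  omega

theorem altΦ_alt (σ τ : Perm α) (f : ℕ → ℂ) (x : α) :
    altΦ Sum.isLeft f (alt σ τ) (Sum.inl x) = f (sz τ x) := by
  rw [altΦ, if_pos (altAt_alt _ _ _), sz_alt, Nat.mul_div_cancel_left _ two_pos]

theorem altΨ_alt (σ τ : Perm α) (g : ℕ → ℕ → ℂ) (x y : α) :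
    altΨ Sum.isLeft g (alt σ τ) (Sum.inl x) (Sum.inl y) = g (sz τ x) (sz τ y) := by
  rw [altΨ, if_pos ⟨altAt_alt _ _ _, altAt_alt _ _ _⟩, sz_alt, sz_alt,
    Nat.mul_div_cancel_left _ two_pos, Nat.mul_div_cancel_left _ two_pos]

theorem cprod_altΦ_alt (σ τ : Perm α) (f : ℕ → ℂ) :
    cprod (alt σ τ) (altΦ Sum.isLeft f (alt σ τ)) = cprod τ fun x => f (sz τ x) := by
  rw [← cprod_match (sameCycle_alt σ τ) (exists_sameCycle_alt σ τ) (isClass_altΦ _ _ _)]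
  simp only [altΦ_alt]

theorem sum_alt {F : Perm (α ⊕ α) → ℂ}
    (hF : ∀ π x, ¬ AltAt Sum.isLeft π x → F π = 0) :
    ∑ π, F π = ∑ σ : Perm α, ∑ τ : Perm α, F (alt σ τ) := by
  rw [← Finset.sum_product', Finset.univ_product_univ]
  refine (Fintype.sum_of_injective _ alt_injective _ _ (fun π hπ => ?_) fun _ => rfl).symm
  by_contra hne
  refine hπ ?_
  obtain ⟨σ, τ, rfl⟩ := exists_alt (π := π) fun x => by
    by_contra hx
    exact hne (hF π x hx)
  exact ⟨(σ, τ), rfl⟩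

/-- The sum runs over chains τ ≤ σ ≤ γ; for fixed `σ` the sum over `τ` is the product of the disc
weights of the cycles of `σ`. -/
theorem geoSum_alt (γ : Perm α) (f : ℕ → ℂ) :
    geoSum (alt γ γ) (altΦ Sum.isLeft f) = geoWeight γ (discWeight f) := by
  rw [geoSum, sum_alt fun π x hx => by rw [cprod_altΦ_eq_zero hx, ite_self], geoWeight, geoSum]
  refine Finset.sum_congr rfl fun σ _ => ?_
  rw [cprod_discWeight, geoWeight, geoSum, Finset.ite_sum_zero]
  refine Finset.sum_congr rfl fun τ _ => ?_
  rw [cprod_altΦ_alt, ← ite_and]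
  exact if_congr (geo_alt_iff.trans and_comm) rfl rfl

theorem annSum_add_geoMarkedSum_alt {γ : Perm α} {col : α → Bool}
    (hcol : ∀ x, col (γ x) = col x) (f : ℕ → ℂ) (g : ℕ → ℕ → ℂ) :
    annSum (alt γ γ) (Sum.elim col col) (altΦ Sum.isLeft f) +
      geoMarkedSum (alt γ γ) (Sum.elim col col) (altΦ Sum.isLeft f) (altΨ Sum.isLeft g) =
      annWeight γ col (discWeight f) (annulusWeight f g) := by
  rw [annSum, sum_alt fun π x hx => by rw [cprod_altΦ_eq_zero hx, ite_self],
    geoMarkedSum, sum_alt fun π x hx => by rw [markedSum_alt_eq_zero hx, ite_self],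
    annWeight, annSum, geoMarkedSum, ← Finset.sum_add_distrib, ← Finset.sum_add_distrib]
  refine Finset.sum_congr rfl fun σ _ => ?_
  rw [cprod_discWeight]
  -- For geodesic `σ`, the annular and the marked `τ` together make up the weight of `σ` with a
  -- marked pair of its own cycles. For any other `σ`, only annular `σ` with a geodesic `τ` below it
  -- contribute.
  by_cases hσ : Geo σ γ
  · have hna : ¬ Ann γ col σ := fun h => h.not_geo hσ
    have hσc : ∀ x, col (σ x) = col x := hσ.col hcol
    rw [if_neg hna, if_pos hσ, zero_add, markedSum_annulusWeight hσc, annWeight, annSum,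
      geoMarkedSum]
    congr 1
    · refine Finset.sum_congr rfl fun τ _ => ?_
      rw [cprod_altΦ_alt]
      exact if_congr ((ann_alt_iff hcol).trans (by simp [hna, hσ])) rfl rfl
    · refine Finset.sum_congr rfl fun τ _ => ?_
      by_cases hτ : Geo τ σ
      · have hτc : ∀ x, Sum.elim col col (alt σ τ x) = Sum.elim col col x :=
          Geo.col (geo_alt_iff.2 ⟨hτ, hσ⟩) (by rintro (x | x) <;> simp [hcol])
        have hcl : IsClass (alt σ τ) (Sum.elim col col) := isClass_of_apply hτc
        rw [if_pos (geo_alt_iff.2 ⟨hτ, hσ⟩), if_pos hτ,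
          ← markedSum_match (sameCycle_alt σ τ) (exists_sameCycle_alt σ τ) (isClass_altΦ _ _ _)
            (hcl.comp (· = false)) (hcl.comp (· = true)) (isClass_altΨ_left _ _ _)
            (isClass_altΨ_right _ _ _)]
        simp only [altΦ_alt, altΨ_alt, Sum.elim_inl]
      · rw [if_neg hτ, if_neg fun h => hτ (geo_alt_iff.1 h).1]
  · have h1 : ∀ τ, ¬ Geo (alt σ τ) (alt γ γ) := fun τ h => hσ (geo_alt_iff.1 h).2
    simp only [if_neg hσ, if_neg (h1 _), Finset.sum_const_zero, add_zero, cprod_altΦ_alt]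
    rw [geoWeight, geoSum, Finset.ite_sum_zero]
    refine Finset.sum_congr rfl fun τ _ => ?_
    rw [← ite_and]
    exact if_congr ((ann_alt_iff hcol).trans (by simp [hσ])) rfl rfl

end Alt

/-! ### Reduction of a sign-reversing rotation to the model on two copies -/

section Flip

variable {β : Type*} [Finite β] {Γ : Perm β} {s : β → Bool}

omit [Finite β] in
-- The points of sign `true` form the first copy and their images under `Γ` the second; `γ` is the
-- square of `Γ` on the first copy.
theorem exists_permCongr_alt (hs : ∀ x, s (Γ x) ≠ s x) :
    ∃ (γ : Perm {x // s x = true}) (e : {x // s x = true} ⊕ {x // s x = true} ≃ β),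
      e.permCongr (alt γ γ) = Γ ∧ (∀ i, e (Sum.inl i) = i.1) ∧ (∀ i, e (Sum.inr i) = Γ i.1) := by
  have hs' : ∀ x, s (Γ x) = !s x := fun x => by
    have := hs x
    cases h : s x <;> cases h' : s (Γ x) <;> simp_all
  let γ : Perm {x // s x = true} := (Γ * Γ).subtypePerm fun x => by simp [hs']
  let e : {x // s x = true} ⊕ {x // s x = true} ≃ β :=
    Equiv.ofBijective (Sum.elim (fun i => i.1) fun i => Γ i.1) <| by
      constructor
      · rintro (⟨x, hx⟩ | ⟨x, hx⟩) (⟨y, hy⟩ | ⟨y, hy⟩) h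
        · simpa using h
        · simp only [Sum.elim_inl, Sum.elim_inr] at h
          rw [h, hs', hy] at hx
          simp at hx
        · simp only [Sum.elim_inl, Sum.elim_inr] at h
          rw [← h, hs', hx] at hy
          simp at hy
        · simpa using h
      · intro y
        cases h : s y
        · refine ⟨Sum.inr ⟨Γ.symm y, ?_⟩, by simp⟩
          have := hs' (Γ.symm y)
          rw [Equiv.apply_symm_apply, h] at this
          simpa using this
        · exact ⟨Sum.inl ⟨y, h⟩, rfl⟩
  refine ⟨γ, e, Equiv.ext fun y => ?_, fun _ => rfl, fun _ => rfl⟩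
  obtain ⟨y | y, rfl⟩ := e.surjective y
  · rw [Equiv.permCongr_apply, e.symm_apply_apply, alt_inl, Equiv.symm_apply_apply]; rfl
  · rw [Equiv.permCongr_apply, e.symm_apply_apply, alt_inr]; rfl

/-- The sum of the weights of the alternating non-crossing permutations of a disc. -/
theorem geoSum_altΦ (hs : ∀ x, s (Γ x) ≠ s x) (hΓ : ∀ x y, Γ.SameCycle x y) (f : ℕ → ℂ) {n : ℕ}
    (hn : Nat.card β = 2 * n) :
    geoSum Γ (altΦ s f) = discWeight (discWeight f) n := by
  obtain ⟨γ, e, rfl, h1, h2⟩ := exists_permCongr_alt hs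
  have hse : (fun x => s (e x)) = Sum.isLeft := by
    funext x
    rcases x with x | x
    · rw [h1]; exact x.2
    · have := hs (e (Sum.inl x))
      rw [h2, ← h1]
      rw [show s (e (Sum.inl x)) = true by rw [h1]; exact x.2] at this
      simpa using this
  have hcard : Nat.card {x // s x = true} = n := by
    have := Nat.card_congr e
    rw [Nat.card_sum] at this
    omega
  rw [geoSum_permCongr e (alt γ γ) (Φ := altΦ Sum.isLeft f) (isClass_altΦ s f), geoSum_alt,
    geoWeight_of_transitive, hcard]
  · intro x y
    rw [← sameCycle_alt γ, ← sameCycle_permCongr e]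
    exact hΓ _ _
  · intro τ x
    rw [altΦ, altΦ, altAt_permCongr, sz_permCongr, hse]

/-- The sum of the weights of the alternating partitioned permutations of an annulus. -/
theorem annSum_add_geoMarkedSum_altΦ (hs : ∀ x, s (Γ x) ≠ s x) {col : β → Bool}
    (hcol : ∀ x, col (Γ x) = col x) (hΓ : ∀ x y, col x = col y → Γ.SameCycle x y) (f : ℕ → ℂ)
    (g : ℕ → ℕ → ℂ) {p q : ℕ} (hp : Nat.card {x // col x = false} = 2 * p)
    (hq : Nat.card {x // col x = true} = 2 * q) :
    annSum Γ col (altΦ s f) + geoMarkedSum Γ col (altΦ s f) (altΨ s g) =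
      annulusWeight (discWeight f) (annulusWeight f g) p q := by
  obtain ⟨γ, e, rfl, h1, h2⟩ := exists_permCongr_alt hs
  have hse : (fun x => s (e x)) = Sum.isLeft := by
    funext x
    rcases x with x | x
    · rw [h1]; exact x.2
    · have := hs (e (Sum.inl x))
      rw [h2, ← h1]
      rw [show s (e (Sum.inl x)) = true by rw [h1]; exact x.2] at this
      simpa using this
  have hce : (fun x => col (e x)) = Sum.elim (fun i : {x // s x = true} => col i.1)
      (fun i : {x // s x = true} => col i.1) := by
    funext x
    rcases x with x | x
    · rw [h1]; rfl
    · rw [h2, hcol]; rfl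
  have hcard : ∀ b, Nat.card {x // col x = b} =
      2 * Nat.card {x : {x // s x = true} // col x.1 = b} := fun b => by
    rw [two_mul, ← Nat.card_sum]
    refine Nat.card_congr ((e.subtypeEquiv fun x => ?_).symm.trans
      (Equiv.subtypeSum (p := fun x => Sum.elim (fun i : {x // s x = true} => col i.1)
        (fun i : {x // s x = true} => col i.1) x = b)))
    rw [← congrFun hce x]
  rw [annSum_permCongr e (alt γ γ) col (Φ := altΦ Sum.isLeft f) (isClass_altΦ s f),
    geoMarkedSum_permCongr e (alt γ γ) hcol (Φ := altΦ Sum.isLeft f) (Ψ := altΨ Sum.isLeft g)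
      (isClass_altΦ s f) _ (isClass_altΨ_left s g) (isClass_altΨ_right s g), hce,
    annSum_add_geoMarkedSum_alt, annWeight_of_transitive]
  · have := hcard false
    have := hcard true
    congr 1 <;> omega
  · intro x
    have := hcol (e (Sum.inr x))
    rw [Equiv.permCongr_apply, e.symm_apply_apply, alt_inr, h1, h2, hcol] at this
    exact this
  · intro x y hxy
    rw [← sameCycle_alt γ, ← sameCycle_permCongr e]
    refine hΓ _ _ ?_
    rwa [h1, h1]
  · intro x
    have := hcol (e (Sum.inr x))
    rw [Equiv.permCongr_apply, e.symm_apply_apply, alt_inr, h1, h2, hcol] at this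
    exact this
  · intro τ x y
    rw [altΨ, altΨ, altAt_permCongr, altAt_permCongr, sz_permCongr, sz_permCongr, hse]
  · intro τ x
    rw [altΦ, altΦ, altAt_permCongr, sz_permCongr, hse]
  · intro τ x
    rw [altΦ, altΦ, altAt_permCongr, sz_permCongr, hse]

end Flip

end Alternating

/-! ### Non-crossing partitions are the geodesic permutations -/

section NonCrossing

/-! ### Transitivity of the geodesic order and products of transpositions -/

section Basic

variable {α : Type*} [Finite α]

omit [Finite α] in
theorem geo_self (σ : Perm α) : Geo σ σ := by
  rw [Geo, inv_mul_cancel, nc_one, add_comm]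

/-- Lengths add along the chain, and the triangle inequality for ρ⁻¹γ, factored through ρ⁻¹π and
π⁻¹γ, leaves no slack. -/
theorem Geo.trans {ρ π γ : Perm α} (h : Geo ρ π) (h' : Geo π γ) : Geo ρ γ := by
  have h1 := nc_triangle (ρ⁻¹ * π) (ρ⁻¹ * γ)
  have h2 := nc_triangle ρ γ
  rw [show (ρ⁻¹ * π)⁻¹ * (ρ⁻¹ * γ) = π⁻¹ * γ by group] at h1
  rw [Geo] at *
  omega

theorem not_sameCycle_of_apply_eq_self {σ : Perm α} {x y : α} (h : σ x = x) (hne : x ≠ y) :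
    ¬ σ.SameCycle x y := by
  intro hs
  obtain ⟨i, -, hi⟩ := hs.exists_pow_eq'
  rw [Perm.pow_apply_eq_self_of_apply_eq_self h] at hi
  exact hne hi

variable [DecidableEq α]

theorem nc_swap {x y : α} (h : x ≠ y) : nc (swap x y) + 1 = Nat.card α := by
  have := nc_swap_mul_of_not (σ := (1 : Perm α)) (x := x) (y := y)
    (by rwa [Perm.sameCycle_one])
  rwa [mul_one, nc_one] at this

/-- A product of two transpositions that splits a cycle of `π` twice is geodesic. -/
theorem Geo.nc_swap_swap {π γ : Perm α} (h : Geo π γ) {a c b d : α} (hac : a ≠ c) (hbd : b ≠ d)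
    (h1 : π.SameCycle a c) (h2 : (swap a c * π).SameCycle b d) :
    nc γ + 2 ≤ nc (swap b d * (swap a c * γ)) := by
  -- Two splittings raise the number of cycles of `π` by 2, while the product of two transpositions
  -- has length at most 2, so the triangle inequality is an equality. By transitivity the product is
  -- also geodesic below `γ`, where its length 2 becomes two additional cycles.
  have hρ : Geo (swap a c * swap b d) π := by
    have e : (swap a c * swap b d)⁻¹ * π = swap b d * (swap a c * π) := by
      simp [mul_inv_rev, mul_assoc]
    have h3 := nc_triangle (swap a c * swap b d) π
    rw [Geo]
    rw [e, nc_swap_mul_of_sameCycle h2 hbd, nc_swap_mul_of_sameCycle h1 hac] at *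
    have h4 := nc_swap hbd
    have h5 : nc (swap b d) ≤ nc (swap a c * swap b d) + 1 := by
      by_cases hs : (swap b d).SameCycle a c
      · rw [nc_swap_mul_of_sameCycle hs hac]; omega
      · exact (nc_swap_mul_of_not hs).ge
    omega
  have h6 := hρ.trans h
  rw [Geo] at h6
  have e : (swap a c * swap b d)⁻¹ * γ = swap b d * (swap a c * γ) := by
    simp [mul_inv_rev, mul_assoc]
  rw [e] at h6
  have h7 := nc_triangle (swap a c) (swap a c * swap b d)
  have h8 := nc_swap hac
  have h9 := nc_swap hbd
  rw [swap_inv, ← mul_assoc, swap_mul_self, one_mul] at h7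
  have h10 : nc (swap a c * swap b d) + 2 ≤ Nat.card α := by
    have h11 := nc_swap_mul_of_sameCycle h2 hbd
    have h12 := nc_swap_mul_of_sameCycle h1 hac
    have := hρ
    rw [Geo] at this
    have e' : (swap a c * swap b d)⁻¹ * π = swap b d * (swap a c * π) := by
      simp [mul_inv_rev, mul_assoc]
    rw [e'] at this
    omega
  omega

end Basic

variable {n : ℕ}

theorem nc_finRotate (hn : 0 < n) : nc (finRotate n) = 1 := by
  rw [nc, Nat.card_eq_one_iff_unique]
  refine ⟨⟨fun p q => ?_⟩, ⟨Cyc.mk _ ⟨0, hn⟩⟩⟩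
  rw [← p.mk_out, ← q.mk_out, Cyc.mk_eq]
  exact sameCycle_finRotate _ _

theorem val_finRotate (i : Fin n) :
    (finRotate n i).1 = if i.1 + 1 < n then i.1 + 1 else 0 := by
  rcases n with _ | n
  · exact i.elim0
  by_cases h : i.1 < n
  · rw [if_pos (by omega), show i = ⟨i.1, by omega⟩ from rfl, finRotate_of_lt h]
  · obtain rfl : i = Fin.last n := Fin.ext (by simp; omega)
    simp

/-- Cutting the rotation by the chord from `a` to `c` leaves the interval [a, c) invariant. -/
theorem not_sameCycle_swap_mul_finRotate {a c b d : Fin n} (hac : a < c)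
    (hb : a ≤ b ∧ b < c) (hd : ¬ (a ≤ d ∧ d < c)) :
    ¬ (swap a c * finRotate n).SameCycle b d := by
  have key : IsClass (swap a c * finRotate n) fun x => decide (a ≤ x ∧ x < c) := by
    refine isClass_of_apply fun x => ?_
    rw [decide_eq_decide, Perm.mul_apply]
    have hx := val_finRotate x
    rcases eq_or_ne (finRotate n x) a with h | h
    · rw [h, swap_apply_left]
      simp only [Fin.lt_def, Fin.le_def, Fin.ext_iff] at *
      split_ifs at hx <;> omega
    rcases eq_or_ne (finRotate n x) c with h' | h'
    · rw [h', swap_apply_right]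
      simp only [Fin.lt_def, Fin.le_def, Fin.ext_iff] at *
      split_ifs at hx <;> omega
    · rw [swap_apply_of_ne_of_ne h h']
      have := x.2
      simp only [Fin.lt_def, Fin.le_def, ne_eq, Fin.ext_iff] at *
      split_ifs at hx <;> omega
  intro hs
  have := key _ _ hs
  simp only [decide_eq_decide] at this
  exact hd (this.1 hb)

/-- The first transposition splits the rotation into two cycles, and the second joins them again as
`b` and `d` lie on different sides of the cut. This leaves one cycle, where a geodesic `π` would
force at least three. -/
theorem not_geo_finRotate {π : Perm (Fin n)} {a c b d : Fin n} (hac : a < c)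
    (hb : a ≤ b ∧ b < c) (hd : ¬ (a ≤ d ∧ d < c)) (h1 : π.SameCycle a c)
    (h2 : (swap a c * π).SameCycle b d) : ¬ Geo π (finRotate n) := by
  intro h
  have hn : 0 < n := (Nat.zero_le _).trans_lt a.2
  have hbd : b ≠ d := by
    rintro rfl
    exact hd hb
  have h3 := h.nc_swap_swap hac.ne hbd h1 h2
  have h4 := nc_swap_mul_of_not (not_sameCycle_swap_mul_finRotate hac hb hd)
  have h5 := nc_swap_mul_of_sameCycle (sameCycle_finRotate a c) hac.ne
  have := nc_finRotate hn
  omega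

/-- Any violation yields the forbidden pair of chords of `not_geo_finRotate`. If the order fails at
`i`, the first chord joins `i` to `π i` and the second joins `π i` to a misplaced point of the same
cycle. For a crossing, the two chords are those of the crossing blocks. -/
theorem Geo.isNC {π : Perm (Fin n)} (h : Geo π (finRotate n)) : IsNC π := by
  refine ⟨fun i => ?_, fun a b c d hab hbc hcd hac hbd => ?_⟩
  · have key : ∀ j, π i ≠ i → π.SameCycle i j → i ≠ j → (swap i (π i) * π).SameCycle (π i) j := by
      intro j hi hj hne
      set π' := swap i (π i) * π with hπ'
      have hfix : π' i = i := by simp [hπ']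
      have hππ : π = swap i (π i) * π' := by simp [hπ', ← mul_assoc]
      have hn := not_sameCycle_of_apply_eq_self hfix (Ne.symm hi)
      have hj' : joinClasses (Perm.SameCycle.setoid π') i (π i) i j := by
        rw [← sameCycle_swap_mul_iff hn, ← hππ]; exact hj
      have hij := not_sameCycle_of_apply_eq_self hfix hne
      rcases hj' with h | ⟨-, h | h⟩
      · exact absurd h hij
      · exact absurd h hij
      · exact h
    rcases lt_trichotomy i (π i) with hi | hi | hi
    · left
      refine ⟨hi, fun j hj => ?_⟩
      by_contra hc
      push Not at hc
      exact not_geo_finRotate hi ⟨hc.1.le, hc.2⟩ (by simp) (sameCycle_apply_self π i)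
        (key j hi.ne' hj hc.1.ne).symm h
    · right
      intro j hj
      obtain rfl : i = j := by
        by_contra hne
        exact not_sameCycle_of_apply_eq_self hi.symm hne hj
      exact ⟨hi.ge, le_rfl⟩
    · right
      intro j hj
      rw [← not_lt, ← not_lt, ← not_or]
      intro hc
      have hne : i ≠ j := by
        rintro rfl
        exact hc.elim (fun h => lt_asymm h hi) (lt_irrefl _)
      have hk := key j hi.ne hj hne
      rw [swap_comm] at hk
      refine not_geo_finRotate hi ⟨le_rfl, hi⟩ ?_ (sameCycle_apply_self π i).symm hk h
      rintro ⟨h1, h2⟩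
      exact hc.elim (fun h => absurd h1 h.not_ge) fun h => lt_asymm h h2
  · by_contra hn
    refine not_geo_finRotate (hab.trans hbc) ⟨hab.le, hbc⟩ (d := d)
      (fun h' => lt_asymm h'.2 hcd) hac ?_ h
    set π' := swap a c * π with hπ'
    have hππ : π = swap a c * π' := by simp [hπ', ← mul_assoc]
    have hne : a ≠ c := (hab.trans hbc).ne
    have hn' : ¬ π'.SameCycle a c := by
      have h1 := nc_swap_mul_of_sameCycle hac hne
      intro hs
      have h2 := nc_swap_mul_of_sameCycle hs hne
      rw [← hππ] at h2
      rw [← hπ'] at h1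
      omega
    have hbd' : joinClasses (Perm.SameCycle.setoid π') a c b d := by
      rw [← sameCycle_swap_mul_iff hn', ← hππ]; exact hbd
    rcases hbd' with h | ⟨h, -⟩
    · exact h
    · exfalso
      have hab' : joinClasses (Perm.SameCycle.setoid π') a c a b :=
        Or.inr ⟨Or.inl (Perm.SameCycle.refl _ _), h⟩
      rw [← sameCycle_swap_mul_iff hn', ← hππ] at hab'
      exact hn hab'

/-! ### Merging the blocks of two neighbouring points -/

section Merge

variable {π : Perm (Fin n)} (h : IsNC π)

include h in
theorem IsNC.sameCycle_of_cross {b d x y : Fin n} (hbd : π.SameCycle b d) (hb : b < x)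
    (hd : x < d) (hy : y < b ∨ d < y) (hxy : π.SameCycle x y) : π.SameCycle b x := by
  rcases hy with hy | hy
  · exact (h.noncrossing y b x d hy hb hd hxy.symm hbd).symm.trans hxy.symm
  · exact h.noncrossing b x d y hb hd hy hbd hxy

variable {i i' : Fin n} (hi : i'.1 = i.1 + 1) (hii : ¬ π.SameCycle i i')

include h hi hii

/-- A block separating a point of the block of `i` from a point of the block of `i'` would, by
non-crossing, separate `i` from `i'` unless it contains one of them; neighbouring numbers cannot be
separated. -/
theorem IsNC.merge_noncrossing {a b c d : Fin n} (hab : a < b) (hbc : b < c) (hcd : c < d)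
    (hac : joinClasses (Perm.SameCycle.setoid π) i i' a c)
    (hbd : joinClasses (Perm.SameCycle.setoid π) i i' b d) :
    joinClasses (Perm.SameCycle.setoid π) i i' a b := by
  have key : ∀ {b d x y u v : Fin n}, π.SameCycle b d → b < x → x < d → (y < b ∨ d < y) →
      π.SameCycle u x → π.SameCycle v y → (u = i ∧ v = i' ∨ u = i' ∧ v = i) →
      π.SameCycle b u ∨ π.SameCycle b v := by
    intro b d x y u v hbd hb hd hy hux hvy huv
    by_contra hc
    push Not at hc
    have hub : u ≠ b := fun e => hc.1 (e ▸ Perm.SameCycle.refl _ _)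
    have hvb : v ≠ b := fun e => hc.2 (e ▸ Perm.SameCycle.refl _ _)
    have hud : u ≠ d := fun e => hc.1 (e ▸ hbd)
    have hvd : v ≠ d := fun e => hc.2 (e ▸ hbd)
    have h1 : ¬ (u < b ∨ d < u) := fun hu =>
      hc.1 ((h.sameCycle_of_cross hbd hb hd hu hux.symm).trans hux.symm)
    have h2 : ¬ (b < v ∧ v < d) := fun hv =>
      hc.2 (h.sameCycle_of_cross hbd hv.1 hv.2 hy hvy)
    have hbd' := hb.trans hd
    rcases huv with ⟨rfl, rfl⟩ | ⟨rfl, rfl⟩ <;>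
      simp only [Fin.lt_def, ne_eq, Fin.ext_iff] at * <;> omega
  have hmem : ∀ {b x u v}, (u = i ∧ v = i' ∨ u = i' ∧ v = i) → π.SameCycle u x →
      (π.SameCycle b u ∨ π.SameCycle b v) →
      joinClasses (Perm.SameCycle.setoid π) i i' x b := by
    rintro b x u v (⟨rfl, rfl⟩ | ⟨rfl, rfl⟩) hux hb
    · exact Or.inr ⟨Or.inl hux, hb.imp (·.symm) (·.symm)⟩
    · exact Or.inr ⟨Or.inr hux, hb.symm.imp (·.symm) (·.symm)⟩
  rcases hac with hac | ⟨ha, hc⟩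
  · rcases hbd with hbd | ⟨hb, hd⟩
    · exact Or.inl (h.noncrossing a b c d hab hbc hcd hac hbd)
    · have hcase : π.SameCycle b d ∨ ∃ u v, (u = i ∧ v = i' ∨ u = i' ∧ v = i) ∧
          π.SameCycle u b ∧ π.SameCycle v d := by
        rcases hb with hb | hb <;> rcases hd with hd | hd
        · exact Or.inl (hb.symm.trans hd)
        · exact Or.inr ⟨i, i', Or.inl ⟨rfl, rfl⟩, hb, hd⟩
        · exact Or.inr ⟨i', i, Or.inr ⟨rfl, rfl⟩, hb, hd⟩
        · exact Or.inl (hb.symm.trans hd)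
      rcases hcase with hbd | ⟨u, v, huv, hub, hvd⟩
      · exact Or.inl (h.noncrossing a b c d hab hbc hcd hac hbd)
      · exact Setoid.symm' _ (hmem huv hub (key hac hab hbc (Or.inr hcd) hub hvd huv))
  · rcases hbd with hbd | ⟨hb, -⟩
    · have hcase : π.SameCycle c a ∨ ∃ u v, (u = i ∧ v = i' ∨ u = i' ∧ v = i) ∧
          π.SameCycle u c ∧ π.SameCycle v a := by
        rcases hc with hc | hc <;> rcases ha with ha | ha
        · exact Or.inl (hc.symm.trans ha)
        · exact Or.inr ⟨i, i', Or.inl ⟨rfl, rfl⟩, hc, ha⟩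
        · exact Or.inr ⟨i', i, Or.inr ⟨rfl, rfl⟩, hc, ha⟩
        · exact Or.inl (hc.symm.trans ha)
      rcases hcase with hca | ⟨u, v, huv, huc, hva⟩
      · exact Or.inl (h.noncrossing a b c d hab hbc hcd hca.symm hbd)
      · refine hmem (huv.symm.imp And.symm And.symm) hva ?_
        exact (key hbd hbc hcd (Or.inl hab) huc hva huv).symm
    · exact Or.inr ⟨ha, hb⟩

omit h hi in
theorem sameCycle_merge (a b : Fin n) : (swap (π i) i' * π).SameCycle a b ↔
    joinClasses (Perm.SameCycle.setoid π) i i' a b := by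
  have hn : ¬ π.SameCycle (π i) i' := by rwa [Perm.sameCycle_apply_left]
  rw [sameCycle_swap_mul_iff hn, joinClasses_iff, joinClasses_iff]
  change π.SameCycle a b ∨ ((π.SameCycle (π i) a ∨ _) ∧ (π.SameCycle (π i) b ∨ _)) ↔
    π.SameCycle a b ∨ ((π.SameCycle i a ∨ _) ∧ (π.SameCycle i b ∨ _))
  rw [Perm.sameCycle_apply_left, Perm.sameCycle_apply_left]

/-- Only two values change: `i` now goes to `i'`, and the predecessor of `i'` goes to `π i`. The
cases are these two points, the other points of either block, and the points outside both;
non-crossing of the old blocks excludes every misplaced point. -/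
theorem IsNC.merge_increasing (k : Fin n) :
    (k < (swap (π i) i' * π) k ∧ ∀ j, joinClasses (Perm.SameCycle.setoid π) i i' k j →
      j ≤ k ∨ (swap (π i) i' * π) k ≤ j) ∨
    (∀ j, joinClasses (Perm.SameCycle.setoid π) i i' k j →
      (swap (π i) i' * π) k ≤ j ∧ j ≤ k) := by
  have hnc := @IsNC.noncrossing _ π h
  have hA : ∀ {a b}, π.SameCycle i a → π.SameCycle i' b → ¬ π.SameCycle a b :=
    fun ha hb hab => hii (ha.trans (hab.trans hb.symm))
  have hiπ := sameCycle_apply_self π i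
  rcases eq_or_ne k i with rfl | hki
  · left
    rw [Perm.mul_apply, swap_apply_left]
    refine ⟨by rw [Fin.lt_def]; omega, fun j _ => ?_⟩
    rw [Fin.le_def, Fin.le_def]; omega
  have hkπ : π k ≠ π i := fun e => hki (π.injective e)
  have hks := sameCycle_apply_self π k
  by_cases hk' : π k = i'
  · have hik : π.SameCycle i' k := hk' ▸ hks.symm
    have hmem : ∀ j, joinClasses (Perm.SameCycle.setoid π) i i' k j →
        π.SameCycle i j ∨ π.SameCycle i' j := by
      rintro j (hj | ⟨-, hj⟩)
      · exact Or.inr (hik.trans hj)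
      · exact hj
    rw [Perm.mul_apply, hk', swap_apply_right]
    have hk := h.increasing k
    rw [hk'] at hk
    have hne : ∀ {a b}, π.SameCycle i a → π.SameCycle i' b → a ≠ b := by
      rintro a b ha hb rfl
      exact hA ha hb (Perm.SameCycle.refl _ _)
    -- If `i` is not the largest point of its block, the whole block of `i'` lies in the gap between
    -- `i` and `π i`, and its last point is `k`. If `i` is the largest, then `π i` is the smallest
    -- point of the block of `i`.
    rcases h.increasing i with ⟨h1, h2⟩ | h1
    · have hB : ∀ b, π.SameCycle i' b → i < b ∧ b < π i := by
        intro b hb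
        have n1 := hne (Perm.SameCycle.refl π i) hb
        have n2 := hne hiπ hb
        have n3 := hne hiπ (Perm.SameCycle.refl π i')
        have c1 : ¬ b < i := fun hlt => by
          refine hA (Perm.SameCycle.refl π i) hb (hnc b i i' (π i) hlt ?_ ?_ hb.symm hiπ).symm
          all_goals simp only [Fin.lt_def, ne_eq, Fin.ext_iff] at *
          all_goals omega
        have c2 : ¬ π i < b := fun hlt => by
          refine hA (Perm.SameCycle.refl π i) (Perm.SameCycle.refl π i')
            (hnc i i' (π i) b ?_ ?_ hlt hiπ hb)
          all_goals simp only [Fin.lt_def, ne_eq, Fin.ext_iff] at *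
          all_goals omega
        simp only [Fin.lt_def, ne_eq, Fin.ext_iff] at *
        omega
      have hkB := hB k hik
      have hmax : ∀ j, π.SameCycle k j → j ≤ k := by
        rcases hk with ⟨h3, -⟩ | h3
        · simp only [Fin.lt_def] at *; omega
        · exact fun j hj => (h3 j hj).2
      left
      refine ⟨hkB.2, fun j hj => ?_⟩
      rcases hmem j hj with hj | hj
      · refine (h2 j hj).imp (fun h => ?_) id
        exact h.trans hkB.1.le
      · exact Or.inl (hmax j (hik.symm.trans hj))
    · rcases hk with ⟨h3, h4⟩ | h3
      · left
        have n1 := hne hiπ hik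
        have hlt : k < π i := by
          by_contra hc
          refine hA hiπ hik (hnc (π i) k i i' ?_ ?_ ?_ hiπ.symm hik.symm)
          all_goals simp only [Fin.lt_def, ne_eq, Fin.ext_iff] at *
          all_goals omega
        refine ⟨hlt, fun j hj => ?_⟩
        rcases hmem j hj with hj | hj
        · exact Or.inr (h1 j hj).1
        · refine (h4 j (hik.symm.trans hj)).imp id fun h5 => ?_
          have := (h1 i (Perm.SameCycle.refl _ _)).1
          simp only [Fin.lt_def, Fin.le_def] at *
          omega
      · right
        intro j hj
        have h6 := (h1 i (Perm.SameCycle.refl _ _)).1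
        have h7 := (h3 i' hik.symm).2
        rcases hmem j hj with hj | hj
        · have := h1 j hj
          simp only [Fin.le_def] at *
          omega
        · have := h3 j (hik.symm.trans hj)
          simp only [Fin.le_def] at *
          omega
  · rw [Perm.mul_apply, swap_apply_of_ne_of_ne hkπ hk']
    have hk := h.increasing k
    have hnek : k ≠ i := hki
    by_cases hAk : π.SameCycle i k
    · have hkA : π.SameCycle k i := hAk.symm
      have hmem : ∀ j, joinClasses (Perm.SameCycle.setoid π) i i' k j →
          π.SameCycle k j ∨ π.SameCycle i' j := by
        rintro j (hj | ⟨-, hj | hj⟩)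
        · exact Or.inl hj
        · exact Or.inl (hkA.trans hj)
        · exact Or.inr hj
      have hAπ : π.SameCycle i (π k) := hAk.trans hks
      have n1 : i' ≠ k := fun e => hii (e ▸ hAk)
      have n2 : i' ≠ π k := fun e => hii (e ▸ hAπ)
      rcases hk with ⟨h1, h2⟩ | h1
      · left
        refine ⟨h1, fun j hj => ?_⟩
        rcases hmem j hj with hj | hj
        · exact h2 j hj
        · by_contra hc
          push Not at hc
          rcases h2 i hkA with h3 | h3
          · refine hA hAk (Perm.SameCycle.refl π i') (hnc i' k j (π k) ?_ hc.1 hc.2 hj hks).symm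
            simp only [Fin.lt_def, Fin.le_def, ne_eq, Fin.ext_iff] at *
            omega
          · refine hA hAk hj (hnc k j (π k) i' hc.1 hc.2 ?_ hks hj.symm)
            simp only [Fin.lt_def, Fin.le_def, ne_eq, Fin.ext_iff] at *
            omega
      · right
        have h3 := h1 i hkA
        intro j hj
        rcases hmem j hj with hj | hj
        · exact h1 j hj
        · constructor
          · by_contra hc
            push Not at hc
            refine hA hAπ hj (hnc j (π k) i' k hc ?_ ?_ hj.symm hks.symm).symm
            all_goals simp only [Fin.lt_def, Fin.le_def, ne_eq, Fin.ext_iff] at *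
            all_goals omega
          · by_contra hc
            push Not at hc
            refine hA hAπ (Perm.SameCycle.refl π i') (hnc (π k) i' k j ?_ ?_ hc hks.symm hj)
            all_goals simp only [Fin.lt_def, Fin.le_def, ne_eq, Fin.ext_iff] at *
            all_goals omega
    · by_cases hBk : π.SameCycle i' k
      · have hkB : π.SameCycle k i' := hBk.symm
        have hmem : ∀ j, joinClasses (Perm.SameCycle.setoid π) i i' k j →
            π.SameCycle k j ∨ π.SameCycle i j := by
          rintro j (hj | ⟨-, hj | hj⟩)
          · exact Or.inl hj
          · exact Or.inr hj
          · exact Or.inl (hkB.trans hj)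
        have hBπ : π.SameCycle i' (π k) := hBk.trans hks
        have n1 : i ≠ π k := fun e => hii (e ▸ hBπ.symm)
        rcases hk with ⟨h1, h2⟩ | h1
        · left
          refine ⟨h1, fun j hj => ?_⟩
          rcases hmem j hj with hj | hj
          · exact h2 j hj
          · by_contra hc
            push Not at hc
            rcases h2 i' hkB with h3 | h3
            · refine hA (Perm.SameCycle.refl π i) hBk (hnc i k j (π k) ?_ hc.1 hc.2 hj hks)
              simp only [Fin.lt_def, Fin.le_def, ne_eq, Fin.ext_iff] at *
              omega
            · refine hA hj hBk (hnc k j (π k) i hc.1 hc.2 ?_ hks hj.symm).symm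
              simp only [Fin.lt_def, Fin.le_def, ne_eq, Fin.ext_iff] at *
              omega
        · right
          have h3 := h1 i' hkB
          intro j hj
          rcases hmem j hj with hj | hj
          · exact h1 j hj
          · constructor
            · by_contra hc
              push Not at hc
              refine hA hj hBπ (hnc j (π k) i k hc ?_ ?_ hj.symm hks.symm)
              all_goals simp only [Fin.lt_def, Fin.le_def, ne_eq, Fin.ext_iff] at *
              all_goals omega
            · by_contra hc
              push Not at hc
              refine hA (Perm.SameCycle.refl π i) hBπ (hnc (π k) i k j ?_ ?_ hc hks.symm hj).symm
              all_goals simp only [Fin.lt_def, Fin.le_def, ne_eq, Fin.ext_iff] at *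
              all_goals omega
      · have hmem : ∀ j, joinClasses (Perm.SameCycle.setoid π) i i' k j → π.SameCycle k j := by
          rintro j (hj | ⟨hj | hj, -⟩)
          · exact hj
          · exact absurd hj hAk
          · exact absurd hj hBk
        exact hk.imp (fun hk => ⟨hk.1, fun j hj => hk.2 j (hmem j hj)⟩)
          fun hk j hj => hk j (hmem j hj)

theorem IsNC.merge : IsNC (swap (π i) i' * π) where
  increasing k := by
    simp only [sameCycle_merge hii]
    exact h.merge_increasing hi hii k
  noncrossing a b c d hab hbc hcd hac hbd := by
    rw [sameCycle_merge hii] at *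
    exact h.merge_noncrossing hi hii hab hbc hcd hac hbd

end Merge

theorem exists_succ_not_sameCycle {π : Perm (Fin n)} (h : ¬ ∀ i j, π.SameCycle i j) :
    ∃ i i' : Fin n, i'.1 = i.1 + 1 ∧ ¬ π.SameCycle i i' := by
  by_contra hc
  push Not at hc
  refine h ?_
  rcases n with _ | n
  · exact fun i => i.elim0
  have h0 : ∀ (k : ℕ) (hk : k < n + 1), π.SameCycle 0 ⟨k, hk⟩ := by
    intro k
    induction k with
    | zero => exact fun _ => Perm.SameCycle.refl _ _
    | succ k ih => exact fun hk => (ih (by omega)).trans (hc _ _ rfl)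
  exact fun i j => (h0 i i.2).symm.trans (h0 j j.2)

/-- Merging the blocks of two neighbours preserves non-crossing and lowers the number of blocks,
until only the full rotation is left. Each merger trades one cycle of `π` for one cycle of the
complement. -/
theorem IsNC.geo {π : Perm (Fin n)} (h : IsNC π) : Geo π (finRotate n) := by
  induction hk : nc π using Nat.strong_induction_on generalizing π with
  | _ k ih =>
  subst hk
  by_cases hc : ∀ i j, π.SameCycle i j
  · rw [eq_finRotate h hc]
    exact geo_self _
  obtain ⟨i, i', hi, hii⟩ := exists_succ_not_sameCycle hc
  have hn : ¬ π.SameCycle (π i) i' := by rwa [Perm.sameCycle_apply_left]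
  have h1 := nc_swap_mul_of_not hn
  have hg := ih _ (by omega) (h.merge hi hii) rfl
  set π' := swap (π i) i' * π with hπ'
  have hγ : finRotate n i = i' := by
    have := i'.2
    rw [Fin.ext_iff, val_finRotate, if_pos (by omega), hi]
  have hπi : π' i = i' := by simp [hπ']
  -- The complement of `π'` fixes `i`, because `π'` and the rotation both send `i` to `i'`.
  -- Multiplying by this transposition thus joins the fixed point to another cycle.
  have e : π⁻¹ * finRotate n =
      (π'⁻¹ * finRotate n) * swap i ((finRotate n)⁻¹ (π i)) := by
    have e1 : π⁻¹ = π'⁻¹ * swap (π i) i' := by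
      rw [hπ', mul_inv_rev, swap_inv, mul_assoc, swap_mul_self, mul_one]
    have e2 : finRotate n ((finRotate n)⁻¹ (π i)) = π i := Equiv.apply_symm_apply _ _
    rw [mul_assoc, mul_swap_eq_swap_mul, hγ, e2, swap_comm i', ← mul_assoc, ← e1]
  have hfix : (π'⁻¹ * finRotate n) i = i := by
    rw [Perm.mul_apply, hγ, Perm.inv_eq_iff_eq, hπi]
  have hne : i ≠ (finRotate n)⁻¹ (π i) := by
    intro e
    rw [Perm.eq_inv_iff_eq, hγ] at e
    exact hn (e ▸ Perm.SameCycle.refl _ _)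
  have h2 := nc_mul_swap_of_not (not_sameCycle_of_apply_eq_self hfix hne)
  rw [← e] at h2
  rw [Geo] at *
  omega

theorem isNC_iff_geo {π : Perm (Fin n)} : IsNC π ↔ Geo π (finRotate n) :=
  ⟨IsNC.geo, Geo.isNC⟩

end NonCrossing

/-! ### The sums over `NC(n)` and `𝒫𝒮_NC(m,n)` -/

section Link

variable {n : ℕ}

/-- The general sums use the `Fintype` instance derived from `Finite`, those over `NC` and `PSNC`
the standard one; the two sets of all permutations agree. -/
theorem univ_perm_fin :
    @Finset.univ (Perm (Fin n)) permFintype = (Finset.univ : Finset (Perm (Fin n))) :=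
  Finset.ext fun _ => iff_of_true (@Finset.mem_univ _ permFintype _) (Finset.mem_univ _)

theorem markedSum_eq_sum_filter {α : Type*} [Finite α] (τ : Perm α) (P Q : α → Prop) (φ : α → ℂ)
    (ψ : α → α → ℂ) : markedSum τ P Q φ ψ = ∑ q : Cyc τ × Cyc τ with P q.1.out ∧ Q q.2.out,
      ψ q.1.out q.2.out * restProd τ φ q.1 q.2 := by
  rw [markedSum, Finset.sum_filter]

theorem exists_isCycleMin (π : Perm (Fin n)) (x : Fin n) :
    ∃ y, π.SameCycle x y ∧ IsCycleMin π y := by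
  obtain ⟨y, hy, hmin⟩ := Finset.exists_min_image (Finset.univ.filter fun y => π.SameCycle x y) id
    ⟨x, Finset.mem_filter.2 ⟨Finset.mem_univ _, Perm.SameCycle.refl _ _⟩⟩
  simp only [Finset.mem_filter, Finset.mem_univ, true_and, id] at hy hmin
  exact ⟨y, hy, fun z hz => hmin z (hy.trans hz)⟩

theorem IsCycleMin.eq {π : Perm (Fin n)} {x y : Fin n} (hx : IsCycleMin π x)
    (hy : IsCycleMin π y) (h : π.SameCycle x y) : x = y := le_antisymm (hx y h) (hy x h.symm)

theorem prod_cyc (π : Perm (Fin n)) (F : Cyc π → ℂ) :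
    ∏ q, F q = ∏ x with IsCycleMin π x, F (Cyc.mk π x) := by
  refine (Finset.prod_bij (fun x _ => Cyc.mk π x) (fun _ _ => Finset.mem_univ _) ?_ ?_
    fun _ _ => rfl).symm
  · intro x hx y hy hxy
    rw [Finset.mem_filter] at hx hy
    exact hx.2.eq hy.2 (Cyc.mk_eq.1 hxy)
  · intro q _
    obtain ⟨y, hy, hmin⟩ := exists_isCycleMin π q.out
    exact ⟨y, by simpa using hmin, by rw [← q.mk_out, Cyc.mk_eq]; exact hy.symm⟩

theorem cprod_eq_prod_min {π : Perm (Fin n)} {Φ : Fin n → ℂ} (hΦ : IsClass π Φ) :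
    cprod π Φ = ∏ x with IsCycleMin π x, Φ x := by
  rw [cprod, prod_cyc]
  exact Finset.prod_congr rfl fun x _ => hΦ.out_mk x

theorem cycleProd_eq_cprod {π : Perm (Fin n)} {Φ : Fin n → ℂ} {φ : List (Fin n) → ℂ}
    (hΦ : IsClass π Φ) (h : ∀ x, φ (cycleWord π x) = Φ x) : cycleProd π φ = cprod π Φ := by
  rw [cprod_eq_prod_min hΦ, cycleProd]
  exact Finset.prod_congr rfl fun x _ => h x

/-- The sum over `NC(n)` of a multiplicative function. -/
theorem sum_NC {Φ : Perm (Fin n) → Fin n → ℂ} {φ : List (Fin n) → ℂ}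
    (hΦ : ∀ π, IsClass π (Φ π)) (h : ∀ π x, φ (cycleWord π x) = Φ π x) :
    ∑ π ∈ NC n, cycleProd π φ = geoSum (finRotate n) Φ := by
  rw [geoSum, univ_perm_fin, NC, Finset.sum_filter]
  refine Finset.sum_congr rfl fun π _ => ?_
  rw [cycleProd_eq_cprod (hΦ π) (h π)]
  exact if_congr isNC_iff_geo rfl rfl

variable {m : ℕ}

/-- The truncated subtractions in `permLength` are harmless because the number of cycles is at most
the number of points. For a connection between the circles, some single step must change the colour.
-/
theorem isNCAnnular_iff {π : Perm (Fin (m + n))} :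
    IsNCAnnular m n π ↔ Ann (annularRotation m n) (circle m n) π := by
  rw [IsNCAnnular, Ann, and_comm]
  have hN : Nat.card (Fin (m + n)) = m + n := Nat.card_fin _
  have h1 := nc_le π
  have h2 := nc_le (π⁻¹ * annularRotation m n)
  have h3 := nc_le (annularRotation m n)
  have e : ∀ σ : Perm (Fin (m + n)), permLength σ = m + n - nc σ := fun σ => rfl
  refine and_congr ?_ ⟨?_, ?_⟩
  · rw [e, e, e]
    rw [hN] at *
    omega
  · rintro ⟨i, j, hij⟩
    refine exists_col_ne (col := circle m n) ?_ ?_ hij <;> simp [circle]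
  · intro h
    obtain ⟨u, v, hu, hv, huv⟩ := exists_sameCycle_of_col h
    induction u using Fin.addCases with
    | right u => simp [circle] at hu
    | left u =>
      induction v using Fin.addCases with
      | left v =>
        have := v.2
        simp [circle] at hv
        omega
      | right v => exact ⟨u, v, huv⟩

theorem exists_prodPerm_iff {π : Perm (Fin (m + n))} :
    (∃ π₁ ∈ NC m, ∃ π₂ ∈ NC n, π = prodPerm π₁ π₂) ↔ Geo π (annularRotation m n) := by
  simp only [NC, Finset.mem_filter, Finset.mem_univ, true_and, isNC_iff_geo]
  constructor
  · rintro ⟨π₁, h₁, π₂, h₂, rfl⟩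
    exact (geo_glue_iff finSumFinEquiv).2 ⟨h₁, h₂⟩
  · intro h
    obtain ⟨π₁, π₂, rfl⟩ := Geo.exists_glue finSumFinEquiv (σ₁ := finRotate m)
      (σ₂ := finRotate n) h
    obtain ⟨h₁, h₂⟩ := (geo_glue_iff finSumFinEquiv).1 h
    exact ⟨π₁, h₁, π₂, h₂, rfl⟩

/-- The pair `(0_π, π)`. -/
def cyclePair (π : Perm (Fin n)) : PartitionedPerm n := ⟨Perm.SameCycle.setoid π, π, le_rfl⟩

/-- The pair `(𝒰, π)` in which `𝒰` joins two cycles of `π`. -/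
def joinPair (π : Perm (Fin n)) (x y : Fin n) : PartitionedPerm n :=
  ⟨joinClasses (Perm.SameCycle.setoid π) x y, π, le_joinClasses _ _ _⟩

theorem blockProd_cyclePair {π : Perm (Fin n)} {Φ : Fin n → ℂ} {φ : List (Fin n) → ℂ}
    (hΦ : IsClass π Φ) (h : ∀ x, φ (cycleWord π x) = Φ x)
    (ψ : List (Fin n) → List (Fin n) → ℂ) : (cyclePair π).blockProd φ ψ = cprod π Φ := by
  rw [cprod_eq_prod_min hΦ, PartitionedPerm.blockProd]
  refine Finset.prod_congr (Finset.filter_congr fun x _ => Iff.rfl) fun x hx => ?_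
  have hmin : IsCycleMin π x := (Finset.mem_filter.1 hx).2
  have hs : (Finset.univ.filter fun y => (cyclePair π).part x y).filter (IsCycleMin π) = {x} := by
    ext y
    simp only [Finset.mem_filter, Finset.mem_univ, true_and, Finset.mem_singleton]
    constructor
    · rintro ⟨h1, h2⟩
      exact (hmin.eq h2 h1).symm
    · rintro rfl
      exact ⟨(cyclePair π).part.refl _, hmin⟩
  rw [blockFactor, show (cyclePair π).perm = π from rfl, hs, Finset.sort_singleton]
  exact h x

/-- The hypothesis `hxy` puts the cycle of `x` entirely before that of `y`, so the joined block is
listed at the least point `x₀` of the former, and sorting returns the two cycles in the order in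
which `ψ` expects them. -/
theorem blockProd_joinPair {π : Perm (Fin n)} {Φ : Fin n → ℂ} {φ : List (Fin n) → ℂ}
    {Ψ : Fin n → Fin n → ℂ} {ψ : List (Fin n) → List (Fin n) → ℂ}
    (hΦ : IsClass π Φ) (h : ∀ x, φ (cycleWord π x) = Φ x)
    (hΨ : ∀ y, IsClass π fun x => Ψ x y) (hΨ' : ∀ x, IsClass π (Ψ x))
    (h' : ∀ x y, ψ (cycleWord π x) (cycleWord π y) = Ψ x y) {x y : Fin n}
    (hxy : ∀ u v, π.SameCycle x u → π.SameCycle y v → u < v) :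
    (joinPair π x y).blockProd φ ψ = Ψ x y * restProd π Φ (Cyc.mk π x) (Cyc.mk π y) := by
  obtain ⟨x₀, hx₀, hxm⟩ := exists_isCycleMin π x
  obtain ⟨y₀, hy₀, hym⟩ := exists_isCycleMin π y
  have hlt := hxy x₀ y₀ hx₀ hy₀
  have hmin : (Finset.univ.filter fun z => ∀ w, (joinPair π x y).part z w → z ≤ w) =
      (Finset.univ.filter (IsCycleMin π)).erase y₀ := by
    ext z
    simp only [Finset.mem_filter, Finset.mem_univ, true_and, Finset.mem_erase]
    constructor
    · intro hz
      refine ⟨?_, fun w hw => hz w (Or.inl hw)⟩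
      rintro rfl
      exact (hz x₀ (Or.inr ⟨Or.inr hy₀, Or.inl hx₀⟩)).not_gt hlt
    · rintro ⟨hne, hz⟩ w (hw | ⟨hz' | hz', hw | hw⟩)
      · exact hz w hw
      · exact hz w (Setoid.trans' (Perm.SameCycle.setoid π) (Setoid.symm' _ hz') hw)
      · exact (hxy z w hz' hw).le
      · exact absurd (hz.eq hym (Perm.SameCycle.trans (Perm.SameCycle.symm hz') hy₀)) hne
      · exact hz w (Setoid.trans' (Perm.SameCycle.setoid π) (Setoid.symm' _ hz') hw)
  have hx₀m : x₀ ∈ (Finset.univ.filter (IsCycleMin π)).erase y₀ := by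
    simp [hlt.ne, hxm]
  have hy₀m : y₀ ∈ Finset.univ.filter (IsCycleMin π) := by simp [hym]
  have hperm : (joinPair π x y).perm = π := rfl
  have hne : ∀ z ∈ ((Finset.univ.filter (IsCycleMin π)).erase y₀).erase x₀,
      IsCycleMin π z ∧ ¬ (π.SameCycle x z ∨ π.SameCycle y z) := by
    intro z hz
    simp only [Finset.mem_erase, Finset.mem_filter, Finset.mem_univ, true_and] at hz
    refine ⟨hz.2.2, ?_⟩
    rintro (hs | hs)
    · exact hz.1 (hz.2.2.eq hxm (hs.symm.trans hx₀))
    · exact hz.2.1 (hz.2.2.eq hym (hs.symm.trans hy₀))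
  rw [PartitionedPerm.blockProd, hmin, ← Finset.mul_prod_erase _ _ hx₀m, restProd, prod_cyc,
    ← Finset.mul_prod_erase _ _ hy₀m, ← Finset.mul_prod_erase _ _ hx₀m,
    if_pos (Or.inr (Cyc.mk_eq.2 hy₀.symm)), if_pos (Or.inl (Cyc.mk_eq.2 hx₀.symm)), one_mul,
    one_mul, hperm]
  congr 1
  · have hs : (Finset.univ.filter fun w => (joinPair π x y).part x₀ w).filter (IsCycleMin π) =
        {x₀, y₀} := by
      ext z
      simp only [Finset.mem_filter, Finset.mem_univ, true_and, Finset.mem_insert,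
        Finset.mem_singleton]
      constructor
      · rintro ⟨hz | ⟨-, hz | hz⟩, hzm⟩
        · exact Or.inl (hzm.eq hxm (Perm.SameCycle.symm hz))
        · exact Or.inl (hzm.eq hxm ((Perm.SameCycle.symm hz).trans hx₀))
        · exact Or.inr (hzm.eq hym ((Perm.SameCycle.symm hz).trans hy₀))
      · rintro (rfl | rfl)
        · exact ⟨(joinPair π x y).part.refl _, hxm⟩
        · exact ⟨Or.inr ⟨Or.inl hx₀, Or.inr hy₀⟩, hym⟩
    have hsort : ({x₀, y₀} : Finset (Fin n)).sort = [x₀, y₀] := by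
      rw [Finset.sort_insert]
      · simp
      · simp [hlt.le]
      · simp [hlt.ne]
    rw [blockFactor, hs, hsort]
    dsimp only
    exact (h' _ _).trans ((hΨ y₀ _ _ hx₀).symm.trans (hΨ' x _ _ hy₀).symm)
  · refine Finset.prod_congr rfl fun z hz => ?_
    obtain ⟨hzm, hnz⟩ := hne z hz
    have hs : (Finset.univ.filter fun w => (joinPair π x y).part z w).filter (IsCycleMin π) =
        {z} := by
      ext w
      simp only [Finset.mem_filter, Finset.mem_univ, true_and, Finset.mem_singleton]
      constructor
      · rintro ⟨hw | ⟨hz', -⟩, hwm⟩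
        · exact (hzm.eq hwm hw).symm
        · exact absurd hz' hnz
      · rintro rfl
        exact ⟨(joinPair π x y).part.refl _, hzm⟩
    rw [blockFactor, hs, Finset.sort_singleton]
    dsimp only
    rw [h, if_neg, hΦ.out_mk]
    rw [Cyc.mk_eq, Cyc.mk_eq]
    exact fun h => hnz (h.imp (·.symm) (·.symm))

theorem isAnnularPair_iff {P : PartitionedPerm (m + n)} : IsAnnularPair m n P ↔
    ∃ π, Ann (annularRotation m n) (circle m n) π ∧ P = cyclePair π := by
  rw [IsAnnularPair, isNCAnnular_iff]
  constructor
  · rintro ⟨h1, h2⟩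
    exact ⟨P.perm, h1, PartitionedPerm.ext h2 rfl⟩
  · rintro ⟨π, h, rfl⟩
    exact ⟨h, rfl⟩

theorem isMarkedPair_iff {P : PartitionedPerm (m + n)} : IsMarkedPair m n P ↔
    ∃ (π : Perm (Fin (m + n))) (q₁ q₂ : Cyc π), Geo π (annularRotation m n) ∧
      circle m n q₁.out = false ∧ circle m n q₂.out = true ∧ P = joinPair π q₁.out q₂.out := by
  rw [IsMarkedPair, exists_prodPerm_iff]
  constructor
  · rintro ⟨h, x, y, hJ⟩
    have hcl : IsClass P.perm (circle m n) :=
      isClass_of_apply (h.col (circle_annularRotation m n))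
    refine ⟨P.perm, Cyc.mk _ (Fin.castAdd n x), Cyc.mk _ (Fin.natAdd m y), h, ?_, ?_, ?_⟩
    · rw [hcl.out_mk]; simp [circle]
    · rw [hcl.out_mk]; simp [circle]
    · refine PartitionedPerm.ext (Setoid.ext fun i j => ?_) rfl
      rw [hJ i j]
      have hx : ∀ z, P.perm.SameCycle (Fin.castAdd n x) z ↔
          P.perm.SameCycle (Cyc.mk P.perm (Fin.castAdd n x)).out z := fun z =>
        ⟨(Cyc.out_mk _ _).trans, (Cyc.out_mk _ _).symm.trans⟩
      have hy : ∀ z, P.perm.SameCycle (Fin.natAdd m y) z ↔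
          P.perm.SameCycle (Cyc.mk P.perm (Fin.natAdd m y)).out z := fun z =>
        ⟨(Cyc.out_mk _ _).trans, (Cyc.out_mk _ _).symm.trans⟩
      rw [hx, hx, hy, hy]
      rfl
  · rintro ⟨π, q₁, q₂, h, h1, h2, rfl⟩
    refine ⟨h, ?_⟩
    generalize q₁.out = u at *
    generalize q₂.out = v at *
    induction u using Fin.addCases with
    | right u => simp [circle] at h1
    | left u =>
      induction v using Fin.addCases with
      | left v =>
        have := v.2
        simp [circle] at h2
        omega
      | right v => exact ⟨u, v, fun _ _ => Iff.rfl⟩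

theorem not_isMarkedPair {P : PartitionedPerm (m + n)} (h : IsAnnularPair m n P) :
    ¬ IsMarkedPair m n P := by
  obtain ⟨π, h1, rfl⟩ := isAnnularPair_iff.1 h
  intro h'
  obtain ⟨π', q₁, q₂, h2, -, -, he⟩ := isMarkedPair_iff.1 h'
  obtain rfl : π = π' := congrArg PartitionedPerm.perm he
  exact h1.not_geo h2

variable {φ : List (Fin (m + n)) → ℂ} {ψ : List (Fin (m + n)) → List (Fin (m + n)) → ℂ}
  {Φ : Perm (Fin (m + n)) → Fin (m + n) → ℂ}
  {Ψ : Perm (Fin (m + n)) → Fin (m + n) → Fin (m + n) → ℂ}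
  (hΦ : ∀ π, IsClass π (Φ π)) (h : ∀ π x, φ (cycleWord π x) = Φ π x)
  (hΨ : ∀ π y, IsClass π fun x => Ψ π x y) (hΨ' : ∀ π x, IsClass π (Ψ π x))
  (h' : ∀ π x y, ψ (cycleWord π x) (cycleWord π y) = Ψ π x y)

include hΦ h

theorem sum_annularPair :
    ∑ P with IsAnnularPair m n P, P.blockProd φ ψ =
      annSum (annularRotation m n) (circle m n) Φ := by
  rw [annSum, univ_perm_fin, ← Finset.sum_filter]
  refine (Finset.sum_bij (fun π _ => cyclePair π) ?_ ?_ ?_ ?_).symm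
  · intro π hπ
    rw [Finset.mem_filter] at hπ ⊢
    exact ⟨Finset.mem_univ _, isAnnularPair_iff.2 ⟨π, hπ.2, rfl⟩⟩
  · intro π _ π' _ he
    exact congrArg PartitionedPerm.perm he
  · intro P hP
    obtain ⟨π, h1, rfl⟩ := isAnnularPair_iff.1 (Finset.mem_filter.1 hP).2
    exact ⟨π, Finset.mem_filter.2 ⟨Finset.mem_univ _, h1⟩, rfl⟩
  · intro π _
    rw [blockProd_cyclePair (hΦ π) (h π)]

include hΨ hΨ' h'

theorem sum_markedPair :
    ∑ P with IsMarkedPair m n P, P.blockProd φ ψ =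
      geoMarkedSum (annularRotation m n) (circle m n) Φ Ψ := by
  rw [geoMarkedSum, univ_perm_fin, ← Finset.sum_filter]
  simp only [markedSum_eq_sum_filter]
  rw [Finset.sum_sigma']
  refine (Finset.sum_bij (fun p _ => joinPair p.1 p.2.1.out p.2.2.out) ?_ ?_ ?_ ?_).symm
  · rintro ⟨π, q₁, q₂⟩ hp
    simp only [Finset.mem_sigma, Finset.mem_filter, Finset.mem_univ, true_and] at hp ⊢
    exact isMarkedPair_iff.2 ⟨π, q₁, q₂, hp.1, hp.2.1, hp.2.2, rfl⟩
  · rintro ⟨π, q₁, q₂⟩ hp ⟨π', p₁, p₂⟩ hp' he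
    obtain rfl : π = π' := congrArg PartitionedPerm.perm he
    simp only [Finset.mem_sigma, Finset.mem_filter, Finset.mem_univ, true_and] at hp hp'
    have hcol := hp.1.col (circle_annularRotation m n)
    have hne : ∀ {u v}, circle m n u = false → circle m n v = true → ¬ π.SameCycle u v := by
      intro u v hu hv hs
      have := sameCycle_col hcol hs
      simp [hu, hv] at this
    -- The partition determines which two cycles are joined, and the colours determine which of them
    -- comes first; this gives injectivity.
    have hj : joinClasses (Perm.SameCycle.setoid π) q₁.out q₂.out p₁.out p₂.out := by
      have := congrArg (fun P => P.part p₁.out p₂.out) he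
      exact this.mpr (joinClasses_self _ _ _)
    rcases hj with hs | ⟨hs | hs, hs' | hs'⟩
    · exact absurd hs (hne hp'.2.1 hp'.2.2)
    · exact absurd hs' (hne hp.2.1 hp'.2.2)
    · have e1 : q₁ = p₁ := by rw [← q₁.mk_out, ← p₁.mk_out]; exact Cyc.mk_eq.2 hs
      have e2 : q₂ = p₂ := by rw [← q₂.mk_out, ← p₂.mk_out]; exact Cyc.mk_eq.2 hs'
      rw [e1, e2]
    · exact absurd (Perm.SameCycle.symm hs) (hne hp'.2.1 hp.2.2)
    · exact absurd (Perm.SameCycle.symm hs) (hne hp'.2.1 hp.2.2)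
  · intro P hP
    obtain ⟨π, q₁, q₂, h1, h2, h3, rfl⟩ := isMarkedPair_iff.1 (Finset.mem_filter.1 hP).2
    exact ⟨⟨π, q₁, q₂⟩, by simp [h1, h2, h3], rfl⟩
  · rintro ⟨π, q₁, q₂⟩ hp
    simp only [Finset.mem_sigma, Finset.mem_filter, Finset.mem_univ, true_and] at hp
    have hcol := hp.1.col (circle_annularRotation m n)
    dsimp only
    rw [blockProd_joinPair (hΦ π) (h π) (hΨ π) (hΨ' π) (h' π), Cyc.mk_out, Cyc.mk_out]
    intro u v hu hv
    have hu' := (sameCycle_col hcol hu).symm.trans hp.2.1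
    have hv' := (sameCycle_col hcol hv).symm.trans hp.2.2
    simp only [circle, decide_eq_false_iff_not, decide_eq_true_eq] at hu' hv'
    rw [Fin.lt_def]
    omega

/-- The sum over `𝒫𝒮_NC(m,n)` of a multiplicative function. -/
theorem sum_PSNC : ∑ P ∈ PSNC m n, P.blockProd φ ψ =
    annSum (annularRotation m n) (circle m n) Φ +
      geoMarkedSum (annularRotation m n) (circle m n) Φ Ψ := by
  rw [← sum_annularPair hΦ h, ← sum_markedPair hΦ h hΨ hΨ' h', PSNC, Finset.filter_or,
    Finset.sum_union]
  rw [Finset.disjoint_filter]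
  exact fun P _ => not_isMarkedPair

end Link

open SecondOrderSpace

/-! ### Alternating words -/

section Words

variable {n : ℕ}

theorem sz_eq_length (π : Perm (Fin n)) (x : Fin n) : sz π x = (cycleWord π x).length := by
  rw [← List.toFinset_card_of_nodup (nodup_cycleWord π x), sz, ← Set.ncard_coe_finset]
  congr 1
  ext y
  simp [mem_cycleWord]

theorem length_cycleWord_pos (π : Perm (Fin n)) (x : Fin n) : 0 < (cycleWord π x).length :=
  List.length_pos_of_mem ((mem_cycleWord π x x).2 (Perm.SameCycle.refl _ _))

theorem bool_eq_iff_even {t : ℕ → Bool} {k : ℕ} (h : ∀ i < k, t (i + 1) ≠ t i) :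
    t k = t 0 ↔ Even k := by
  induction k with
  | zero => simp
  | succ k ih =>
    have h1 := ih fun i hi => h i (by omega)
    have h2 := h k (by omega)
    rw [Nat.even_add_one, ← h1]
    clear h1 ih h
    revert h2
    cases t (k + 1) <;> cases t k <;> cases t 0 <;> simp

/-- The sign pattern of a word. -/
def isPos (s : Fin n → ℤˣ) (i : Fin n) : Bool := decide (s i = 1)

theorem isPos_ne_iff {s : Fin n → ℤˣ} {i j : Fin n} : isPos s i ≠ isPos s j ↔ s i ≠ s j := by
  rw [isPos, isPos]
  rcases Int.units_eq_one_or (s i) with h | h <;> rcases Int.units_eq_one_or (s j) with h' | h' <;>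
    simp [h, h']

/-- Alternation around a cycle is alternation along its word together with a change of sign from the
last letter to the first; even length is exactly the latter condition. -/
theorem evenAlternating_iff (s : Fin n → ℤˣ) (π : Perm (Fin n)) (x : Fin n) :
    EvenAlternating ((cycleWord π x).map s) ↔ AltAt (isPos s) π x := by
  set t : ℕ → Bool := fun i => isPos s (π^[i] x) with ht
  have hper : π^[Function.minimalPeriod π x] x = x := Function.iterate_minimalPeriod
  have hL : 0 < Function.minimalPeriod π x := by
    rw [← length_cycleWord]; exact length_cycleWord_pos π x
  have hchain : ((cycleWord π x).map s).IsChain (· ≠ ·) ↔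
      ∀ i, i + 1 < Function.minimalPeriod π x → t (i + 1) ≠ t i := by
    rw [List.isChain_iff_getElem]
    simp only [List.length_map, length_cycleWord, List.getElem_map]
    refine forall_congr' fun i => forall_congr' fun hi => ?_
    rw [ht]
    dsimp only
    rw [ne_comm, isPos_ne_iff]
    simp only [cycleWord, List.getElem_iterate]
  rw [EvenAlternating, hchain, List.length_map, length_cycleWord]
  have hend : t (Function.minimalPeriod π x) = t 0 := by simp [ht, hper]
  constructor
  · rintro ⟨he, hc⟩ y hy
    obtain ⟨i, hi, rfl⟩ : ∃ i < Function.minimalPeriod π x, π^[i] x = y := by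
      have := (mem_cycleWord π x y).2 hy
      rw [cycleWord, List.mem_iterate] at this
      obtain ⟨i, hi, h⟩ := this
      exact ⟨i, hi, h.symm⟩
    rw [← Function.iterate_succ_apply' ⇑π]
    change t (i + 1) ≠ t i
    rcases Nat.lt_or_ge (i + 1) (Function.minimalPeriod π x) with h | h
    · exact hc i h
    · have h1 : i + 1 = Function.minimalPeriod π x := by omega
      rw [h1, hend]
      intro h2
      have h3 := (bool_eq_iff_even (k := i) fun j hj => hc j (by omega)).1 h2.symm
      rw [← h1, Nat.even_add_one] at he
      exact he h3
  · intro h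
    have hc : ∀ i, t (i + 1) ≠ t i := fun i => by
      have := h (π^[i] x) ⟨i, by simp [← Perm.iterate_eq_pow]⟩
      rwa [← Function.iterate_succ_apply' ⇑π] at this
    exact ⟨(bool_eq_iff_even fun i _ => hc i).1 hend, fun i _ => hc i⟩

theorem cycleWord_finRotate_of_pos (hn : 0 < n) :
    cycleWord (finRotate n) ⟨0, hn⟩ = List.finRange n := by
  obtain ⟨k, rfl⟩ := Nat.exists_eq_succ_of_ne_zero hn.ne'
  exact cycleWord_finRotate

theorem isPos_finRotate_ne {s : Fin n → ℤˣ}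
    (h : EvenAlternating ((List.finRange n).map s)) (i : Fin n) :
    isPos s (finRotate n i) ≠ isPos s i := by
  have hn : 0 < n := i.pos
  rw [← cycleWord_finRotate_of_pos hn, evenAlternating_iff] at h
  exact h i (sameCycle_finRotate _ _)

/-- The alternating word of length `2k` starting with `u`. -/
def altList (u : ℤˣ) (k : ℕ) : List ℤˣ := (List.replicate k [u, -u]).flatten

theorem altList_succ (u : ℤˣ) (k : ℕ) : altList u (k + 1) = u :: -u :: altList u k := by
  simp [altList, List.replicate_succ]

theorem length_altList (u : ℤˣ) (k : ℕ) : (altList u k).length = 2 * k := by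
  induction k with
  | zero => rfl
  | succ k ih => rw [altList_succ, List.length_cons, List.length_cons, ih]; ring

theorem units_eq_neg {u v : ℤˣ} (h : u ≠ v) : v = -u := by
  rcases Int.units_eq_one_or u with rfl | rfl <;> rcases Int.units_eq_one_or v with rfl | rfl <;>
    simp_all

/-- The letter `-u` in front records that the word starts with `u`, also when the word is empty,
which is what the induction needs. -/
theorem eq_altList_of_isChain {k : ℕ} {u : ℤˣ} {δ : List ℤˣ} (hl : δ.length = 2 * k)
    (h : (-u :: δ).IsChain (· ≠ ·)) : δ = altList u k := by
  induction k generalizing δ with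
  | zero => exact List.length_eq_zero_iff.1 hl
  | succ k ih =>
    rcases δ with _ | ⟨x, _ | ⟨y, δ⟩⟩
    · simp at hl
    · simp at hl; omega
    · rw [List.isChain_cons_cons, List.isChain_cons_cons] at h
      obtain ⟨h1, h2, h3⟩ := h
      obtain rfl : x = u := by rw [units_eq_neg h1, neg_neg]
      obtain rfl : y = -x := units_eq_neg h2
      rw [altList_succ, ih (by simp at hl; omega) h3]

theorem eq_altList_of_evenAlternating {δ : List ℤˣ} (h : EvenAlternating δ) :
    ∃ u, δ = altList u (δ.length / 2) := by
  have hl : δ.length = 2 * (δ.length / 2) := (Nat.mul_div_cancel' h.1.two_dvd).symm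
  rcases δ with _ | ⟨x, δ⟩
  · exact ⟨1, rfl⟩
  · refine ⟨x, eq_altList_of_isChain hl ?_⟩
    rw [List.isChain_cons_cons]
    refine ⟨fun e => ?_, h.2⟩
    rcases Int.units_eq_one_or x with rfl | rfl <;> simp at e

theorem evenAlternating_altList (u : ℤˣ) (k : ℕ) : EvenAlternating (altList u k) := by
  refine ⟨by rw [length_altList]; exact even_two_mul k, ?_⟩
  have : (-u :: altList u k).IsChain (· ≠ ·) := by
    induction k with
    | zero => exact List.isChain_singleton _
    | succ k ih =>
      rw [altList_succ, List.isChain_cons_cons, List.isChain_cons_cons]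
      refine ⟨fun e => ?_, fun e => ?_, ih⟩ <;>
      rcases Int.units_eq_one_or u with rfl | rfl <;> simp at e
  exact this.tail

variable {A : Type*} [Ring A] [StarRing A]

theorem altWord_eq (a : A) (k : ℕ) :
    altWord a k = (altList 1 k).map (signed a) := by
  induction k with
  | zero => rfl
  | succ k ih =>
    rw [altList_succ, List.map_cons, List.map_cons, ← ih]
    simp [altWord, signed, List.replicate_succ]

theorem prod_altList (a : A) (u : ℤˣ) (k : ℕ) :
    ((altList u k).map (signed a)).prod =
      (signed a u * signed a (-u)) ^ k := by
  induction k with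
  | zero => simp [altList]
  | succ k ih =>
    rw [altList_succ, List.map_cons, List.map_cons, List.prod_cons, List.prod_cons, ih, pow_succ',
      mul_assoc]

end Words

/-! ### Sums over words in `a` and `a*` -/

section RDiagonal

variable {A : Type*} [Ring A] [Algebra ℂ A] (S : SecondOrderSpace A)

/-- The length guard vanishes on the one-block partition, so the erased term can be put back at no
cost and the correction becomes a sum over all of `NC`. -/
theorem cumulant_eq {w : List A} (hw : w ≠ []) : S.cumulant w = S.φ w.prod -
    ∑ π ∈ NC w.length, cycleProd π fun c =>
      (fun u : List A => if u.length < w.length then S.cumulant u else 0) (c.map w.get) := by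
  rw [← Finset.add_sum_erase _ _ (show finRotate w.length ∈ NC w.length by
    simp [NC, isNC_finRotate]), cycleProd_finRotate (List.length_pos_iff.2 hw),
    List.map_get_finRange]
  dsimp only
  rw [if_neg (lt_irrefl _), zero_add]
  conv_lhs => rw [cumulant]
  simp only [List.length_map, dite_eq_ite]

theorem cumulant₂_eq {v w : List A} (hv : v ≠ []) (hw : w ≠ []) :
    S.cumulant₂ v w = S.φ₂ v.prod w.prod -
      ∑ P ∈ PSNC v.length w.length, P.blockProd (fun c => S.cumulant (c.map (entries v w)))
        fun c d => (fun u u' : List A => if u.length + u'.length < v.length + w.length then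
          S.cumulant₂ u u' else 0) (c.map (entries v w)) (d.map (entries v w)) := by
  have hv' := List.length_pos_iff.2 hv
  have hw' := List.length_pos_iff.2 hw
  rw [← Finset.add_sum_erase _ _ (topPair_mem hv' hw'), blockProd_topPair hv' hw']
  dsimp only
  rw [if_neg (by simp), zero_add]
  conv_lhs => rw [cumulant₂]
  simp only [List.length_map, dite_eq_ite]

/-- Traciality moves the first factor of the word to its end; this makes the starting letter of an
alternating moment irrelevant. -/
theorem φ_mul_pow (x y : A) (k : ℕ) : S.φ ((x * y) ^ k) = S.φ ((y * x) ^ k) := by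
  cases k with
  | zero => simp
  | succ k => rw [pow_succ, ← mul_assoc, mul_pow_mul, mul_assoc, S.tracial, mul_assoc, ← pow_succ]

theorem φ₂_mul_pow (x y c : A) (k : ℕ) : S.φ₂ ((x * y) ^ k) c = S.φ₂ ((y * x) ^ k) c := by
  cases k with
  | zero => simp
  | succ k => rw [pow_succ, ← mul_assoc, mul_pow_mul, mul_assoc, S.tracial₂, mul_assoc, ← pow_succ]

variable [StarRing A] (a : A)

theorem φ_altList (u : ℤˣ) (k : ℕ) :
    S.φ ((altList u k).map (signed a)).prod = S.φ (altWord a k).prod := by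
  rw [altWord_eq, prod_altList, prod_altList]
  rcases Int.units_eq_one_or u with rfl | rfl
  · rfl
  · rw [φ_mul_pow, neg_neg]

theorem φ₂_altList (u v : ℤˣ) (k l : ℕ) :
    S.φ₂ ((altList u k).map (signed a)).prod ((altList v l).map (signed a)).prod =
      S.φ₂ (altWord a k).prod (altWord a l).prod := by
  have h : ∀ (u : ℤˣ) (k : ℕ) c,
      S.φ₂ ((altList u k).map (signed a)).prod c = S.φ₂ (altWord a k).prod c := by
    intro u k c
    rw [altWord_eq, prod_altList, prod_altList]
    rcases Int.units_eq_one_or u with rfl | rfl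
    · rfl
    · rw [φ₂_mul_pow, neg_neg]
  rw [h, S.symm₂, h, S.symm₂]

variable {a}

omit [Algebra ℂ A] in
-- Indexing the signs by the positions of `w` itself avoids transport between `Fin` types of equal
-- size in the sums over `NC` and `PSNC`.
theorem exists_signs {w : List A} {δ : List ℤˣ} (hw : w = δ.map (signed a)) :
    ∃ s : Fin w.length → ℤˣ, (List.finRange w.length).map s = δ ∧ w.get = signed a ∘ s := by
  subst hw
  refine ⟨fun i => δ.get (i.cast (by simp)), ?_, ?_⟩
  · exact List.ext_getElem (by simp) fun i h1 h2 => by simp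
  · funext i; simp

omit [Algebra ℂ A] in
/-- The sum over `NC(2k)` for a function of words that is supported on the alternating ones. -/
theorem sum_NC_alternating {f : ℕ → ℂ} {K : List A → ℂ}
    (hK : ∀ δ : List ℤˣ, δ ≠ [] →
      K (δ.map (signed a)) = if EvenAlternating δ then f (δ.length / 2) else 0)
    (u : ℤˣ) (k : ℕ) {w : List A} (hw : w = (altList u k).map (signed a)) :
    ∑ π ∈ NC w.length, cycleProd π (fun c => K (c.map w.get)) =
      discWeight (discWeight f) k := by
  have hl : w.length = 2 * k := by rw [hw, List.length_map, length_altList]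
  obtain ⟨s, hs, hsw⟩ := exists_signs hw
  have h1 := isPos_finRotate_ne (s := s) (hs ▸ evenAlternating_altList u k)
  rw [← geoSum_altΦ (s := isPos s) h1 (fun x y => sameCycle_finRotate x y) f
    (by rw [Nat.card_fin, hl])]
  refine sum_NC (fun π => isClass_altΦ _ _ π) fun π x => ?_
  rw [hsw, ← List.map_map, hK, altΦ, List.length_map, sz_eq_length]
  · exact if_congr (evenAlternating_iff s π x) rfl rfl
  · rw [Ne, List.map_eq_nil_iff, ← List.length_eq_zero_iff]
    exact (length_cycleWord_pos π x).ne'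

theorem circle_castAdd {m n : ℕ} (i : Fin m) : circle m n (Fin.castAdd n i) = false := by
  simp [circle]

theorem circle_natAdd {m n : ℕ} (i : Fin n) : circle m n (Fin.natAdd m i) = true := by
  simp [circle]

theorem sameCycle_annularRotation {m n : ℕ} {x y : Fin (m + n)}
    (h : circle m n x = circle m n y) : (annularRotation m n).SameCycle x y := by
  induction x using Fin.addCases with
  | left x =>
    induction y using Fin.addCases with
    | left y => exact (annular_left _ _).2 ⟨y, rfl⟩
    | right y => simp [circle_castAdd, circle_natAdd] at h
  | right x =>
    induction y using Fin.addCases with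
    | left y => simp [circle_castAdd, circle_natAdd] at h
    | right y => exact (annular_right _ _).2 ⟨y, rfl⟩

theorem card_circle_false (m n : ℕ) : Nat.card {x // circle m n x = false} = m := by
  refine (Nat.card_congr (Equiv.ofBijective
    (fun i : Fin m => (⟨Fin.castAdd n i, circle_castAdd i⟩ : {x // circle m n x = false}))
    ⟨fun i j h => Fin.castAdd_injective m n (congrArg Subtype.val h), ?_⟩)).symm.trans (Nat.card_fin m)
  rintro ⟨x, hx⟩
  induction x using Fin.addCases with
  | left x => exact ⟨x, rfl⟩
  | right x => simp [circle_natAdd] at hx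

theorem card_circle_true (m n : ℕ) : Nat.card {x // circle m n x = true} = n := by
  refine (Nat.card_congr (Equiv.ofBijective
    (fun i : Fin n => (⟨Fin.natAdd m i, circle_natAdd i⟩ : {x // circle m n x = true}))
    ⟨fun i j h => Fin.natAdd_injective n m (congrArg Subtype.val h), ?_⟩)).symm.trans (Nat.card_fin n)
  rintro ⟨x, hx⟩
  induction x using Fin.addCases with
  | left x => simp [circle_castAdd] at hx
  | right x => exact ⟨x, rfl⟩

omit [Algebra ℂ A] in
/-- The sum over `𝒫𝒮_NC(2k,2l)` for functions of words that are supported on the alternating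
ones. -/
theorem sum_PSNC_alternating {f : ℕ → ℂ} {g : ℕ → ℕ → ℂ} {K : List A → ℂ}
    {K₂ : List A → List A → ℂ}
    (hK : ∀ δ : List ℤˣ, δ ≠ [] →
      K (δ.map (signed a)) = if EvenAlternating δ then f (δ.length / 2) else 0)
    (hK₂ : ∀ ε δ : List ℤˣ, ε ≠ [] → δ ≠ [] → K₂ (ε.map (signed a)) (δ.map (signed a)) =
      if EvenAlternating ε ∧ EvenAlternating δ then g (ε.length / 2) (δ.length / 2) else 0)
    (u u' : ℤˣ) (k l : ℕ) {v w : List A} (hv : v = (altList u k).map (signed a))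
    (hw : w = (altList u' l).map (signed a)) :
    ∑ P ∈ PSNC v.length w.length, P.blockProd (fun c => K (c.map (entries v w)))
      (fun c d => K₂ (c.map (entries v w)) (d.map (entries v w))) =
      annulusWeight (discWeight f) (annulusWeight f g) k l := by
  have hvl : v.length = 2 * k := by rw [hv, List.length_map, length_altList]
  have hwl : w.length = 2 * l := by rw [hw, List.length_map, length_altList]
  obtain ⟨s, hs, hsv⟩ := exists_signs hv
  obtain ⟨t, ht, htw⟩ := exists_signs hw
  have h1 := isPos_finRotate_ne (s := s) (hs ▸ evenAlternating_altList u k)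
  have h2 := isPos_finRotate_ne (s := t) (ht ▸ evenAlternating_altList u' l)
  set r : Fin (v.length + w.length) → ℤˣ := Fin.append s t with hr
  have he : entries v w = signed a ∘ r := by
    funext i
    rw [entries, hsv, htw]
    induction i using Fin.addCases with
    | left i => simp [hr]
    | right i => simp [hr]
  have hflip : ∀ x, isPos r (annularRotation v.length w.length x) ≠ isPos r x := by
    intro x
    rw [isPos_ne_iff]
    induction x using Fin.addCases with
    | left i =>
      rw [annularRotation, prodPerm_castAdd, hr, Fin.append_left, Fin.append_left]
      exact isPos_ne_iff.1 (h1 i)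
    | right i =>
      rw [annularRotation, prodPerm_natAdd, hr, Fin.append_right, Fin.append_right]
      exact isPos_ne_iff.1 (h2 i)
  have hne : ∀ (π : Perm (Fin (v.length + w.length))) x, (cycleWord π x).map r ≠ [] := by
    intro π x
    rw [Ne, List.map_eq_nil_iff, ← List.length_eq_zero_iff]
    exact (length_cycleWord_pos π x).ne'
  rw [← annSum_add_geoMarkedSum_altΦ hflip (circle_annularRotation _ _)
    (fun x y => sameCycle_annularRotation) f g ((card_circle_false _ _).trans hvl)
    ((card_circle_true _ _).trans hwl)]
  refine sum_PSNC (fun π => isClass_altΦ _ _ π) (fun π x => ?_)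
    (fun π y => isClass_altΨ_left _ _ π y) (fun π x => isClass_altΨ_right _ _ π x)
    fun π x y => ?_
  · rw [he, ← List.map_map, hK _ (hne π x), altΦ, List.length_map, sz_eq_length]
    exact if_congr (evenAlternating_iff r π x) rfl rfl
  · rw [he, ← List.map_map, ← List.map_map, hK₂ _ _ (hne π x) (hne π y), altΨ, List.length_map,
      List.length_map, sz_eq_length, sz_eq_length]
    exact if_congr (and_congr (evenAlternating_iff r π x) (evenAlternating_iff r π y)) rfl rfl

end RDiagonal

/-! ### The cumulants of an `R`-diagonal element and of `aa*` -/

section Cumulants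

variable {A : Type*} [Ring A] [StarRing A] [Algebra ℂ A] {S : SecondOrderSpace A} {a : A}

omit [Algebra ℂ A] in
theorem map_altList_ne_nil {u : ℤˣ} {k : ℕ} (hk : 0 < k) :
    (altList u k).map (signed a) ≠ [] := by
  rw [Ne, List.map_eq_nil_iff, ← List.length_eq_zero_iff, length_altList]
  omega

/-- The starting letter does not matter: the moment is independent of it by traciality, and the
correction involves only shorter alternating cumulants, which by induction depend on their length
alone. -/
theorem SecondOrderSpace.IsRDiagonal.cumulant_altList (ha : S.IsRDiagonal a) (u : ℤˣ) (k : ℕ) :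
    S.cumulant ((altList u k).map (signed a)) = S.β a k := by
  induction k using Nat.strong_induction_on generalizing u with
  | _ k ih =>
  rcases Nat.eq_zero_or_pos k with rfl | hk
  · rfl
  have h : ∀ u, S.cumulant ((altList u k).map (signed a)) = S.φ (altWord a k).prod -
      discWeight (discWeight fun j => if j < k then S.β a j else 0) k := by
    intro u
    rw [cumulant_eq S (map_altList_ne_nil hk), φ_altList]
    congr 1
    refine sum_NC_alternating (a := a)
      (K := fun v => if v.length < ((altList u k).map (signed a)).length then S.cumulant v else 0)
      (fun δ _ => ?_) u k rfl
    rw [List.length_map, List.length_map, length_altList]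
    by_cases hδ : EvenAlternating δ
    · obtain ⟨v, hv⟩ := eq_altList_of_evenAlternating hδ
      have hl := Nat.mul_div_cancel' hδ.1.two_dvd
      rw [if_pos hδ]
      by_cases h : δ.length / 2 < k
      · rw [if_pos h, if_pos (by omega), ← ih _ h v, ← hv]
      · rw [if_neg h, if_neg (by omega)]
    · rw [if_neg hδ, ha.first δ hδ, ite_self]
  rw [β, altWord_eq, h u, h 1]

theorem SecondOrderSpace.IsRDiagonal.cumulant_signed (ha : S.IsRDiagonal a) (δ : List ℤˣ) :
    S.cumulant (δ.map (signed a)) = if EvenAlternating δ then S.β a (δ.length / 2) else 0 := by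
  split
  · next h =>
    obtain ⟨u, hu⟩ := eq_altList_of_evenAlternating h
    rw [← ha.cumulant_altList u, ← hu]
  · next h => exact ha.first δ h

theorem pos_of_evenAlternating {δ : List ℤˣ} (h : EvenAlternating δ) (hne : δ ≠ []) :
    0 < δ.length / 2 := by
  have := List.length_pos_iff.2 hne
  have := Nat.mul_div_cancel' h.1.two_dvd
  omega

/-- As in the first order case, traciality in each variable removes the starting letters from the
moment, and induction on the total length removes them from the correction. -/
theorem SecondOrderSpace.IsRDiagonal.cumulant₂_altList (ha : S.IsRDiagonal a) {k l : ℕ}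
    (hk : 0 < k) (hl : 0 < l) (u v : ℤˣ) :
    S.cumulant₂ ((altList u k).map (signed a)) ((altList v l).map (signed a)) = S.β₂ a k l := by
  induction hN : k + l using Nat.strong_induction_on generalizing k l u v with
  | _ N ih =>
  subst hN
  have h : ∀ u v, S.cumulant₂ ((altList u k).map (signed a)) ((altList v l).map (signed a)) =
      S.φ₂ (altWord a k).prod (altWord a l).prod - annulusWeight (discWeight (S.β a))
        (annulusWeight (S.β a) fun i j => if i + j < k + l then S.β₂ a i j else 0) k l := by
    intro u v
    rw [cumulant₂_eq S (map_altList_ne_nil hk) (map_altList_ne_nil hl), φ₂_altList]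
    congr 1
    refine sum_PSNC_alternating (a := a) (K := S.cumulant)
      (K₂ := fun x y => if x.length + y.length < ((altList u k).map (signed a)).length +
        ((altList v l).map (signed a)).length then S.cumulant₂ x y else 0)
      (fun δ _ => ha.cumulant_signed δ) (fun ε δ hε hδ => ?_) u v k l rfl rfl
    rw [List.length_map, List.length_map, List.length_map, List.length_map, length_altList,
      length_altList]
    by_cases hA : EvenAlternating ε ∧ EvenAlternating δ
    · obtain ⟨x, hx⟩ := eq_altList_of_evenAlternating hA.1
      obtain ⟨y, hy⟩ := eq_altList_of_evenAlternating hA.2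
      have hl := Nat.mul_div_cancel' hA.1.1.two_dvd
      have hl' := Nat.mul_div_cancel' hA.2.1.two_dvd
      rw [if_pos hA]
      by_cases h : ε.length / 2 + δ.length / 2 < k + l
      · rw [if_pos h, if_pos (by omega), ← ih _ h (pos_of_evenAlternating hA.1 hε)
          (pos_of_evenAlternating hA.2 hδ) x y rfl, ← hx, ← hy]
      · rw [if_neg h, if_neg (by omega)]
    · rw [if_neg hA, ha.second ε δ hA, ite_self]
  rw [β₂, altWord_eq, altWord_eq, h u v, h 1 1]

theorem SecondOrderSpace.IsRDiagonal.cumulant₂_signed (ha : S.IsRDiagonal a) {ε δ : List ℤˣ}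
    (hε : ε ≠ []) (hδ : δ ≠ []) : S.cumulant₂ (ε.map (signed a)) (δ.map (signed a)) =
      if EvenAlternating ε ∧ EvenAlternating δ then S.β₂ a (ε.length / 2) (δ.length / 2)
      else 0 := by
  split
  · next h =>
    obtain ⟨u, hu⟩ := eq_altList_of_evenAlternating h.1
    obtain ⟨v, hv⟩ := eq_altList_of_evenAlternating h.2
    rw [← ha.cumulant₂_altList (pos_of_evenAlternating h.1 hε) (pos_of_evenAlternating h.2 hδ) u v,
      ← hu, ← hv]
  · next h => exact ha.second ε δ h

omit [Algebra ℂ A] in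
theorem prod_altWord (k : ℕ) : (altWord a k).prod = (List.replicate k (a * star a)).prod := by
  rw [altWord_eq, prod_altList, List.prod_replicate]
  rfl

/-- Read as a word in `a` and `a*`, the moment is a sum over alternating non-crossing permutations,
hence over chains. The outer `discWeight` is the moment-cumulant sum for aa*, the inner one its
claimed cumulant. -/
theorem SecondOrderSpace.IsRDiagonal.φ_replicate (ha : S.IsRDiagonal a) (k : ℕ) :
    S.φ (List.replicate k (a * star a)).prod = discWeight (discWeight (S.β a)) k := by
  rw [← prod_altWord, S.moment_cumulant,
    sum_NC_alternating (fun δ _ => ha.cumulant_signed δ) 1 k (altWord_eq a k)]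

theorem SecondOrderSpace.IsRDiagonal.φ₂_replicate (ha : S.IsRDiagonal a) {k l : ℕ} (hk : 0 < k)
    (hl : 0 < l) :
    S.φ₂ (List.replicate k (a * star a)).prod (List.replicate l (a * star a)).prod =
      annulusWeight (discWeight (S.β a)) (annulusWeight (S.β a) (S.β₂ a)) k l := by
  rw [← prod_altWord, ← prod_altWord, S.moment_cumulant₂,
    sum_PSNC_alternating (fun δ _ => ha.cumulant_signed δ)
      (fun ε δ hε hδ => ha.cumulant₂_signed hε hδ) 1 1 k l (altWord_eq a k) (altWord_eq a l)]
  · rw [altWord_eq]; exact map_altList_ne_nil hk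
  · rw [altWord_eq]; exact map_altList_ne_nil hl

/-- Every non-crossing partition other than the one-block partition involves only cycles shorter
than `n`, so all other terms cancel. -/
theorem eq_of_sum_NC_eq {n : ℕ} (hn : 0 < n) {f g : List (Fin n) → ℂ}
    (h : ∀ c, c ≠ [] → c.length < n → f c = g c)
    (hs : ∑ π ∈ NC n, cycleProd π f = ∑ π ∈ NC n, cycleProd π g) :
    f (List.finRange n) = g (List.finRange n) := by
  have hm : finRotate n ∈ NC n := by simp [NC, isNC_finRotate]
  rw [← Finset.add_sum_erase _ _ hm, ← Finset.add_sum_erase _ _ hm, cycleProd_finRotate hn,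
    cycleProd_finRotate hn] at hs
  refine add_right_cancel (hs.trans (congrArg _ (Finset.sum_congr rfl fun π hπ =>
    Finset.prod_congr rfl fun x _ => ?_)))
  rw [Finset.mem_erase, NC, Finset.mem_filter] at hπ
  exact (h _ (List.length_pos_iff.1 (length_cycleWord_pos π x))
    (length_cycleWord_lt hπ.2.2 hπ.1 x)).symm

theorem eq_of_sum_PSNC_eq {m n : ℕ} (hm : 0 < m) (hn : 0 < n) {f : List (Fin (m + n)) → ℂ}
    {g g' : List (Fin (m + n)) → List (Fin (m + n)) → ℂ}
    (h : ∀ c d, c.length + d.length < m + n → g c d = g' c d)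
    (hs : ∑ P ∈ PSNC m n, P.blockProd f g = ∑ P ∈ PSNC m n, P.blockProd f g') :
    g ((List.finRange m).map (Fin.castAdd n)) ((List.finRange n).map (Fin.natAdd m)) =
      g' ((List.finRange m).map (Fin.castAdd n)) ((List.finRange n).map (Fin.natAdd m)) := by
  rw [← Finset.add_sum_erase _ _ (topPair_mem hm hn), ← Finset.add_sum_erase _ _
    (topPair_mem hm hn), blockProd_topPair hm hn, blockProd_topPair hm hn] at hs
  refine add_right_cancel (hs.trans (congrArg _ (Finset.sum_congr rfl fun P hP => ?_)))
  rw [Finset.mem_erase] at hP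
  exact (blockProd_congr hP.2 hP.1 f h).symm

theorem cycleWord_ne_nil {n : ℕ} (π : Perm (Fin n)) (x : Fin n) : cycleWord π x ≠ [] :=
  List.length_pos_iff.1 (length_cycleWord_pos π x)

theorem sum_NC_length (f : ℕ → ℂ) (n : ℕ) :
    ∑ π ∈ NC n, cycleProd π (fun c => f c.length) = discWeight f n :=
  sum_NC (fun π => (isClass_sz π).comp f) fun π x => by rw [sz_eq_length]

theorem sum_PSNC_length {m n : ℕ} {f : ℕ → ℂ} {g : ℕ → ℕ → ℂ} {φ : List (Fin (m + n)) → ℂ}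
    {ψ : List (Fin (m + n)) → List (Fin (m + n)) → ℂ} (h : ∀ c, c ≠ [] → φ c = f c.length)
    (h' : ∀ c d, c ≠ [] → d ≠ [] → ψ c d = g c.length d.length) :
    ∑ P ∈ PSNC m n, P.blockProd φ ψ = annulusWeight f g m n :=
  sum_PSNC (fun π => (isClass_sz π).comp f)
    (fun π x => by rw [h _ (cycleWord_ne_nil π x), sz_eq_length])
    (fun π y => (isClass_sz π).comp fun i => g i (sz π y)) (fun π x => (isClass_sz π).comp _)
    fun π x y => by
      rw [h' _ _ (cycleWord_ne_nil π x) (cycleWord_ne_nil π y), sz_eq_length, sz_eq_length]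

theorem map_get_replicate {B : Type*} (k : ℕ) (b : B) (c : List (Fin (List.replicate k b).length)) :
    c.map (List.replicate k b).get = List.replicate c.length b := by
  refine List.ext_getElem (by simp) fun i h1 h2 => by simp

theorem map_entries_replicate {B : Type*} [Ring B] [Algebra ℂ B] (k l : ℕ) (b : B)
    (c : List (Fin ((List.replicate k b).length + (List.replicate l b).length))) :
    c.map (entries (List.replicate k b) (List.replicate l b)) = List.replicate c.length b := by
  have h : ∀ i, entries (List.replicate k b) (List.replicate l b) i = b := fun i => by
    rw [entries]
    induction i using Fin.addCases <;> simp
  refine List.ext_getElem (by simp) fun i h1 h2 => by simp [h]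

/-- The free cumulants of `aa*`. -/
theorem SecondOrderSpace.IsRDiagonal.cumulant_replicate (ha : S.IsRDiagonal a) {k : ℕ}
    (hk : 0 < k) : S.cumulant (List.replicate k (a * star a)) = discWeight (S.β a) k := by
  induction k using Nat.strong_induction_on with
  | _ k ih =>
  have h := ha.φ_replicate k
  rw [S.moment_cumulant] at h
  simp only [map_get_replicate] at h
  rw [List.length_replicate] at h
  rw [← sum_NC_length] at h
  have := eq_of_sum_NC_eq hk (fun c hc hlt => ih _ hlt (List.length_pos_iff.2 hc)) h
  simpa using this

/-- The second order cumulants of `aa*`. -/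
theorem SecondOrderSpace.IsRDiagonal.cumulant₂_replicate (ha : S.IsRDiagonal a) {k l : ℕ}
    (hk : 0 < k) (hl : 0 < l) :
    S.cumulant₂ (List.replicate k (a * star a)) (List.replicate l (a * star a)) =
      annulusWeight (S.β a) (S.β₂ a) k l := by
  induction hN : k + l using Nat.strong_induction_on generalizing k l with
  | _ N ih =>
  subst hN
  have h := ha.φ₂_replicate hk hl
  rw [S.moment_cumulant₂ _ _ (by simpa using hk.ne') (by simpa using hl.ne')] at h
  simp only [map_entries_replicate] at h
  rw [List.length_replicate, List.length_replicate] at h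
  -- The comparison ranges over all pairs of lists, but the induction hypothesis covers only
  -- positive lengths. On empty lists, which never occur as cycles, `g'` is therefore set equal to
  -- the cumulant itself.
  have := eq_of_sum_PSNC_eq hk hl (g' := fun c d => if c = [] ∨ d = [] then
      S.cumulant₂ (List.replicate c.length (a * star a)) (List.replicate d.length (a * star a))
    else annulusWeight (S.β a) (S.β₂ a) c.length d.length) (fun c d hcd => ?_)
    (h.trans (sum_PSNC_length (fun c hc => ?_) fun c d hc hd => ?_).symm)
  · simpa [hk.ne', hl.ne'] using this
  · split
    · rfl
    · next hne =>
      rw [not_or] at hne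
      exact ih _ hcd (List.length_pos_iff.2 hne.1) (List.length_pos_iff.2 hne.2) rfl
  · exact ha.cumulant_replicate (List.length_pos_iff.2 hc)
  · rw [if_neg (by simp [hc, hd])]

end Cumulants

end SecondOrderFree

end

theorem theorem3p4 {A : Type*} [Ring A] [StarRing A] [Algebra ℂ A] [StarModule ℂ A]
    (S : SecondOrderFree.SecondOrderSpace A) (a : A) (ha : S.IsRDiagonal a)
    (p q : ℕ) (hp : 1 ≤ p) (hq : 1 ≤ q) :
    S.cumulant₂ (List.replicate p (a * star a)) (List.replicate q (a * star a))
      = ∑ P ∈ SecondOrderFree.PSNC p q, S.βPair a P := by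
  rw [ha.cumulant₂_replicate hp hq]
  exact (SecondOrderFree.sum_PSNC_length (fun _ _ => rfl) fun _ _ _ _ => rfl).symm
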